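/- Let $G=\mathbb Z/r_1\mathbb Z\times\dots\times\mathbb Z/r_n\mathbb Z$ with $n\ge 1$, $r_j\ge 1$ and $r_j\mid r_{j+1}$, and let $\mathbb F_q$ be a finite field with $q\equiv 1\pmod{r_n}$. Let $\mathcal R$ be the set of non-zero integer vectors $\vec\alpha=(\alpha_1,\dots,\alpha_n)$ with $0\le\alpha_j\le r_j-1$, and let $\vec d=(d(\vec\alpha))_{\vec\alpha\in\mathcal R}$ be non-negative integers with $\sum_{\vec\alpha}\alpha_j d(\vec\alpha)\equiv 0\pmod{r_j}$ for all $j$. Let $\hat{\mathcal F}_{[\vec d]}$ be the set of pairs $(\vec c,(f_{\vec\alpha})_{\vec\alpha\in\mathcal R})$ where $\vec c\in(\mathbb F_q^*)^n$ and the $f_{\vec\alpha}\in\mathbb F_q[X]$ are monic, squarefree and pairwise coprime, such that either $\deg f_{\vec\alpha}=d(\vec\alpha)$ for all $\vec\alpha$, or, for one $\vec\beta\in\mathcal R$, $\deg f_{\vec\beta}=d(\vec\beta)-1$ and $\deg f_{\vec\alpha}=d(\vec\alpha)$ for all $\vec\alpha\ne\vec\beta$. For each $m\mid r_n$ let $\chi_m$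 be a complex multiplicative character of $\mathbb F_q^*$ of exact order $m$, with $\chi_m(0)=0$. For a vector $\vec s=(s_1,\dots,s_n)$ with $s_j\mid r_j$ put $\ell(\vec s)=\operatorname{lcm}(s_1,\dots,s_n)$ and $\Omega_{\vec s}=\{\vec\omega: 1\le\omega_j\le s_j,\ (\omega_j,s_j)=1\}$. For $(\vec c,(f_{\vec\alpha}))\in\hat{\mathcal F}_{[\vec d]}$ and $\vec\omega\in\Omega_{\vec s}$ put $$c_{(\vec s)}^{(\vec\omega)}=\prod_{j} c_j^{\,\frac{\ell(\vec s)}{s_j}\omega_j \bmod \ell(\vec s)},\qquad F_{(\vec s)}^{(\vec\omega)}(X)=c_{(\vec s)}^{(\vec\omega)}\prod_{\vec\alpha\in\mathcal R} f_{\vec\alpha}(X)^{\,\left(\sum_{j}\frac{\ell(\vec s)}{s_j}\omega_j\alpha_j\right) \bmod \ell(\vec s)},$$ where the exponents are the least non-negative residues. At the point at infinity, with $d_j=\sum_{\vec\alpha}\alpha_j\deg f_{\vec\alpha}$, put $F_{(\vec s)}^{(\vec\omega)}(\infty)=c_{(\vec s)}^{(\vec\omega)}$ if $\sum_j\frac{\ell(\vec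 s)}{s_j}\omega_jd_j\equiv0\pmod{\ell(\vec s)}$, and $F_{(\vec s)}^{(\vec\omega)}(\infty)=0$ otherwise. Let $x_1,\dots,x_{q+1}$ be the points of $\mathbb P^1(\mathbb F_q)$, and let each of $e_1,\dots,e_{q+1}$ be $0$ or of the form $|G|/s$ with $s\mid r_n$. Let $m_0=|\{i:e_i=0\}|$ and, for $s\mid r_n$, $m_s=|\{i:e_i=|G|/s\}|$. Then $$\frac{\left|\left\{(\vec c,(f_{\vec\alpha}))\in\hat{\mathcal F}_{[\vec d]}:\ \sum_{\vec s}\sum_{\vec\omega\in\Omega_{\vec s}}\chi_{\ell(\vec s)}\!\left(F_{(\vec s)}^{(\vec\omega)}(x_i)\right)=e_i,\ i=1,\dots,q+1\right\}\right|}{|\hat{\mathcal F}_{[\vec d]}|}$$ $$=\left(\frac{(|G|-1)(q+|G|)-\sum_{s\mid r_n}s\phi_G(s)+1}{|G|(q+|G|-1)}\right)^{m_0}\left(\frac{q}{|G|(q+|G|-1)}\right)^{m_1}\prod_{\substack{s\mid r_n\\ s\ne1}}\left(\frac{s\phi_G(s)}{|G|(q+|G|-1)}\right)^{m_s}\left(1+O\!\left(q^{-\frac12\min_{\vec\alpha}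 d(\vec\alpha)}\right)\right),$$ where $\phi_G(s)$ is the number of elements of order $s$ in $G$ and the implied constant depends only on $G$ (through $r_1,\dots,r_n$) and $q$. (If $\hat{\mathcal F}_{[\vec d]}$ is empty, the left side is read as $0$; for trivial $G$ the minimum over the empty set is read as $0$.) -/

import Mathlib

open Polynomial

noncomputable section

namespace AbelianCovers

variable {n : ℕ}

/-- The order `|G| = r₁ ⋯ rₙ` of `G = ℤ/r₁ × ⋯ × ℤ/rₙ`. The number of cyclic factors is written
`n + 1`, so that there is a last one. -/
def groupOrder (r : Fin (n + 1) → ℕ) : ℕ := ∏ j, r j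

/-- `φ_G(s)`: the number of elements of order `s` in `G = ∏ j, ℤ/r_j`. -/
def phiG (r : Fin (n + 1) → ℕ) (s : ℕ) : ℕ :=
  Nat.card {g : (j : Fin (n + 1)) → ZMod (r j) // addOrderOf g = s}

/-- The index set `R`: the non-zero integer vectors `α` with `0 ≤ α_j ≤ r_j - 1`. -/
abbrev Idx (r : Fin (n + 1) → ℕ) : Type :=
  {α : (j : Fin (n + 1)) → Fin (r j) // ∃ j, (α j : ℕ) ≠ 0}

/-- The vectors `s = (s_j)` with `s_j ∣ r_j` (for positive `r_j`). -/
def divVectors (r : Fin (n + 1) → ℕ) : Finset (Fin (n + 1) → ℕ) :=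
  Fintype.piFinset fun j => (r j).divisors

/-- `ℓ(s) = lcm(s_j)`. -/
def ell (s : Fin (n + 1) → ℕ) : ℕ := Finset.univ.lcm s

/-- `Ω_s`: the vectors `ω` with `1 ≤ ω_j ≤ s_j` and `gcd(ω_j, s_j) = 1`. -/
def Omega (s : Fin (n + 1) → ℕ) : Finset (Fin (n + 1) → ℕ) :=
  Fintype.piFinset fun j => (Finset.Icc 1 (s j)).filter fun w => Nat.Coprime w (s j)

variable {F : Type*} [Field F]

/-- Pairs `(c, (f_α))` of a vector of non-zero constants and a family of polynomials. -/
abbrev Datum (F : Type*) [Field F] (r : Fin (n + 1) → ℕ) : Type _ :=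
  (Fin (n + 1) → Fˣ) × (Idx r → F[X])

/-- `F̂_[d]`: the `f_α` are monic, squarefree and pairwise coprime, and either `deg f_α = d α` for
all `α`, or there is one index `β` with `deg f_β = d β - 1` (in the integers; so there is no such
family if `d β = 0`) and `deg f_α = d α` for `α ≠ β`. -/
def Fhat (F : Type*) [Field F] (r : Fin (n + 1) → ℕ) (d : Idx r → ℕ) : Set (Datum F r) :=
  {p | (∀ α, (p.2 α).Monic ∧ Squarefree (p.2 α)) ∧
    (∀ α β, α ≠ β → IsCoprime (p.2 α) (p.2 β)) ∧
    ((∀ α, (p.2 α).natDegree = d α) ∨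
      ∃ β, (p.2 β).natDegree + 1 = d β ∧ ∀ α, α ≠ β → (p.2 α).natDegree = d α)}

/-- `c_(s)^(ω) = ∏ j, c_j ^ ((ℓ(s)/s_j) ω_j mod ℓ(s))`. -/
def leadCoeff (s ω : Fin (n + 1) → ℕ) (c : Fin (n + 1) → Fˣ) : F :=
  ∏ j, (c j : F) ^ (ell s / s j * ω j % ell s)

/-- The polynomial
`F_(s)^(ω) = c_(s)^(ω) ∏ α, f_α ^ ((∑ j, (ℓ(s)/s_j) ω_j α_j) mod ℓ(s))`. -/
def Fpoly {r : Fin (n + 1) → ℕ} (s ω : Fin (n + 1) → ℕ) (p : Datum F r) : F[X] :=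
  C (leadCoeff s ω p.1) * ∏ α : Idx r, p.2 α ^ ((∑ j, ell s / s j * ω j * (α.1 j : ℕ)) % ell s)

/-- `d_j = ∑ α, α_j deg f_α`, the degree of `F_j = c_j ∏ α, f_α ^ α_j`. -/
def degF {r : Fin (n + 1) → ℕ} (p : Datum F r) (j : Fin (n + 1)) : ℕ :=
  ∑ α : Idx r, (α.1 j : ℕ) * (p.2 α).natDegree

/-- The value of `F_(s)^(ω)` at a point of `ℙ¹(F) = F ∪ {∞}`: the usual one at a finite point; at
`∞` it is `c_(s)^(ω)` if `∑ j, (ℓ(s)/s_j) ω_j d_j ≡ 0 mod ℓ(s)`, and `0` otherwise. -/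
def Fval {r : Fin (n + 1) → ℕ} (s ω : Fin (n + 1) → ℕ) (p : Datum F r) : OnePoint F → F
  | none => if ell s ∣ ∑ j, ell s / s j * ω j * degF p j then leadCoeff s ω p.1 else 0
  | some x => (Fpoly s ω p).eval x

/-- The character sum `∑ s, ∑ ω ∈ Ω_s, χ_{ℓ(s)}(F_(s)^(ω)(x))` at a point `x` of `ℙ¹(F)`. -/
def charSum {r : Fin (n + 1) → ℕ} (χ : ℕ → MulChar F ℂ) (p : Datum F r) (x : OnePoint F) : ℂ :=
  ∑ s ∈ divVectors r, ∑ ω ∈ Omega s, χ (ell s) (Fval s ω p x)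

/-- The number of points `x` of `ℙ¹(F)` with `e x = k`. -/
def mult (e : OnePoint F → ℕ) (k : ℕ) : ℕ := Nat.card {x : OnePoint F // e x = k}

/-- The main term `P₀^{m₀} P₁^{m₁} ∏_{s ∣ rₙ, s ≠ 1} P_s^{m_s}`, where `m₀` is the number of points
with `e x = 0`, `m_s` is the number of points with `e x = |G|/s`, and
`P₀ = ((|G|-1)(q+|G|) - ∑_{s ∣ rₙ} s φ_G(s) + 1) / (|G|(q+|G|-1))`, `P₁ = q / (|G|(q+|G|-1))`,
`P_s = s φ_G(s) / (|G|(q+|G|-1))` for `s ≠ 1`. -/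
def mainTerm [Fintype F] (r : Fin (n + 1) → ℕ) (e : OnePoint F → ℕ) : ℝ :=
  let q : ℝ := Fintype.card F
  let g : ℝ := groupOrder r
  let D : Finset ℕ := (r (Fin.last n)).divisors
  (((g - 1) * (q + g) - ∑ s ∈ D, (s : ℝ) * phiG r s + 1) / (g * (q + g - 1))) ^ mult e 0 *
    (q / (g * (q + g - 1))) ^ mult e (groupOrder r) *
    ∏ s ∈ D.erase 1, ((s : ℝ) * phiG r s / (g * (q + g - 1))) ^ mult e (groupOrder r / s)

end AbelianCovers

end

open AbelianCovers

/-! ### Monic polynomials with prescribed values and derivatives on `F` -/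

open Polynomial
noncomputable section
namespace AbelianCovers

/-! Local side. The pairs `(s, ω)` enumerate exactly the tuples `ψ` of characters with `ψ_j ^ r_j =
1`, the dual group of `G` (`sum_charTuple`). A point has type `none` if no `f_α` vanishes there, and
type `some α` if only `f_α` does, with a simple zero. At a point of type `τ` the tuples pairing
non-trivially with `τ` contribute zero, and the rest form a subgroup of order `N = |G| / ord τ`
(`card_annih_mul`) on which the summand is a homomorphism; so the sum is `0` or `N`. Its mean over
all local data of that type is `1` (`sum_localSum`), hence `N` occurs with frequency `1/N` and `0`
with frequency `1 - 1/N` (`card_filter_eq_frac`). At infinity the type is the index whose degree is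
lowered: the congruences on `d` give the same shape of sum, and averaging is over the constants `c`.

Global side. Away from primes of degree one, the conditions on the `f_α` are sieved; at the points
of `F`, everything depends only on the values and first derivatives. An inclusion-exclusion over
primes of degree at least two shows that the number of good tuples hardly depends on the prescribed
data, and that lowering one degree divides it by `q`, with error `q ^ (∑ d - min d / 2)`
(`abs_tupleCount_lowerDeg_sub_le`). The factor `1/q` is also the ratio between the numbers of local
data with a simple zero and without zeros (`card_typeData`), so infinity behaves like any other
point. The `q + 1` points become independent, with types weighted by `1` and `1/q`, and the main
term is a product over points (`mainTerm_eq`, `sum_weight_card_matches`).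

From absolute to relative error. Good tuples have positive density (`exists_card_goodTuple_ge`),
which bounds the denominator below. There are finitely many main terms for given `F` and `r`; a zero
one forces the counted set to be empty (`not_forall_charSum_of_mainTerm_eq_zero`), and the others
are bounded away from zero. Small `min d` is absorbed in the constant. -/

/-- The monic polynomials of degree `d` over a finite field. -/
def monics (F : Type*) [Field F] [Fintype F] (d : ℕ) : Finset F[X] :=
  Finset.univ.map (((monicEquivDegreeLT (R := F) d).trans
    (degreeLTEquiv F d).toEquiv).symm.toEmbedding.trans (Function.Embedding.subtype _))

@[simp] theorem mem_monics {F : Type*} [Field F] [Fintype F] {d : ℕ} {p : F[X]} :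
    p ∈ monics F d ↔ p.Monic ∧ p.natDegree = d := by
  simp only [monics, Finset.mem_map, Finset.mem_univ, true_and]
  constructor
  · rintro ⟨v, rfl⟩
    exact (((monicEquivDegreeLT (R := F) d).trans (degreeLTEquiv F d).toEquiv).symm v).2
  · intro h
    refine ⟨((monicEquivDegreeLT (R := F) d).trans (degreeLTEquiv F d).toEquiv) ⟨p, h⟩, ?_⟩
    simp only [Function.Embedding.trans_apply, Equiv.coe_toEmbedding, Equiv.symm_apply_apply]
    rfl

theorem card_monics {F : Type*} [Field F] [Fintype F] (d : ℕ) :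
    (monics F d).card = Fintype.card F ^ d := by
  simp [monics]

/-- The values and the values of the derivative at all points of `F`. -/
def herm (F : Type*) [Field F] : F[X] →ₗ[F] (F → F × F) where
  toFun p x := (p.eval x, p.derivative.eval x)
  map_add' p p' := by ext <;> simp
  map_smul' c p := by ext <;> simp

@[simp] theorem herm_apply {F : Type*} [Field F] (p : F[X]) (x : F) :
    herm F p x = (p.eval x, p.derivative.eval x) := rfl

variable {F : Type*} [Field F] [Fintype F]

/-- Otherwise every point of `F` would be a root of multiplicity at least two, giving `2q` roots in
all. -/
theorem eq_zero_of_herm_eq_zero {p : F[X]} (hp : herm F p = 0)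
    (hdeg : p.degree < (2 * Fintype.card F : ℕ)) : p = 0 := by
  classical
  by_contra h0
  have hmul (x : F) : 2 ≤ p.roots.count x := by
    rw [count_roots]
    have := congrFun hp x
    simp only [herm_apply, Pi.zero_apply, Prod.mk_eq_zero] at this
    exact (one_lt_rootMultiplicity_iff_isRoot h0).2 this
  have h1 : ∑ x : F, 2 ≤ p.natDegree := by
    refine le_trans ?_ p.card_roots'
    rw [← Multiset.sum_count_eq_card (s := Finset.univ) (by simp)]
    exact Finset.sum_le_sum fun x _ => hmul x
  rw [degree_eq_natDegree h0, Nat.cast_lt] at hdeg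
  simp at h1
  omega

/-- Hermite interpolation by dimension count: on degrees below `2q` the map is injective between
spaces of dimension `2q`. -/
theorem exists_herm_eq (a : F → F × F) :
    ∃ p : F[X], p.degree < (2 * Fintype.card F : ℕ) ∧ herm F p = a := by
  classical
  let N := 2 * Fintype.card F
  let φ : degreeLT F N →ₗ[F] (F → F × F) := (herm F).domRestrict _
  have hinj : Function.Injective φ := by
    rw [← LinearMap.ker_eq_bot, LinearMap.ker_eq_bot']
    rintro ⟨p, hp⟩ h
    exact Subtype.ext (eq_zero_of_herm_eq_zero h (mem_degreeLT.1 hp))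
  have hfin : FiniteDimensional F (degreeLT F N) :=
    Module.Finite.equiv (degreeLTEquiv F N).symm
  have hdim : Module.finrank F (degreeLT F N) = Module.finrank F (F → F × F) := by
    rw [(degreeLTEquiv F N).finrank_eq]
    simp [Module.finrank_pi_fintype, N, mul_comm]
  obtain ⟨p, hp⟩ := (LinearMap.injective_iff_surjective_of_finrank_eq_finrank hdim).1 hinj a
  exact ⟨p.1, mem_degreeLT.1 p.2, hp⟩

open scoped Classical in
-- Adding an interpolating polynomial of degree below `2q ≤ d` moves one fibre into the other
-- without touching the leading term.
theorem card_monics_herm_congr {d : ℕ} (hd : 2 * Fintype.card F ≤ d) (a b : F → F × F) :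
    ((monics F d).filter fun p => herm F p = a).card =
      ((monics F d).filter fun p => herm F p = b).card := by
  have key (a b : F → F × F) : ((monics F d).filter fun p => herm F p = a).card ≤
      ((monics F d).filter fun p => herm F p = b).card := by
    obtain ⟨h, hdeg, hh⟩ := exists_herm_eq (b - a)
    have hlt : h.degree < (d : ℕ) := hdeg.trans_le (by exact_mod_cast hd)
    refine Finset.card_le_card_of_injOn (fun p => p + h) ?_ (fun _ _ _ _ h' => add_right_cancel h')
    intro p hp
    simp only [Finset.coe_filter, mem_monics, Set.mem_ofPred_eq] at hp ⊢
    obtain ⟨⟨hm, hn⟩, ha⟩ := hp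
    have hpd : p.degree = d := by rw [degree_eq_natDegree hm.ne_zero, hn]
    refine ⟨⟨hm.add_of_left (hpd ▸ hlt), ?_⟩, by rw [map_add, ha, hh]; abel⟩
    rw [natDegree_add_eq_left_of_degree_lt (hpd ▸ hlt), hn]
  exact le_antisymm (key a b) (key b a)

open scoped Classical in
theorem card_monics_herm {d : ℕ} (hd : 2 * Fintype.card F ≤ d) (a : F → F × F) :
    ((monics F d).filter fun p => herm F p = a).card =
      Fintype.card F ^ (d - 2 * Fintype.card F) := by
  have h := Finset.card_eq_sum_card_fiberwise (s := monics F d) (f := herm F)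
    (t := Finset.univ) (fun _ _ => Finset.mem_coe.2 (Finset.mem_univ _))
  rw [Finset.sum_congr rfl fun b _ => card_monics_herm_congr hd b a] at h
  rw [card_monics, Finset.sum_const, smul_eq_mul, Finset.card_univ] at h
  have hc : Fintype.card (F → F × F) = Fintype.card F ^ (2 * Fintype.card F) := by
    simp [← sq, pow_mul]
  rw [hc] at h
  have hq : 0 < Fintype.card F := Fintype.card_pos
  apply Nat.eq_of_mul_eq_mul_left (pow_pos hq (2 * Fintype.card F))
  rw [← h, ← pow_add, Nat.add_sub_cancel' hd]

open scoped Classical in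
-- For `d < 2q` the truncated exponent makes the bound `1`, which is right: two members would differ
-- by a polynomial of degree below `2q` with zero data.
theorem card_monics_herm_le (d : ℕ) (a : F → F × F) :
    ((monics F d).filter fun p => herm F p = a).card ≤
      Fintype.card F ^ (d - 2 * Fintype.card F) := by
  rcases le_or_gt (2 * Fintype.card F) d with hd | hd
  · exact (card_monics_herm hd a).le
  · rw [Nat.sub_eq_zero_of_le hd.le, pow_zero, Finset.card_le_one]
    intro p hp p' hp'
    simp only [Finset.mem_filter, mem_monics] at hp hp'
    rw [← sub_eq_zero]
    refine eq_zero_of_herm_eq_zero (by rw [map_sub, hp.2, hp'.2, sub_self]) ?_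
    refine (degree_sub_le _ _).trans_lt (max_lt ?_ ?_) <;>
    · rw [degree_eq_natDegree (Monic.ne_zero (by tauto))]
      norm_cast
      omega

open scoped Classical in
/-- The number of monic multiples of `m` of degree `d` with given data. -/
def multCount (m : F[X]) (d : ℕ) (a : F → F × F) : ℕ :=
  ((monics F d).filter fun p => m ∣ p ∧ herm F p = a).card

theorem multCount_eq_zero {m : F[X]} {d : ℕ} (h : d < m.natDegree) (a : F → F × F) :
    multCount m d a = 0 := by
  classical
  rw [multCount, Finset.card_eq_zero, Finset.filter_eq_empty_iff]
  rintro p hp ⟨hdvd, -⟩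
  rw [mem_monics] at hp
  have := natDegree_le_of_dvd hdvd hp.1.ne_zero
  omega

open scoped Classical in
theorem exists_multCount_eq {m : F[X]} (hm : m.Monic) (hroot : ∀ x, m.eval x ≠ 0) {d : ℕ}
    (h : m.natDegree ≤ d) (a : F → F × F) :
    ∃ b, multCount m d a = ((monics F (d - m.natDegree)).filter fun p => herm F p = b).card := by
  -- The witness solves `m p = a.1` and `m' p + m p' = a.2` for the values of `p` and `p'`; this is
  -- possible because `m` has no root in `F`.
  refine ⟨fun x => ((a x).1 / m.eval x,
    ((a x).2 - m.derivative.eval x * ((a x).1 / m.eval x)) / m.eval x), ?_⟩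
  symm
  refine Finset.card_bij (fun p _ => m * p) ?_ ?_ ?_
  · intro p hp
    simp only [Finset.mem_filter, mem_monics] at hp ⊢
    obtain ⟨⟨h1, h2⟩, h3⟩ := hp
    refine ⟨⟨hm.mul h1, by rw [hm.natDegree_mul h1]; omega⟩, dvd_mul_right _ _, ?_⟩
    ext x
    · have := congrArg Prod.fst (congrFun h3 x)
      simp only [herm_apply] at this
      simp [this, mul_div_cancel₀ _ (hroot x)]
    · have e1 := congrArg Prod.fst (congrFun h3 x)
      have e2 := congrArg Prod.snd (congrFun h3 x)
      simp only [herm_apply] at e1 e2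
      have := hroot x
      simp only [herm_apply, derivative_mul, eval_add, eval_mul, e1, e2]
      field_simp
      ring
  · intro p _ p' _ h
    exact mul_left_cancel₀ hm.ne_zero h
  · intro f hf
    simp only [Finset.mem_filter, mem_monics] at hf
    obtain ⟨⟨h1, h2⟩, ⟨p, rfl⟩, h3⟩ := hf
    have hp : p.Monic := hm.of_mul_monic_left h1
    refine ⟨p, ?_, rfl⟩
    simp only [Finset.mem_filter, mem_monics]
    refine ⟨⟨hp, by rw [hm.natDegree_mul hp] at h2; omega⟩, ?_⟩
    subst h3
    ext x
    · simp [mul_div_cancel_left₀ _ (hroot x)]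
    · have := hroot x
      simp only [herm_apply, derivative_mul, eval_add, eval_mul]
      field_simp
      ring

/-- The difference vanishes once the cofactor of `m` has degree at least `2q` already in degree `d`.
Otherwise both terms lie in `[0, q^k]`, and both are zero when `m` is too large. The error is thus
uniform in `m`, and only the number of moduli matters in the sieve. -/
theorem abs_multCount_sub_le {m : F[X]} (hm : m.Monic) (hroot : ∀ x, m.eval x ≠ 0) (d k : ℕ)
    (a b : F → F × F) :
    |(multCount m (d + k) a : ℝ) - (Fintype.card F : ℝ) ^ k * multCount m d b| ≤
      if m.natDegree ≤ d + k then (Fintype.card F : ℝ) ^ k else 0 := by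
  classical
  have hq : 1 ≤ Fintype.card F := Fintype.card_pos
  split_ifs with h
  · obtain ⟨a', ha'⟩ := exists_multCount_eq hm hroot h a
    rcases le_or_gt m.natDegree d with hd | hd
    · obtain ⟨b', hb'⟩ := exists_multCount_eq hm hroot hd b
      rcases le_or_gt (2 * Fintype.card F) (d - m.natDegree) with h2 | h2
      · rw [ha', hb', card_monics_herm h2, card_monics_herm (by omega)]
        have : d + k - m.natDegree - 2 * Fintype.card F =
          k + (d - m.natDegree - 2 * Fintype.card F) := by omega
        rw [this]
        push_cast
        rw [pow_add, sub_self, abs_zero]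
        positivity
      · have h3 : multCount m (d + k) a ≤ Fintype.card F ^ k := by
          rw [ha']
          exact (card_monics_herm_le _ _).trans (Nat.pow_le_pow_right hq (by omega))
        have h4 : multCount m d b ≤ 1 := by
          rw [hb']
          refine (card_monics_herm_le _ _).trans ?_
          rw [Nat.sub_eq_zero_of_le h2.le, pow_zero]
        have h5 : Fintype.card F ^ k * multCount m d b ≤ Fintype.card F ^ k := by
          simpa using Nat.mul_le_mul_left (Fintype.card F ^ k) h4
        have h3' : (multCount m (d + k) a : ℝ) ≤ (Fintype.card F : ℝ) ^ k := by exact_mod_cast h3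
        have h5' : (Fintype.card F : ℝ) ^ k * multCount m d b ≤ (Fintype.card F : ℝ) ^ k := by
          exact_mod_cast h5
        exact abs_sub_le_of_nonneg_of_le (by positivity) h3' (by positivity) h5'
    · rw [multCount_eq_zero hd]
      have h3 : multCount m (d + k) a ≤ Fintype.card F ^ k := by
        rw [ha']
        exact (card_monics_herm_le _ _).trans (Nat.pow_le_pow_right hq (by omega))
      have h3' : (multCount m (d + k) a : ℝ) ≤ (Fintype.card F : ℝ) ^ k := by exact_mod_cast h3
      simpa using h3'
  · rw [multCount_eq_zero (by omega), multCount_eq_zero (by omega)]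
    simp

end AbelianCovers
end
-- The sieve over primes of degree at least two
open Polynomial
noncomputable section
namespace AbelianCovers

variable {F : Type*} [Field F] [Fintype F]

open scoped Classical in
/-- The monic irreducible polynomials of degree between `2` and `n`. -/
def primesUpTo (F : Type*) [Field F] [Fintype F] (n : ℕ) : Finset F[X] :=
  ((Finset.Icc 2 n).biUnion (monics F)).filter Irreducible

theorem mem_primesUpTo {n : ℕ} {P : F[X]} :
    P ∈ primesUpTo F n ↔ P.Monic ∧ Irreducible P ∧ 2 ≤ P.natDegree ∧ P.natDegree ≤ n := by
  classical
  simp only [primesUpTo, Finset.mem_filter, Finset.mem_biUnion, Finset.mem_Icc, mem_monics]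
  constructor
  · rintro ⟨⟨i, hi, h1, rfl⟩, h2⟩
    exact ⟨h1, h2, hi.1, hi.2⟩
  · rintro ⟨h1, h2, h3, h4⟩
    exact ⟨⟨_, ⟨h3, h4⟩, h1, rfl⟩, h2⟩

theorem eq_of_dvd_of_monic_of_irreducible {K : Type*} [Field K] {P Q : K[X]} (hP : P.Monic)
    (hQ : Q.Monic) (hP' : Irreducible P) (hQ' : Irreducible Q) (h : P ∣ Q) : P = Q :=
  eq_of_monic_of_associated hP hQ (hP'.associated_of_dvd hQ' h)

theorem isCoprime_of_monic_irreducible_ne {K : Type*} [Field K] {P Q : K[X]} (hP : P.Monic)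
    (hQ : Q.Monic) (hP' : Irreducible P) (hQ' : Irreducible Q) (h : P ≠ Q) : IsCoprime P Q :=
  (hP'.coprime_iff_not_dvd).2 fun h' =>
    h (eq_of_dvd_of_monic_of_irreducible hP hQ hP' hQ' h')

/-- `f` is squarefree and coprime to `H`, away from the primes of degree one. -/
def Good (f H : F[X]) : Prop :=
  ∀ P : F[X], P.Monic → Irreducible P → 2 ≤ P.natDegree → ¬ P ^ 2 ∣ f ∧ ¬ (P ∣ f ∧ P ∣ H)

open scoped Classical in
/-- The power of `P` excluded as a divisor in `Good f H`. -/
def excluded (H P : F[X]) : F[X] := if P ∣ H then P else P ^ 2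

/-- For a prime dividing `H`, not dividing `f` already excludes its square; for any other prime only
the square is forbidden. This leaves one modulus per prime. -/
theorem good_iff {f H : F[X]} {n : ℕ} (hf : f ≠ 0) (hn : f.natDegree ≤ n) :
    Good f H ↔ ∀ P ∈ primesUpTo F n, ¬ excluded H P ∣ f := by
  constructor
  · intro h P hP
    rw [mem_primesUpTo] at hP
    obtain ⟨h1, h2⟩ := h P hP.1 hP.2.1 hP.2.2.1
    unfold excluded
    split_ifs with h3
    · exact fun h4 => h2 ⟨h4, h3⟩
    · exact h1
  · intro h P h1 h2 h3
    by_cases h5 : P ∣ f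
    · have h6 := h P (mem_primesUpTo.2 ⟨h1, h2, h3, (natDegree_le_of_dvd h5 hf).trans hn⟩)
      unfold excluded at h6
      split_ifs at h6 with h7
      · exact absurd h5 h6
      · exact ⟨h6, fun h8 => h7 h8.2⟩
    · exact ⟨fun h6 => h5 ((dvd_pow_self P two_ne_zero).trans h6), fun h6 => h5 h6.1⟩

theorem isCoprime_excluded {F : Type*} [Field F] {H P Q : F[X]} (hP : P.Monic)
    (hQ : Q.Monic) (hP' : Irreducible P) (hQ' : Irreducible Q) (h : P ≠ Q) :
    IsCoprime (excluded H P) (excluded H Q) := by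
  have := isCoprime_of_monic_irreducible_ne hP hQ hP' hQ' h
  unfold excluded
  split_ifs
  · exact this
  · exact this.pow_right
  · exact this.pow_left
  · exact this.pow

open scoped Classical in
/-- The number of monic `f` of degree `d` with given data which are `Good` for `H`. -/
def goodCount (H : F[X]) (d : ℕ) (a : F → F × F) : ℕ :=
  ((monics F d).filter fun f => Good f H ∧ herm F f = a).card

/-- Inclusion-exclusion: expand the product of `1 - 1[excluded H P ∣ f]`, the moduli being pairwise
coprime. The bound `n` may exceed `d`, so that two different degrees can be expanded over the same
index set. -/
theorem goodCount_eq_sum (H : F[X]) {d n : ℕ} (hdn : d ≤ n) (a : F → F × F) :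
    (goodCount H d a : ℝ) = ∑ T ∈ (primesUpTo F n).powerset,
      (-1) ^ T.card * (multCount (∏ P ∈ T, excluded H P) d a : ℝ) := by
  classical
  have h1 (f : F[X]) (hf : f ∈ monics F d) : (if Good f H ∧ herm F f = a then (1 : ℝ) else 0) =
      ∑ T ∈ (primesUpTo F n).powerset, (-1) ^ T.card *
        (if (∏ P ∈ T, excluded H P) ∣ f ∧ herm F f = a then (1 : ℝ) else 0) := by
    rw [mem_monics] at hf
    by_cases ha : herm F f = a
    · simp only [ha, and_true]
      have h2 : (if Good f H then (1 : ℝ) else 0) =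
          ∏ P ∈ primesUpTo F n, (-(if excluded H P ∣ f then (1 : ℝ) else 0) + 1) := by
        rw [good_iff hf.1.ne_zero (hf.2.le.trans hdn)]
        split_ifs with h
        · rw [Finset.prod_eq_one]
          intro P hP
          simp [h P hP]
        · push Not at h
          obtain ⟨P, hP, h'⟩ := h
          rw [Finset.prod_eq_zero hP]
          simp [h']
      rw [h2, Finset.prod_add]
      refine Finset.sum_congr rfl fun T hT => ?_
      rw [Finset.mem_powerset] at hT
      rw [Finset.prod_const_one, mul_one, Finset.prod_neg, Finset.prod_ite_zero,
        Finset.prod_const_one]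
      congr 2
      apply propext
      constructor
      · intro h
        refine Finset.prod_dvd_of_coprime ?_ h
        intro P hP Q hQ hPQ
        have hP := mem_primesUpTo.1 (hT hP)
        have hQ := mem_primesUpTo.1 (hT hQ)
        exact isCoprime_excluded hP.1 hQ.1 hP.2.1 hQ.2.1 hPQ
      · intro h P hP
        exact (Finset.dvd_prod_of_mem _ hP).trans h
    · simp [ha]
  have h2 : (goodCount H d a : ℝ) =
      ∑ f ∈ monics F d, if Good f H ∧ herm F f = a then (1 : ℝ) else 0 := by
    rw [goodCount, Finset.sum_boole]
  rw [h2, Finset.sum_congr rfl h1, Finset.sum_comm]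
  refine Finset.sum_congr rfl fun T _ => ?_
  rw [← Finset.mul_sum, multCount, Finset.sum_boole]

open scoped Classical in
/-- The monic divisors of `H`. -/
def monicDivisors (H : F[X]) : Finset F[X] :=
  ((Finset.range (H.natDegree + 1)).biUnion (monics F)).filter (· ∣ H)

theorem mem_monicDivisors {H : F[X]} (hH : H ≠ 0) {E : F[X]} :
    E ∈ monicDivisors H ↔ E.Monic ∧ E ∣ H := by
  classical
  simp only [monicDivisors, Finset.mem_filter, Finset.mem_biUnion, Finset.mem_range, mem_monics]
  constructor
  · rintro ⟨⟨i, hi, h1, rfl⟩, h2⟩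
    exact ⟨h1, h2⟩
  · rintro ⟨h1, h2⟩
    exact ⟨⟨_, Nat.lt_succ_of_le (natDegree_le_of_dvd h2 hH), h1, rfl⟩, h2⟩

/-- The square root of the cardinality of `F`. -/
def sqrtq (F : Type*) [Fintype F] : ℝ := √(Fintype.card F)

theorem sqrtq_sq : sqrtq F ^ 2 = Fintype.card F := Real.sq_sqrt (by positivity)

theorem two_le_card : (2 : ℝ) ≤ Fintype.card F := by
  exact_mod_cast Fintype.one_lt_card (α := F)

theorem one_lt_sqrtq : 1 < sqrtq F := by
  rw [sqrtq, Real.lt_sqrt (by norm_num)]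
  linarith [two_le_card (F := F)]

theorem sqrtq_pos : 0 < sqrtq F := one_pos.trans one_lt_sqrtq

/-- `∑ q^{-deg E / 2}` over the monic divisors `E` of `H`. -/
def divSum (H : F[X]) : ℝ := ∑ E ∈ monicDivisors H, (sqrtq F)⁻¹ ^ E.natDegree

theorem divSum_nonneg (H : F[X]) : 0 ≤ divSum H :=
  Finset.sum_nonneg fun _ _ => pow_nonneg (inv_nonneg.2 sqrtq_pos.le) _

theorem card_monics_le_card (m : ℕ) :
    ∑ i ∈ Finset.range (m + 1), Fintype.card F ^ i ≤ 2 * Fintype.card F ^ m := by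
  have hq : 2 ≤ Fintype.card F := Fintype.one_lt_card (α := F)
  induction m with
  | zero => simp
  | succ m ih =>
    rw [Finset.sum_range_succ]
    have : 2 * Fintype.card F ^ m ≤ Fintype.card F ^ (m + 1) := by
      rw [pow_succ']
      exact Nat.mul_le_mul_right _ hq
    omega

theorem natDegree_prod_excluded {F : Type*} [Field F] (H : F[X]) (T : Finset F[X]) (hT : ∀ P ∈ T, P.Monic) :
    (∏ P ∈ T, excluded H P).natDegree = (by classical exact
      (∏ P ∈ T with P ∣ H, P).natDegree + 2 * (∏ P ∈ T with ¬ P ∣ H, P).natDegree) := by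
  classical
  have h1 : ∏ P ∈ T, excluded H P =
      (∏ P ∈ T with P ∣ H, P) * (∏ P ∈ T with ¬ P ∣ H, P) ^ 2 := by
    rw [← Finset.prod_filter_mul_prod_filter_not T (· ∣ H), ← Finset.prod_pow]
    congr 1
    · exact Finset.prod_congr rfl fun P hP => by simp [excluded, (Finset.mem_filter.1 hP).2]
    · exact Finset.prod_congr rfl fun P hP => by simp [excluded, (Finset.mem_filter.1 hP).2]
  have h2 : (∏ P ∈ T with P ∣ H, P).Monic :=
    monic_prod_of_monic _ _ fun P hP => hT P (Finset.mem_filter.1 hP).1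
  have h3 : (∏ P ∈ T with ¬ P ∣ H, P).Monic :=
    monic_prod_of_monic _ _ fun P hP => hT P (Finset.mem_filter.1 hP).1
  rw [h1, h2.natDegree_mul (h3.pow 2), h3.natDegree_pow]

open scoped Classical in
-- A set `T` is encoded by `E`, the product of its primes dividing `H`, and `A`, the product of the
-- others, with `deg E + 2 deg A ≤ y`. For each `E` there are at most `2 q ^ ((y - deg E) / 2)`
-- choices of `A`.
theorem card_sieve_le {H : F[X]} (hH : H ≠ 0) (n y : ℕ) :
    (((primesUpTo F n).powerset.filter
      fun T => (∏ P ∈ T, excluded H P).natDegree ≤ y).card : ℝ) ≤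
      2 * sqrtq F ^ y * divSum H := by
  let target : Finset (Σ _ : F[X], F[X]) := (monicDivisors H).sigma fun E =>
    if E.natDegree ≤ y then (Finset.range ((y - E.natDegree) / 2 + 1)).biUnion (monics F) else ∅
  have hcard : ((primesUpTo F n).powerset.filter
      fun T => (∏ P ∈ T, excluded H P).natDegree ≤ y).card ≤ target.card := by
    refine Finset.card_le_card_of_injOn
      (fun T => ⟨∏ P ∈ T with P ∣ H, P, ∏ P ∈ T with ¬ P ∣ H, P⟩) ?_ ?_
    · intro T hT
      simp only [Finset.coe_filter, Finset.mem_powerset, Set.mem_ofPred_eq] at hT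
      have hm : ∀ P ∈ T, P.Monic := fun P hP => (mem_primesUpTo.1 (hT.1 hP)).1
      have h1 := hT.2
      rw [natDegree_prod_excluded H T hm] at h1
      simp only [Finset.coe_sigma, Set.mem_sigma_iff, Finset.mem_coe, target]
      refine ⟨(mem_monicDivisors hH).2 ⟨monic_prod_of_monic _ _ fun P hP =>
        hm P (Finset.mem_filter.1 hP).1, Finset.prod_dvd_of_coprime ?_ fun P hP =>
          (Finset.mem_filter.1 hP).2⟩, ?_⟩
      · intro P hP Q hQ hPQ
        have hP := mem_primesUpTo.1 (hT.1 (Finset.mem_filter.1 hP).1)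
        have hQ := mem_primesUpTo.1 (hT.1 (Finset.mem_filter.1 hQ).1)
        exact isCoprime_of_monic_irreducible_ne hP.1 hQ.1 hP.2.1 hQ.2.1 hPQ
      · rw [if_pos (by omega)]
        simp only [Finset.mem_biUnion, Finset.mem_range, mem_monics]
        exact ⟨_, by omega, monic_prod_of_monic _ _ fun P hP =>
          hm P (Finset.mem_filter.1 hP).1, rfl⟩
    -- The encoding is injective because `T` is the set of primes dividing `E A`.
    · have hmem (T : Finset F[X]) (hT : T ⊆ primesUpTo F n) (P : F[X])
          (hP : P ∈ primesUpTo F n) :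
          P ∈ T ↔ P ∣ (∏ P ∈ T with P ∣ H, P) * (∏ P ∈ T with ¬ P ∣ H, P) := by
        rw [Finset.prod_filter_mul_prod_filter_not]
        constructor
        · exact fun h => Finset.dvd_prod_of_mem (fun P => P) h
        · intro h
          rw [mem_primesUpTo] at hP
          obtain ⟨Q, hQ, hd⟩ := (hP.2.1.prime.dvd_finsetProd_iff _).1 h
          have hQ' := mem_primesUpTo.1 (hT hQ)
          rwa [eq_of_dvd_of_monic_of_irreducible hP.1 hQ'.1 hP.2.1 hQ'.2.1 hd]
      intro T hT T' hT' h
      simp only [Finset.coe_filter, Finset.mem_powerset, Set.mem_ofPred_eq] at hT hT'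
      simp only [Sigma.mk.injEq, heq_eq_eq] at h
      ext P
      constructor
      · intro hP
        rw [hmem T' hT'.1 P (hT.1 hP), ← h.1, ← h.2, ← hmem T hT.1 P (hT.1 hP)]
        exact hP
      · intro hP
        rw [hmem T hT.1 P (hT'.1 hP), h.1, h.2, ← hmem T' hT'.1 P (hT'.1 hP)]
        exact hP
  refine (Nat.cast_le.2 hcard).trans ?_
  rw [Finset.card_sigma, divSum, Finset.mul_sum]
  push_cast
  refine Finset.sum_le_sum fun E _ => ?_
  split_ifs with h
  · set m := (y - E.natDegree) / 2 with hm
    have h1 : ((Finset.range (m + 1)).biUnion (monics F)).card ≤ 2 * Fintype.card F ^ m := by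
      refine Finset.card_biUnion_le.trans (le_trans (le_of_eq ?_) (card_monics_le_card m))
      exact Finset.sum_congr rfl fun i _ => card_monics i
    refine (Nat.cast_le.2 h1).trans ?_
    push_cast
    rw [← sqrtq_sq, ← pow_mul, mul_assoc]
    gcongr
    have h2 : sqrtq F ^ y * (sqrtq F)⁻¹ ^ E.natDegree = sqrtq F ^ (y - E.natDegree) := by
      rw [inv_pow, pow_sub₀ _ sqrtq_pos.ne' h]
    rw [h2]
    exact pow_le_pow_right₀ one_lt_sqrtq.le (by omega)
  · have := sqrtq_pos (F := F)
    simp only [Finset.card_empty, Nat.cast_zero]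
    positivity

/-- The two expansions are compared term by term. The moduli have no roots in `F`, since their
primes have degree at least two; only those of degree at most `d + k` contribute, each at most
`q^k`. -/
theorem abs_goodCount_sub_le {H : F[X]} (hH : H ≠ 0) (d k : ℕ) (a b : F → F × F) :
    |(goodCount H (d + k) a : ℝ) - (Fintype.card F : ℝ) ^ k * goodCount H d b| ≤
      2 * (Fintype.card F : ℝ) ^ k * sqrtq F ^ (d + k) * divSum H := by
  classical
  rw [goodCount_eq_sum H le_rfl, goodCount_eq_sum H (Nat.le_add_right d k), Finset.mul_sum,
    ← Finset.sum_sub_distrib]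
  refine (Finset.abs_sum_le_sum_abs _ _).trans ?_
  have h1 (T : Finset F[X]) (hT : T ∈ (primesUpTo F (d + k)).powerset) :
      |(-1) ^ T.card * (multCount (∏ P ∈ T, excluded H P) (d + k) a : ℝ) -
        (Fintype.card F : ℝ) ^ k * ((-1) ^ T.card *
          (multCount (∏ P ∈ T, excluded H P) d b : ℝ))| ≤
      if (∏ P ∈ T, excluded H P).natDegree ≤ d + k then (Fintype.card F : ℝ) ^ k else 0 := by
    rw [mul_left_comm, ← mul_sub, abs_mul, abs_pow, abs_neg, abs_one, one_pow, one_mul]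
    rw [Finset.mem_powerset] at hT
    refine abs_multCount_sub_le (monic_prod_of_monic _ _ fun P hP => ?_) (fun x => ?_) _ _ _ _
    · have := (mem_primesUpTo.1 (hT hP)).1
      unfold excluded
      split_ifs
      · exact this
      · exact this.pow 2
    · rw [eval_prod, Finset.prod_ne_zero_iff]
      intro P hP
      obtain ⟨-, h2, h3, -⟩ := mem_primesUpTo.1 (hT hP)
      have h4 : P.eval x ≠ 0 := by
        intro h
        have : P.natDegree = 1 :=
          natDegree_eq_of_degree_eq_some (degree_eq_one_of_irreducible_of_root h2 h)
        omega
      unfold excluded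
      split_ifs
      · exact h4
      · rw [eval_pow]
        exact pow_ne_zero 2 h4
  refine (Finset.sum_le_sum h1).trans ?_
  rw [← Finset.sum_filter, Finset.sum_const, nsmul_eq_mul]
  refine (mul_le_mul_of_nonneg_right (card_sieve_le hH _ _) (by positivity)).trans (le_of_eq ?_)
  ring

/-- Each monic divisor of `H * K` splits into monic divisors of `H` and of `K`, and the weights are
multiplicative. -/
theorem divSum_mul_le {H K : F[X]} (hH : H ≠ 0) (hK : K ≠ 0) :
    divSum (H * K) ≤ divSum H * divSum K := by
  classical
  rw [divSum, divSum, divSum, Finset.sum_mul_sum, ← Finset.sum_product']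
  have h1 : monicDivisors (H * K) ⊆
      (monicDivisors H ×ˢ monicDivisors K).image fun p => p.1 * p.2 := by
    intro E hE
    obtain ⟨hm, hd⟩ := (mem_monicDivisors (mul_ne_zero hH hK)).1 hE
    obtain ⟨A, B, hA, hB, rfl⟩ := exists_dvd_and_dvd_of_dvd_mul hd
    have hA0 : A ≠ 0 := left_ne_zero_of_mul hm.ne_zero
    have hB0 : B ≠ 0 := right_ne_zero_of_mul hm.ne_zero
    refine Finset.mem_image.2 ⟨(normalize A, normalize B), Finset.mem_product.2
      ⟨(mem_monicDivisors hH).2 ⟨monic_normalize hA0, normalize_dvd_iff.2 hA⟩,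
      (mem_monicDivisors hK).2 ⟨monic_normalize hB0, normalize_dvd_iff.2 hB⟩⟩, ?_⟩
    simp only
    rw [← normalize_mul, hm.normalize_eq_self]
  have hnn (E : F[X]) : 0 ≤ (sqrtq F)⁻¹ ^ E.natDegree := pow_nonneg (inv_nonneg.2 sqrtq_pos.le) _
  refine (Finset.sum_le_sum_of_subset_of_nonneg h1 fun E _ _ => hnn E).trans ?_
  refine (Finset.sum_image_le_of_nonneg fun E _ => hnn _).trans (le_of_eq ?_)
  refine Finset.sum_congr rfl fun p hp => ?_
  rw [Finset.mem_product, mem_monicDivisors hH, mem_monicDivisors hK] at hp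
  rw [hp.1.1.natDegree_mul hp.2.1, pow_add]

theorem divSum_one : divSum (1 : F[X]) = 1 := by
  have : monicDivisors (1 : F[X]) = {1} := by
    ext E
    rw [mem_monicDivisors one_ne_zero, Finset.mem_singleton]
    constructor
    · rintro ⟨h1, h2⟩
      exact h1.eq_one_of_isUnit (isUnit_of_dvd_one h2)
    · rintro rfl
      exact ⟨monic_one, dvd_rfl⟩
  simp [divSum, this]

theorem divSum_prod_le {ι : Type*} (s : Finset ι) (f : ι → F[X]) (hf : ∀ i ∈ s, f i ≠ 0) :
    divSum (∏ i ∈ s, f i) ≤ ∏ i ∈ s, divSum (f i) := by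
  classical
  induction s using Finset.induction_on with
  | empty => simp [divSum_one]
  | insert i s hi ih =>
    rw [Finset.prod_insert hi, Finset.prod_insert hi]
    have h2 : ∀ j ∈ s, f j ≠ 0 := fun j hj => hf j (Finset.mem_insert_of_mem hj)
    refine (divSum_mul_le (hf i (Finset.mem_insert_self _ _)) (Finset.prod_ne_zero_iff.2 h2)).trans
      (mul_le_mul_of_nonneg_left (ih h2) (divSum_nonneg _))

open scoped Classical in
theorem card_monics_filter_dvd {E : F[X]} (hE : E.Monic) {d : ℕ} (h : E.natDegree ≤ d) :
    ((monics F d).filter fun f => E ∣ f).card = Fintype.card F ^ (d - E.natDegree) := by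
  rw [← card_monics]
  symm
  refine Finset.card_bij (fun p _ => E * p) ?_ ?_ ?_
  · intro p hp
    simp only [Finset.mem_filter, mem_monics] at hp ⊢
    exact ⟨⟨hE.mul hp.1, by rw [hE.natDegree_mul hp.1]; omega⟩, dvd_mul_right _ _⟩
  · intro p _ p' _ h
    exact mul_left_cancel₀ hE.ne_zero h
  · intro f hf
    simp only [Finset.mem_filter, mem_monics] at hf
    obtain ⟨⟨h1, h2⟩, ⟨p, rfl⟩⟩ := hf
    have hp : p.Monic := hE.of_mul_monic_left h1
    exact ⟨p, mem_monics.2 ⟨hp, by rw [hE.natDegree_mul hp] at h2; omega⟩, rfl⟩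

/-- Interchanging the sums, the `q^e` divisors of degree `e` have `q^(d-e)` multiples each, of
weight `q^(-e/2)`; what remains is `q^d` times a geometric series. So the sieve error stays bounded
on average over `H`. -/
theorem sum_divSum_le (d : ℕ) :
    ∑ f ∈ monics F d, divSum f ≤ 4 * (Fintype.card F : ℝ) ^ d := by
  classical
  have hs := sqrtq_pos (F := F)
  have h1 : ∑ f ∈ monics F d, divSum f = ∑ e ∈ Finset.range (d + 1), ∑ E ∈ monics F e,
      (sqrtq F)⁻¹ ^ e * (((monics F d).filter fun f => E ∣ f).card : ℝ) := by
    have h2 (f : F[X]) (hf : f ∈ monics F d) : divSum f = ∑ e ∈ Finset.range (d + 1),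
        ∑ E ∈ monics F e, if E ∣ f then (sqrtq F)⁻¹ ^ e else 0 := by
      rw [mem_monics] at hf
      rw [divSum, monicDivisors, hf.2, Finset.sum_filter, Finset.sum_biUnion]
      · refine Finset.sum_congr rfl fun e _ => Finset.sum_congr rfl fun E hE => ?_
        rw [(mem_monics.1 hE).2]
      · intro i _ j _ hij
        rw [Function.onFun, Finset.disjoint_left]
        intro p hp hp'
        exact hij ((mem_monics.1 hp).2.symm.trans (mem_monics.1 hp').2)
    rw [Finset.sum_congr rfl h2, Finset.sum_comm]
    refine Finset.sum_congr rfl fun e _ => ?_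
    rw [Finset.sum_comm]
    refine Finset.sum_congr rfl fun E _ => ?_
    rw [← Finset.sum_filter, Finset.sum_const, nsmul_eq_mul, mul_comm]
  have h3 : ∑ f ∈ monics F d, divSum f =
      ∑ e ∈ Finset.range (d + 1), (sqrtq F)⁻¹ ^ e * (Fintype.card F : ℝ) ^ d := by
    rw [h1]
    refine Finset.sum_congr rfl fun e he => ?_
    have hed : e ≤ d := Nat.lt_succ_iff.1 (Finset.mem_range.1 he)
    have h4 (E : F[X]) (hE : E ∈ monics F e) :
        (sqrtq F)⁻¹ ^ e * (((monics F d).filter fun f => E ∣ f).card : ℝ) =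
          (sqrtq F)⁻¹ ^ e * (Fintype.card F : ℝ) ^ (d - e) := by
      rw [mem_monics] at hE
      rw [card_monics_filter_dvd hE.1 (hE.2.le.trans hed), hE.2]
      push_cast
      rfl
    rw [Finset.sum_congr rfl h4, Finset.sum_const, card_monics, nsmul_eq_mul]
    push_cast
    rw [mul_left_comm, ← pow_add, Nat.add_sub_cancel' hed]
  rw [h3, ← Finset.sum_mul]
  refine mul_le_mul_of_nonneg_right ?_ (by positivity)
  -- A rational bound for `q^(-1/2) ≤ 2^(-1/2)`; the geometric series of ratio `3/4` has sum `4`.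
  have h5 : (sqrtq F)⁻¹ ≤ 3 / 4 := by
    rw [inv_le_comm₀ hs (by norm_num)]
    refine Real.le_sqrt_of_sq_le ?_
    have := two_le_card (F := F)
    norm_num
    linarith
  have h6 : (sqrtq F)⁻¹ < 1 := by linarith
  calc ∑ e ∈ Finset.range (d + 1), (sqrtq F)⁻¹ ^ e ≤ ∑ e ∈ Finset.range (d + 1), (3 / 4 : ℝ) ^ e := by
        gcongr
    _ ≤ 4 := by
        rw [geom_sum_eq (by norm_num)]
        have : (0 : ℝ) < (3 / 4) ^ (d + 1) := by positivity
        rw [div_le_iff_of_neg (by norm_num)]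
        linarith

end AbelianCovers
end
-- Good tuples: independence of the data and effect of lowering a degree
open Polynomial
noncomputable section
namespace AbelianCovers

variable {F : Type*} [Field F] [Fintype F]

/-- The entries of `f` are squarefree and pairwise coprime, away from the primes of degree one. -/
def GoodTuple {ι : Type*} (f : ι → F[X]) : Prop :=
  ∀ P : F[X], P.Monic → Irreducible P → 2 ≤ P.natDegree →
    (∀ α, ¬ P ^ 2 ∣ f α) ∧ ∀ α β, α ≠ β → ¬ (P ∣ f α ∧ P ∣ f β)

variable {ι : Type*} [Fintype ι] [DecidableEq ι]

/-- Tuples of monic polynomials of given degrees. -/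
def tuples (F : Type*) [Field F] [Fintype F] (d : ι → ℕ) : Finset (ι → F[X]) :=
  Fintype.piFinset fun α => monics F (d α)

theorem mem_tuples {d : ι → ℕ} {f : ι → F[X]} :
    f ∈ tuples F d ↔ ∀ α, (f α).Monic ∧ (f α).natDegree = d α := by
  simp [tuples]

open scoped Classical in
/-- The number of good tuples of monic polynomials with given degrees and given data. -/
def tupleCount (d : ι → ℕ) (a : ι → F → F × F) : ℕ :=
  ((tuples F d).filter fun f => GoodTuple f ∧ ∀ α, herm F (f α) = a α).card

theorem goodTuple_iff {F : Type*} [Field F] (α : ι) (f : ι → F[X]) :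
    GoodTuple f ↔ GoodTuple (fun β : {β // β ≠ α} => f β) ∧
      Good (f α) (∏ β : {β // β ≠ α}, f β) := by
  constructor
  · intro h
    refine ⟨fun P h1 h2 h3 => ⟨fun β => (h P h1 h2 h3).1 β, fun β γ hβγ =>
      (h P h1 h2 h3).2 β γ fun h => hβγ (Subtype.ext h)⟩, fun P h1 h2 h3 =>
      ⟨(h P h1 h2 h3).1 α, ?_⟩⟩
    rintro ⟨h4, h5⟩
    obtain ⟨β, -, h6⟩ := (h2.prime.dvd_finsetProd_iff _).1 h5
    exact (h P h1 h2 h3).2 α β β.2.symm ⟨h4, h6⟩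
  · rintro ⟨h, h'⟩ P h1 h2 h3
    obtain ⟨h4, h5⟩ := h P h1 h2 h3
    obtain ⟨h6, h7⟩ := h' P h1 h2 h3
    have h8 (β : ι) (hβ : β ≠ α) : ¬ (P ∣ f α ∧ P ∣ f β) := by
      intro h9
      have h10 : f β ∣ ∏ β : {β // β ≠ α}, f β :=
        Finset.dvd_prod_of_mem (fun β : {β // β ≠ α} => f β)
          (Finset.mem_univ (⟨β, hβ⟩ : {β // β ≠ α}))
      exact h7 ⟨h9.1, h9.2.trans h10⟩
    refine ⟨fun β => ?_, fun β γ hβγ => ?_⟩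
    · by_cases hβ : β = α
      · exact hβ ▸ h6
      · exact h4 ⟨β, hβ⟩
    · by_cases hβ : β = α
      · subst hβ
        exact h8 γ hβγ.symm
      · by_cases hγ : γ = α
        · subst hγ
          exact fun h => h8 β hβγ h.symm
        · exact h5 ⟨β, hβ⟩ ⟨γ, hγ⟩ fun h => hβγ (congrArg Subtype.val h)

open scoped Classical in
-- Isolating the entry at `α` reduces tuples to the sieve for one polynomial, with `H` the product
-- of the other entries.
theorem tupleCount_eq_sum (α : ι) (d : ι → ℕ) (a : ι → F → F × F) :
    tupleCount d a = ∑ g ∈ (tuples F fun β : {β // β ≠ α} => d β).filter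
      (fun g : {β // β ≠ α} → F[X] => GoodTuple g ∧ ∀ β, herm F (g β) = a β), goodCount (∏ β, g β) (d α) (a α) := by
  simp only [goodCount]
  rw [← Finset.card_sigma, tupleCount]
  refine Finset.card_bij (fun f _ => ⟨fun β => f β, f α⟩) ?_ ?_ ?_
  · intro f hf
    simp only [Finset.mem_filter, mem_tuples, Finset.mem_sigma, mem_monics] at hf ⊢
    obtain ⟨h1, h2, h3⟩ := hf
    rw [goodTuple_iff α] at h2
    exact ⟨⟨fun β => h1 β, h2.1, fun β => h3 β⟩, h1 α, h2.2, h3 α⟩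
  · intro f _ f' _ h
    simp only [Sigma.mk.injEq, heq_eq_eq] at h
    funext β
    by_cases hβ : β = α
    · rw [hβ, h.2]
    · exact congrFun h.1 ⟨β, hβ⟩
  · rintro ⟨g, p⟩ h
    simp only [Finset.mem_filter, mem_tuples, Finset.mem_sigma, mem_monics] at h
    obtain ⟨⟨h1, h2, h3⟩, h4, h5, h6⟩ := h
    let f : ι → F[X] := fun β => if hβ : β = α then p else g ⟨β, hβ⟩
    have hα : f α = p := by simp [f]
    have hg (β : {β // β ≠ α}) : f β = g β := by simp [f, β.2]
    have hg' : (fun β : {β // β ≠ α} => f β) = g := funext hg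
    refine ⟨f, ?_, ?_⟩
    · simp only [Finset.mem_filter, mem_tuples]
      refine ⟨fun β => ?_, (goodTuple_iff α f).2 ⟨by rwa [hg'], ?_⟩, fun β => ?_⟩
      · by_cases hβ : β = α
        · rw [hβ, hα]
          exact h4
        · exact hg ⟨β, hβ⟩ ▸ h1 ⟨β, hβ⟩
      · rw [hα, Finset.prod_congr rfl fun β _ => hg β]
        exact h5
      · by_cases hβ : β = α
        · rw [hβ, hα]
          exact h6
        · exact hg ⟨β, hβ⟩ ▸ h3 ⟨β, hβ⟩
    · rw [hα, hg']

theorem sum_prod_divSum_le (d : ι → ℕ) :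
    ∑ g ∈ tuples F d, ∏ β, divSum (g β) ≤
      4 ^ Fintype.card ι * (Fintype.card F : ℝ) ^ ∑ β, d β := by
  rw [tuples, ← Finset.prod_univ_sum, ← Finset.prod_pow_eq_pow_sum, ← Finset.card_univ,
    ← Finset.prod_const, ← Finset.prod_mul_distrib]
  exact Finset.prod_le_prod (fun β _ => Finset.sum_nonneg fun f _ => divSum_nonneg f)
    fun β _ => sum_divSum_le (d β)

/-- The sieve error is summed over the other entries, where `divSum` is bounded on average. Only the
entry at `α` shows square-root cancellation, whence the factor `q^(-e α / 2)`. -/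
theorem abs_tupleCount_sub_le_of_eq_off (α : ι) (k : ℕ) {d e : ι → ℕ} {a b : ι → F → F × F}
    (hde : ∀ β, β ≠ α → e β = d β) (hα : e α = d α + k) (hab : ∀ β, β ≠ α → a β = b β) :
    |(tupleCount e a : ℝ) - (Fintype.card F : ℝ) ^ k * tupleCount d b| ≤
      2 * 4 ^ Fintype.card ι * (Fintype.card F : ℝ) ^ k *
        ((Fintype.card F : ℝ) ^ (∑ β, e β) * (sqrtq F)⁻¹ ^ e α) := by
  classical
  have hs := sqrtq_pos (F := F)
  have h1 : (fun β : {β // β ≠ α} => e β) = fun β : {β // β ≠ α} => d β :=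
    funext fun β => hde β β.2
  have h2 : (fun g : {β // β ≠ α} → F[X] => GoodTuple g ∧ ∀ β, herm F (g β) = a β) =
      fun g : {β // β ≠ α} → F[X] => GoodTuple g ∧ ∀ β, herm F (g β) = b β := by
    funext g
    exact propext (and_congr_right fun _ => forall_congr' fun β => by rw [hab β β.2])
  rw [tupleCount_eq_sum α, tupleCount_eq_sum α d, h1]
  simp only [h2]
  push_cast
  rw [Finset.mul_sum, ← Finset.sum_sub_distrib, hα]
  refine (Finset.abs_sum_le_sum_abs _ _).trans ?_
  have h3 (g : {β // β ≠ α} → F[X])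
      (hg : g ∈ tuples F fun β : {β // β ≠ α} => d β) :
      |(goodCount (∏ β, g β) (d α + k) (a α) : ℝ) -
        (Fintype.card F : ℝ) ^ k * goodCount (∏ β, g β) (d α) (b α)| ≤
      2 * (Fintype.card F : ℝ) ^ k * sqrtq F ^ (d α + k) * ∏ β, divSum (g β) := by
    rw [mem_tuples] at hg
    have h0 : ∀ β ∈ Finset.univ, g β ≠ 0 := fun β _ => (hg β).1.ne_zero
    refine (abs_goodCount_sub_le (Finset.prod_ne_zero_iff.2 h0) _ _ _ _).trans ?_
    exact mul_le_mul_of_nonneg_left (divSum_prod_le _ _ h0) (by positivity)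
  refine (Finset.sum_le_sum fun g hg => h3 g (Finset.mem_filter.1 hg).1).trans ?_
  rw [← Finset.mul_sum]
  have h4 : ∑ g ∈ (tuples F fun β : {β // β ≠ α} => d β).filter
      (fun g : {β // β ≠ α} → F[X] => GoodTuple g ∧ ∀ β, herm F (g β) = b β), ∏ β, divSum (g β) ≤
      4 ^ Fintype.card ι * (Fintype.card F : ℝ) ^ ∑ β : {β // β ≠ α}, d β := by
    refine (Finset.sum_le_sum_of_subset_of_nonneg (Finset.filter_subset _ _) fun g _ _ =>
      Finset.prod_nonneg fun β _ => divSum_nonneg _).trans ((sum_prod_divSum_le _).trans ?_)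
    refine mul_le_mul_of_nonneg_right ?_ (by positivity)
    exact pow_le_pow_right₀ (by norm_num) (Fintype.card_subtype_le _)
  refine (mul_le_mul_of_nonneg_left h4 (by positivity)).trans (le_of_eq ?_)
  have h5 : ∑ β, e β = ∑ β : {β // β ≠ α}, d β + (d α + k) := by
    rw [← hα, ← Finset.add_sum_erase _ _ (Finset.mem_univ α), add_comm]
    congr 1
    rw [Finset.sum_subtype (Finset.univ.erase α) (p := fun β => β ≠ α) (by simp)]
    exact Finset.sum_congr rfl fun β _ => hde β β.2
  have h6 : (Fintype.card F : ℝ) ^ (d α + k) = sqrtq F ^ (d α + k) * sqrtq F ^ (d α + k) := by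
    rw [← sqrtq_sq (F := F), ← pow_mul, two_mul, pow_add]
  have : sqrtq F ^ (d α + k) ≠ 0 := pow_ne_zero _ hs.ne'
  rw [h5, pow_add _ _ (d α + k), h6, inv_pow]
  field_simp

/-- The constant in the comparison of the numbers of good tuples. -/
def cmpConst (F ι : Type*) [Fintype F] [Fintype ι] : ℝ :=
  2 * 4 ^ Fintype.card ι * (Fintype.card ι + Fintype.card F)

/-- The data are exchanged one entry at a time, passing through `S.piecewise b a`. -/
theorem abs_tupleCount_sub_le {d : ι → ℕ} {m : ℕ} (hm : ∀ α, m ≤ d α) (a b : ι → F → F × F) :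
    |(tupleCount d a : ℝ) - tupleCount d b| ≤ Fintype.card ι * (2 * 4 ^ Fintype.card ι *
        ((Fintype.card F : ℝ) ^ (∑ β, d β) * (sqrtq F)⁻¹ ^ m)) := by
  have hs := sqrtq_pos (F := F)
  have hs1 : (sqrtq F)⁻¹ ≤ 1 := inv_le_one_of_one_le₀ one_lt_sqrtq.le
  suffices h : ∀ S : Finset ι, |(tupleCount d a : ℝ) - tupleCount d (S.piecewise b a)| ≤
      S.card * (2 * 4 ^ Fintype.card ι *
        ((Fintype.card F : ℝ) ^ (∑ β, d β) * (sqrtq F)⁻¹ ^ m)) by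
    simpa using h Finset.univ
  intro S
  induction S using Finset.induction_on with
  | empty => simp
  | insert α S hα ih =>
    have h1 := abs_tupleCount_sub_le_of_eq_off α 0 (d := d) (e := d) (a := S.piecewise b a)
      (b := (insert α S).piecewise b a) (fun _ _ => rfl) rfl (fun β hβ => by
        by_cases h : β ∈ S <;> simp [h, hβ])
    rw [pow_zero, one_mul, mul_one] at h1
    have h2 : (sqrtq F)⁻¹ ^ d α ≤ (sqrtq F)⁻¹ ^ m :=
      pow_le_pow_of_le_one (inv_nonneg.2 hs.le) hs1 (hm α)
    have h3 : 2 * 4 ^ Fintype.card ι * ((Fintype.card F : ℝ) ^ (∑ β, d β) * (sqrtq F)⁻¹ ^ d α) ≤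
      2 * 4 ^ Fintype.card ι * ((Fintype.card F : ℝ) ^ (∑ β, d β) * (sqrtq F)⁻¹ ^ m) := by gcongr
    rw [Finset.card_insert_of_notMem hα]
    push_cast
    rw [add_mul, one_mul]
    exact (abs_sub_le _ _ _).trans (add_le_add ih (h1.trans h3))

/-- The degrees `d`, or `d` with the entry at `β` lowered by one. -/
def lowerDeg (d : ι → ℕ) : Option ι → ι → ℕ
  | none => d
  | some β => Function.update d β (d β - 1)

/-- The weight of a ramification type. -/
def weight (F : Type*) [Fintype F] {ι : Type*} : Option ι → ℝ
  | none => 1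
  | some _ => (Fintype.card F : ℝ)⁻¹

theorem abs_tupleCount_lowerDeg_sub_le {d : ι → ℕ} {m : ℕ} (hm : ∀ α, m ≤ d α) (hm1 : 1 ≤ m)
    (τ : Option ι) (a b : ι → F → F × F) :
    |(tupleCount (lowerDeg d τ) a : ℝ) - weight F τ * tupleCount d b| ≤
      cmpConst F ι * ((Fintype.card F : ℝ) ^ (∑ β, d β) * (sqrtq F)⁻¹ ^ m) := by
  have hs := sqrtq_pos (F := F)
  have hs1 : (sqrtq F)⁻¹ ≤ 1 := inv_le_one_of_one_le₀ one_lt_sqrtq.le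
  have hq := two_le_card (F := F)
  have h0 := abs_tupleCount_sub_le hm a b
  set E : ℝ := (Fintype.card F : ℝ) ^ (∑ β, d β) * (sqrtq F)⁻¹ ^ m with hE
  have hEn : 0 ≤ E := by positivity
  have hK : (0 : ℝ) ≤ 2 * 4 ^ Fintype.card ι * E := by positivity
  rw [cmpConst]
  cases τ with
  | none =>
    simp only [lowerDeg, weight, one_mul]
    refine h0.trans ?_
    nlinarith
  | some β =>
    -- The comparison goes up from degree `d β - 1` to `d β`; `1 ≤ m` keeps the subtraction from
    -- truncating. Dividing by `q` afterwards gives the weight.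
    have h1 := abs_tupleCount_sub_le_of_eq_off β 1 (d := lowerDeg d (some β)) (e := d) (a := a)
      (b := a) (fun γ hγ => by simp [lowerDeg, hγ])
      (by have := hm β; simp [lowerDeg]; omega) (fun _ _ => rfl)
    rw [pow_one] at h1
    have h2 : (sqrtq F)⁻¹ ^ d β ≤ (sqrtq F)⁻¹ ^ m :=
      pow_le_pow_of_le_one (inv_nonneg.2 hs.le) hs1 (hm β)
    have h3 : 2 * 4 ^ Fintype.card ι * (Fintype.card F : ℝ) *
        ((Fintype.card F : ℝ) ^ (∑ β, d β) * (sqrtq F)⁻¹ ^ d β) ≤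
        2 * 4 ^ Fintype.card ι * (Fintype.card F : ℝ) * E := by
      rw [hE]
      gcongr
    have h4 := h1.trans h3
    rw [abs_sub_comm] at h4
    have h5 := (abs_sub_le _ _ _).trans (add_le_add h4 h0)
    have h6 : (tupleCount (lowerDeg d (some β)) a : ℝ) - weight F (some β) * tupleCount d b =
        (Fintype.card F : ℝ)⁻¹ * ((Fintype.card F : ℝ) * tupleCount (lowerDeg d (some β)) a -
          tupleCount d b) := by
      rw [weight]
      field_simp
    rw [h6, abs_mul, abs_of_nonneg (by positivity)]
    have h7 : (Fintype.card F : ℝ)⁻¹ ≤ 1 := inv_le_one_of_one_le₀ (by linarith)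
    refine (mul_le_of_le_one_left (abs_nonneg _) h7).trans (h5.trans (le_of_eq ?_))
    ring

end AbelianCovers
end
-- Positive density of good tuples
open Polynomial
noncomputable section
namespace AbelianCovers

variable {F : Type*} [Field F] [Fintype F]

open scoped Classical in
/-- Monic `g` of degree `n` with `Q g ≡ -1` modulo a given `R` coprime to `Q`. -/
theorem card_filter_dvd_mul_add_one_le {Q R : F[X]} (hR : R.Monic) (hQR : IsCoprime R Q) (n : ℕ) :
    ((monics F n).filter fun g => R ∣ Q * g + 1).card ≤ Fintype.card F ^ (n - R.natDegree) := by
  rcases Finset.eq_empty_or_nonempty ((monics F n).filter fun g => R ∣ Q * g + 1) with h | ⟨g₀, h₀⟩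
  · rw [h, Finset.card_empty]
    exact Nat.zero_le _
  rw [Finset.mem_filter, mem_monics] at h₀
  have hdvd (g : F[X]) (hg : R ∣ Q * g + 1) : R ∣ g - g₀ := by
    refine hQR.dvd_of_dvd_mul_left ?_
    have := dvd_sub hg h₀.2
    rwa [add_sub_add_right_eq_sub, ← mul_sub] at this
  have hdeg (g : F[X]) (hg : g ∈ monics F n) : (g - g₀).degree < (n : ℕ) := by
    rw [mem_monics] at hg
    have h1 : g.degree = n := by rw [degree_eq_natDegree hg.1.ne_zero, hg.2]
    have h2 : g₀.degree = n := by rw [degree_eq_natDegree h₀.1.1.ne_zero, h₀.1.2]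
    rw [← h1]
    exact degree_sub_lt_left (h1.trans h2.symm) hg.1.ne_zero
      (by rw [hg.1.leadingCoeff, h₀.1.1.leadingCoeff])
  rw [← card_monics]
  -- The quotient of `g - g₀` by `R` determines `g`, and adding `X ^ (n - deg R)` makes it monic. If
  -- `deg R > n`, then `g = g₀` and the image is `1`.
  refine Finset.card_le_card_of_injOn
    (fun g => X ^ (n - R.natDegree) + (g - g₀) /ₘ R) ?_ ?_
  · intro g hg
    rw [Finset.mem_coe, Finset.mem_filter] at hg
    have h1 : ((g - g₀) /ₘ R).degree < (n - R.natDegree : ℕ) := by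
      by_cases h0 : (g - g₀) /ₘ R = 0
      · rw [h0, degree_zero]
        exact WithBot.bot_lt_coe _
      · have h2 : (g - g₀) ≠ 0 := by
          rintro h
          rw [h, zero_divByMonic] at h0
          exact h0 rfl
        have h3 := hdeg g hg.1
        rw [degree_eq_natDegree h2, Nat.cast_lt] at h3
        have h4 := natDegree_le_of_dvd (hdvd g hg.2) h2
        rw [degree_eq_natDegree h0, natDegree_divByMonic _ hR, Nat.cast_lt]
        omega
    rw [Finset.mem_coe, mem_monics]
    refine ⟨monic_X_pow_add h1, ?_⟩
    rw [natDegree_add_eq_left_of_degree_lt (by rwa [degree_X_pow]), natDegree_X_pow]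
  · intro g hg g' hg' h
    rw [Finset.mem_coe, Finset.mem_filter] at hg hg'
    have h1 : (g - g₀) /ₘ R = (g' - g₀) /ₘ R := add_left_cancel h
    have h2 := (modByMonic_eq_zero_iff_dvd hR).2 (hdvd g hg.2)
    have h3 := (modByMonic_eq_zero_iff_dvd hR).2 (hdvd g' hg'.2)
    have h4 := modByMonic_add_div (g - g₀) R
    have h5 := modByMonic_add_div (g' - g₀) R
    rw [h2, h1] at h4
    rw [h3] at h5
    exact sub_left_injective (h4.symm.trans h5)

open scoped Classical in
-- When `deg R > n` the count can still be `1`, more than the expected `q^(n - deg R)`. But `R ∣ Q g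
-- + 1` forces `deg R ≤ n + deg Q`, so a loss of `q^(deg Q)` is enough.
theorem card_filter_dvd_le_real {Q R : F[X]} (hQ : Q.Monic) (hR : R.Monic) (hQR : IsCoprime R Q)
    {n : ℕ} (hn : 0 < n) :
    (((monics F n).filter fun g => R ∣ Q * g + 1).card : ℝ) ≤
      (if R.natDegree ≤ n then 1 else (Fintype.card F : ℝ) ^ Q.natDegree) *
        (Fintype.card F : ℝ)⁻¹ ^ R.natDegree * (Fintype.card F : ℝ) ^ n := by
  have hq := two_le_card (F := F)
  have hq1 : (1 : ℝ) ≤ Fintype.card F := by linarith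
  have h1 := card_filter_dvd_mul_add_one_le hR hQR n
  have h1' : (((monics F n).filter fun g => R ∣ Q * g + 1).card : ℝ) ≤
    (Fintype.card F : ℝ) ^ (n - R.natDegree) := by exact_mod_cast h1
  split_ifs with h
  · refine h1'.trans (le_of_eq ?_)
    rw [pow_sub₀ _ (by positivity) h, inv_pow]
    ring
  · rcases le_or_gt R.natDegree (n + Q.natDegree) with h2 | h2
    · refine h1'.trans ?_
      rw [Nat.sub_eq_zero_of_le (by omega), pow_zero, inv_pow, mul_right_comm, ← div_eq_mul_inv,
        ← pow_add, one_le_div (by positivity)]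
      exact pow_le_pow_right₀ hq1 (by omega)
    · rw [Finset.filter_eq_empty_iff.2, Finset.card_empty, Nat.cast_zero]
      · positivity
      · intro g hg hd
        rw [mem_monics] at hg
        have hm : (Q * g).natDegree = Q.natDegree + n := by rw [hQ.natDegree_mul hg.1, hg.2]
        have hd1 : (Q * g + 1).natDegree = Q.natDegree + n := by
          rw [← hm, ← C_1, natDegree_add_C]
        have h0 : Q * g + 1 ≠ 0 := by
          rintro h0
          rw [h0, natDegree_zero] at hd1
          omega
        have := natDegree_le_of_dvd hd h0
        omega

variable {ι : Type*} [Fintype ι] [DecidableEq ι]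

open scoped Classical in
theorem card_tuples_filter_le {Q R : F[X]} (hQ : Q.Monic) (hR : R.Monic) (hQR : IsCoprime R Q)
    {n : ι → ℕ} (hn : ∀ α, 0 < n α) {θ : ℝ}
    (hθ : ∀ α, (if R.natDegree ≤ n α then 1 else (Fintype.card F : ℝ) ^ Q.natDegree) ≤ θ)
    (S : Finset ι) :
    (((tuples F n).filter fun g => ∀ α ∈ S, R ∣ Q * g α + 1).card : ℝ) ≤
      (θ * (Fintype.card F : ℝ)⁻¹ ^ R.natDegree) ^ S.card * (Fintype.card F : ℝ) ^ ∑ α, n α := by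
  have h1 : (tuples F n).filter (fun g => ∀ α ∈ S, R ∣ Q * g α + 1) =
      Fintype.piFinset fun α => (monics F (n α)).filter fun p => α ∈ S → R ∣ Q * p + 1 := by
    ext g
    simp only [tuples, Finset.mem_filter, Fintype.mem_piFinset]
    exact forall_and.symm
  rw [h1, Fintype.card_piFinset]
  push_cast
  have h2 : (θ * (Fintype.card F : ℝ)⁻¹ ^ R.natDegree) ^ S.card * (Fintype.card F : ℝ) ^ ∑ α, n α =
      ∏ α, (if α ∈ S then θ * (Fintype.card F : ℝ)⁻¹ ^ R.natDegree else 1) *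
        (Fintype.card F : ℝ) ^ n α := by
    rw [Finset.prod_mul_distrib, Finset.prod_pow_eq_pow_sum, Finset.prod_ite_mem,
      Finset.univ_inter, Finset.prod_const]
  rw [h2]
  refine Finset.prod_le_prod (fun _ _ => by positivity) fun α _ => ?_
  by_cases hα : α ∈ S
  · simp only [hα, true_imp_iff, if_true]
    refine (card_filter_dvd_le_real hQ hR hQR (hn α)).trans ?_
    gcongr
    exact hθ α
  · simp [hα, card_monics]

theorem sum_Ioc_half_pow_le (z N : ℕ) : ∑ p ∈ Finset.Ioc z N, (1 / 2 : ℝ) ^ p ≤ (1 / 2) ^ z := by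
  rcases le_or_gt z N with h | h
  · have : ∑ p ∈ Finset.Ioc z N, (1 / 2 : ℝ) ^ p = (1 / 2) ^ z - (1 / 2) ^ N := by
      induction N, h using Nat.le_induction with
      | base => simp
      | succ N h ih =>
        rw [Finset.sum_Ioc_succ_top h, ih]
        ring
    rw [this]
    have : (0 : ℝ) < (1 / 2) ^ N := by positivity
    linarith
  · rw [Finset.Ioc_eq_empty (by omega), Finset.sum_empty]
    positivity

open scoped Classical in
-- The `q^p` monics of degree `p` have weight `q^(-2p)` each, which leaves `q^(-p) ≤ 2^(-p)`: one
-- tail beyond `z`, and one beyond `B` penalised by `M`.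
theorem sum_primes_le (z B N : ℕ) {M : ℝ} (hM : 1 ≤ M) :
    ∑ P ∈ ((Finset.Ioc z N).biUnion (monics F)).filter Irreducible,
      (if P.natDegree ≤ B then 1 else M) * ((Fintype.card F : ℝ)⁻¹ ^ P.natDegree) ^ 2 ≤
      (1 / 2) ^ z + M * (1 / 2) ^ B := by
  have hq := two_le_card (F := F)
  have hnn (P : F[X]) : 0 ≤ (if P.natDegree ≤ B then 1 else M) *
      ((Fintype.card F : ℝ)⁻¹ ^ P.natDegree) ^ 2 := by
    have : 0 ≤ (if P.natDegree ≤ B then 1 else M) := by split_ifs <;> linarith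
    positivity
  refine (Finset.sum_le_sum_of_subset_of_nonneg (Finset.filter_subset _ _)
    fun P _ _ => hnn P).trans ?_
  rw [Finset.sum_biUnion]
  swap
  · intro i _ j _ hij
    rw [Function.onFun, Finset.disjoint_left]
    intro p hp hp'
    exact hij ((mem_monics.1 hp).2.symm.trans (mem_monics.1 hp').2)
  have h1 (p : ℕ) : ∑ P ∈ monics F p, (if P.natDegree ≤ B then 1 else M) *
      ((Fintype.card F : ℝ)⁻¹ ^ P.natDegree) ^ 2 ≤
      (1 / 2) ^ p + if B < p then M * (1 / 2) ^ p else 0 := by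
    have h2 : ∑ P ∈ monics F p, (if P.natDegree ≤ B then 1 else M) *
        ((Fintype.card F : ℝ)⁻¹ ^ P.natDegree) ^ 2 =
        (if p ≤ B then 1 else M) * (Fintype.card F : ℝ)⁻¹ ^ p := by
      rw [Finset.sum_congr rfl fun P hP => by rw [(mem_monics.1 hP).2], Finset.sum_const,
        card_monics, nsmul_eq_mul]
      push_cast
      rw [inv_pow]
      field_simp
    have h3 : (Fintype.card F : ℝ)⁻¹ ^ p ≤ (1 / 2) ^ p := by
      refine pow_le_pow_left₀ (by positivity) ?_ _
      rw [one_div]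
      exact inv_anti₀ (by norm_num) hq
    have h4 : (0 : ℝ) < (1 / 2) ^ p := by positivity
    rw [h2]
    by_cases hp : p ≤ B
    · simp only [hp, if_true, one_mul, not_lt.2 hp, if_false, add_zero]
      exact h3
    · simp only [hp, if_false, not_le.1 hp, if_true]
      have := mul_le_mul_of_nonneg_left h3 (by linarith : 0 ≤ M)
      linarith
  refine (Finset.sum_le_sum fun p _ => h1 p).trans ?_
  rw [Finset.sum_add_distrib]
  refine add_le_add (sum_Ioc_half_pow_le z N) ?_
  rw [← Finset.sum_filter, ← Finset.mul_sum]
  refine mul_le_mul_of_nonneg_left ?_ (by linarith)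
  refine (Finset.sum_le_sum_of_subset_of_nonneg ?_ fun _ _ _ => by positivity).trans
    (sum_Ioc_half_pow_le B N)
  intro p hp
  simp only [Finset.mem_filter, Finset.mem_Ioc] at hp ⊢
  omega

open scoped Classical in
-- Primes of degree at most `z` divide `Q`, so they cannot divide `Q g + 1`. The remaining primes
-- are handled by a union bound over squares dividing one entry and primes dividing two entries,
-- each of relative frequency about `|P|^(-2)`.
theorem card_bad_tuples_le {Q : F[X]} (hQ : Q.Monic) {z B : ℕ}
    (hQz : ∀ P : F[X], P.Monic → 1 ≤ P.natDegree → P.natDegree ≤ z → P ∣ Q)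
    {n : ι → ℕ} (hn : ∀ α, 0 < n α) (hB : ∀ α, 2 * B ≤ n α) :
    (((tuples F n).filter fun g => ¬ GoodTuple fun α => Q * g α + 1).card : ℝ) ≤
      ((Fintype.card ι : ℝ) + (Fintype.card ι : ℝ) ^ 2) *
        ((1 / 2) ^ z + ((Fintype.card F : ℝ) ^ Q.natDegree) ^ 2 * (1 / 2) ^ B) *
        (Fintype.card F : ℝ) ^ ∑ α, n α := by
  have hq := two_le_card (F := F)
  have hq1 : (1 : ℝ) ≤ Fintype.card F := by linarith
  set κ := Q.natDegree with hκ
  set N := ∑ α, (κ + n α) with hN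
  set Ps := ((Finset.Ioc z N).biUnion (monics F)).filter Irreducible with hPs
  let bad (P : F[X]) (i : ι ⊕ ι × ι) : Finset (ι → F[X]) := match i with
    | .inl α => (tuples F n).filter fun g => ∀ γ ∈ ({α} : Finset ι), P ^ 2 ∣ Q * g γ + 1
    | .inr (α, β) => if α = β then ∅ else
        (tuples F n).filter fun g => ∀ γ ∈ ({α, β} : Finset ι), P ∣ Q * g γ + 1
  have hcop {P g : F[X]} (hP : Irreducible P) (h : P ∣ Q * g + 1) : IsCoprime P Q := by
    rw [hP.coprime_iff_not_dvd]
    intro h'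
    exact hP.not_isUnit (isUnit_of_dvd_one ((dvd_add_right (h'.mul_right g)).1 h))
  have hmem {P g : F[X]} {α : ι} (hP : P.Monic) (hP' : Irreducible P) (hP2 : 2 ≤ P.natDegree)
      (hg : g.Monic ∧ g.natDegree = n α) (h : P ∣ Q * g + 1) : P ∈ Ps := by
    have h1 : (Q * g + 1).natDegree = κ + n α := by
      rw [← C_1, natDegree_add_C, hQ.natDegree_mul hg.1, hg.2]
    have h2 : Q * g + 1 ≠ 0 := by
      rintro h0
      rw [h0, natDegree_zero] at h1
      have := hn α
      omega
    have h3 := natDegree_le_of_dvd h h2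
    have h4 : κ + n α ≤ N :=
      Finset.single_le_sum (f := fun α => κ + n α) (fun _ _ => Nat.zero_le _) (Finset.mem_univ α)
    have h5 : z < P.natDegree := by
      by_contra h5
      exact (hP'.coprime_iff_not_dvd.1 (hcop hP' h)) (hQz P hP (by omega) (by omega))
    rw [hPs, Finset.mem_filter, Finset.mem_biUnion]
    exact ⟨⟨P.natDegree, Finset.mem_Ioc.2 ⟨h5, by omega⟩, mem_monics.2 ⟨hP, rfl⟩⟩, hP'⟩
  have hsub : (tuples F n).filter (fun g => ¬ GoodTuple fun α => Q * g α + 1) ⊆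
      (Ps ×ˢ (Finset.univ : Finset (ι ⊕ ι × ι))).biUnion fun x => bad x.1 x.2 := by
    intro g hg
    rw [Finset.mem_filter] at hg
    have hg' := mem_tuples.1 hg.1
    have h1 := hg.2
    simp only [GoodTuple] at h1
    push Not at h1
    obtain ⟨P, h2, h3, h4, h5⟩ := h1
    simp only [Finset.mem_biUnion, Finset.mem_product, Finset.mem_univ, and_true]
    by_cases h6 : ∃ α, P ^ 2 ∣ Q * g α + 1
    · obtain ⟨α, h6⟩ := h6
      refine ⟨(P, .inl α), hmem h2 h3 h4 (hg' α) ((dvd_pow_self P two_ne_zero).trans h6), ?_⟩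
      simp only [bad, Finset.mem_filter, Finset.mem_singleton, forall_eq]
      exact ⟨hg.1, h6⟩
    · push Not at h6
      obtain ⟨α, β, h7, h8, h9⟩ := h5 h6
      refine ⟨(P, .inr (α, β)), hmem h2 h3 h4 (hg' α) h8, ?_⟩
      simp only [bad, if_neg h7, Finset.mem_filter, Finset.mem_insert, Finset.mem_singleton]
      refine ⟨hg.1, ?_⟩
      rintro γ (rfl | rfl)
      · exact h8
      · exact h9
  have hbound (P : F[X]) (hP : P ∈ Ps) (i : ι ⊕ ι × ι) : ((bad P i).card : ℝ) ≤
      ((if P.natDegree ≤ B then 1 else ((Fintype.card F : ℝ) ^ κ) ^ 2) *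
        ((Fintype.card F : ℝ)⁻¹ ^ P.natDegree) ^ 2) * (Fintype.card F : ℝ) ^ ∑ α, n α := by
    have hPm : P.Monic := by
      rw [hPs, Finset.mem_filter, Finset.mem_biUnion] at hP
      obtain ⟨⟨j, -, hj⟩, -⟩ := hP
      exact (mem_monics.1 hj).1
    have hPi : Irreducible P := (Finset.mem_filter.1 hP).2
    have hκ1 : (1 : ℝ) ≤ (Fintype.card F : ℝ) ^ κ := one_le_pow₀ hq1
    have hnn : 0 ≤ ((if P.natDegree ≤ B then 1 else ((Fintype.card F : ℝ) ^ κ) ^ 2) *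
        ((Fintype.card F : ℝ)⁻¹ ^ P.natDegree) ^ 2) * (Fintype.card F : ℝ) ^ ∑ α, n α := by
      have : (0 : ℝ) ≤ (if P.natDegree ≤ B then 1 else ((Fintype.card F : ℝ) ^ κ) ^ 2) := by
        split_ifs <;> positivity
      positivity
    by_cases hc : IsCoprime P Q
    swap
    · have : bad P i = ∅ := by
        rcases i with α | ⟨α, β⟩
        · simp only [bad, Finset.mem_singleton, forall_eq]
          refine Finset.filter_eq_empty_iff.2 fun g _ h => hc (hcop hPi (g := g α) ?_)
          exact (dvd_pow_self P two_ne_zero).trans h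
        · simp only [bad]
          split_ifs
          · rfl
          · exact Finset.filter_eq_empty_iff.2 fun g _ h =>
              hc (hcop hPi (g := g α) (h α (by simp)))
      rw [this, Finset.card_empty, Nat.cast_zero]
      exact hnn
    rcases i with α | ⟨α, β⟩
    · refine (card_tuples_filter_le (R := P ^ 2) hQ (hPm.pow 2) hc.pow_left hn
        (θ := if P.natDegree ≤ B then 1 else ((Fintype.card F : ℝ) ^ κ) ^ 2) ?_ {α}).trans
        (le_of_eq ?_)
      -- For `deg P ≤ B`, the hypothesis `2 * B ≤ n γ` makes `P ^ 2` small enough to have the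
      -- expected count.
      · intro γ
        rw [hPm.natDegree_pow]
        have := hB γ
        by_cases h1 : P.natDegree ≤ B
        · rw [if_pos (by omega), if_pos h1]
        · rw [if_neg h1]
          split_ifs
          · exact one_le_pow₀ hκ1
          · exact le_self_pow₀ hκ1 two_ne_zero
      · rw [Finset.card_singleton, pow_one, hPm.natDegree_pow, mul_comm 2, pow_mul]
    · simp only [bad]
      by_cases hαβ : α = β
      · rw [if_pos hαβ, Finset.card_empty, Nat.cast_zero]
        exact hnn
      rw [if_neg hαβ]
      by_cases hPB : P.natDegree ≤ B
      · rw [if_pos hPB]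
        refine (card_tuples_filter_le (R := P) hQ hPm hc hn (θ := 1) ?_ {α, β}).trans
          (le_of_eq ?_)
        · intro γ
          have := hB γ
          rw [if_pos (by omega)]
        · rw [Finset.card_pair hαβ, mul_pow, one_pow]
      · rw [if_neg hPB]
        refine (card_tuples_filter_le (R := P) hQ hPm hc hn
          (θ := (Fintype.card F : ℝ) ^ κ) ?_ {α, β}).trans (le_of_eq ?_)
        · intro γ
          split_ifs
          · exact hκ1
          · exact le_rfl
        · rw [Finset.card_pair hαβ, mul_pow]
  calc (((tuples F n).filter fun g => ¬ GoodTuple fun α => Q * g α + 1).card : ℝ)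
      ≤ ∑ x ∈ Ps ×ˢ (Finset.univ : Finset (ι ⊕ ι × ι)), ((bad x.1 x.2).card : ℝ) := by
        exact_mod_cast (Finset.card_le_card hsub).trans Finset.card_biUnion_le
    _ ≤ ∑ P ∈ Ps, ∑ _i : ι ⊕ ι × ι,
          ((if P.natDegree ≤ B then 1 else ((Fintype.card F : ℝ) ^ κ) ^ 2) *
          ((Fintype.card F : ℝ)⁻¹ ^ P.natDegree) ^ 2) * (Fintype.card F : ℝ) ^ ∑ α, n α := by
        rw [Finset.sum_product]
        exact Finset.sum_le_sum fun P hP => Finset.sum_le_sum fun i _ => hbound P hP i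
    _ = ((Fintype.card ι : ℝ) + (Fintype.card ι : ℝ) ^ 2) *
          (∑ P ∈ Ps, (if P.natDegree ≤ B then 1 else ((Fintype.card F : ℝ) ^ κ) ^ 2) *
          ((Fintype.card F : ℝ)⁻¹ ^ P.natDegree) ^ 2) * (Fintype.card F : ℝ) ^ ∑ α, n α := by
        simp only [Finset.sum_const, Finset.card_univ, Fintype.card_sum, Fintype.card_prod,
          nsmul_eq_mul]
        rw [← Finset.mul_sum, ← Finset.sum_mul]
        push_cast
        ring
    _ ≤ _ := by
        gcongr
        exact sum_primes_le z B N (one_le_pow₀ (one_le_pow₀ hq1))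

open scoped Classical in
/-- Good tuples have positive density. -/
theorem exists_card_goodTuple_ge (F : Type*) [Field F] [Fintype F] (ι : Type*) [Fintype ι]
    [DecidableEq ι] :
    ∃ c : ℝ, 0 < c ∧ ∃ B : ℕ, ∀ d : ι → ℕ, (∀ α, B ≤ d α) →
      c * (Fintype.card F : ℝ) ^ (∑ α, d α) ≤ ((tuples F d).filter GoodTuple).card := by
  have hq := two_le_card (F := F)
  have hlim (J : ℝ) : ∃ z : ℕ, J * (1 / 2) ^ z ≤ 1 / 4 := by
    have h1 : Filter.Tendsto (fun z : ℕ => J * (1 / 2 : ℝ) ^ z) Filter.atTop (nhds (J * 0)) :=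
      (tendsto_pow_atTop_nhds_zero_of_lt_one (by norm_num) (by norm_num)).const_mul J
    rw [mul_zero] at h1
    exact (h1.eventually (ge_mem_nhds (by norm_num : (0 : ℝ) < 1 / 4))).exists
  -- `J` counts single entries and pairs. The order of choice matters: `z` first, then `Q` and its
  -- degree `κ`, and last `B`, which has to beat the penalty `q^(2κ)`. Each tail then costs at most
  -- `1/4`.
  set J : ℝ := (Fintype.card ι : ℝ) + (Fintype.card ι : ℝ) ^ 2 with hJ
  obtain ⟨z, hz⟩ := hlim J
  set Q : F[X] := ∏ P ∈ (Finset.Icc 1 z).biUnion (monics F), P with hQdef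
  have hQ : Q.Monic := by
    refine monic_prod_of_monic _ _ fun P hP => ?_
    obtain ⟨j, -, hj⟩ := Finset.mem_biUnion.1 hP
    exact (mem_monics.1 hj).1
  have hQz : ∀ P : F[X], P.Monic → 1 ≤ P.natDegree → P.natDegree ≤ z → P ∣ Q := by
    intro P h1 h2 h3
    exact Finset.dvd_prod_of_mem (fun P => P) (Finset.mem_biUnion.2
      ⟨P.natDegree, Finset.mem_Icc.2 ⟨h2, h3⟩, mem_monics.2 ⟨h1, rfl⟩⟩)
  set κ := Q.natDegree with hκ
  obtain ⟨B, hB⟩ := hlim (J * ((Fintype.card F : ℝ) ^ κ) ^ 2)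
  -- At least half of the tuples `Q g + 1` are good, and these have density `q^(-κ)` in each entry.
  refine ⟨1 / 2 * ((Fintype.card F : ℝ) ^ (Fintype.card ι * κ))⁻¹, by positivity,
    κ + 2 * B + 1, fun d hd => ?_⟩
  set n : ι → ℕ := fun α => d α - κ with hn
  have hnd (α : ι) : κ + n α = d α := by have := hd α; simp only [hn]; omega
  have h1 := card_bad_tuples_le (ι := ι) hQ hQz (B := B) (n := n)
    (fun α => by have := hd α; simp only [hn]; omega)
    (fun α => by have := hd α; simp only [hn]; omega)
  have h2 : (((tuples F n).filter fun g => GoodTuple fun α => Q * g α + 1).card : ℝ) +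
      (((tuples F n).filter fun g => ¬ GoodTuple fun α => Q * g α + 1).card : ℝ) =
      (Fintype.card F : ℝ) ^ ∑ α, n α := by
    have := Finset.card_filter_add_card_filter_not (s := tuples F n)
      (fun g => GoodTuple fun α => Q * g α + 1)
    have h3 : (tuples F n).card = Fintype.card F ^ ∑ α, n α := by
      rw [tuples, Fintype.card_piFinset, ← Finset.prod_pow_eq_pow_sum]
      exact Finset.prod_congr rfl fun α _ => card_monics _
    rw [h3] at this
    exact_mod_cast this
  have h3 : ((tuples F n).filter fun g => GoodTuple fun α => Q * g α + 1).card ≤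
      ((tuples F d).filter GoodTuple).card := by
    refine Finset.card_le_card_of_injOn (fun g α => Q * g α + 1) ?_ ?_
    · intro g hg
      rw [Finset.mem_coe, Finset.mem_filter, mem_tuples] at hg ⊢
      refine ⟨fun α => ?_, hg.2⟩
      have h5 := hg.1 α
      have h4 : (Q * g α).natDegree = d α := by
        rw [hQ.natDegree_mul h5.1, h5.2, hnd α]
      have h6 : (Q * g α).Monic := hQ.mul h5.1
      refine ⟨h6.add_of_left ?_, by rw [← C_1, natDegree_add_C, h4]⟩
      rw [degree_one, degree_eq_natDegree h6.ne_zero, h4]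
      have := hd α
      exact_mod_cast (by omega : 0 < d α)
    · intro g _ g' _ h
      funext α
      have := congrFun h α
      exact mul_left_cancel₀ hQ.ne_zero (add_right_cancel this)
  have h3' : (((tuples F n).filter fun g => GoodTuple fun α => Q * g α + 1).card : ℝ) ≤
      ((tuples F d).filter GoodTuple).card := by exact_mod_cast h3
  refine le_trans ?_ h3'
  have h4 : ∑ α, d α = Fintype.card ι * κ + ∑ α, n α := by
    rw [← Finset.sum_congr rfl fun α _ => hnd α, Finset.sum_add_distrib, Finset.sum_const,
      Finset.card_univ, smul_eq_mul]
  have h5 : J * ((1 / 2) ^ z + ((Fintype.card F : ℝ) ^ κ) ^ 2 * (1 / 2) ^ B) ≤ 1 / 2 := by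
    have : J * ((1 / 2) ^ z + ((Fintype.card F : ℝ) ^ κ) ^ 2 * (1 / 2) ^ B) =
      J * (1 / 2) ^ z + J * ((Fintype.card F : ℝ) ^ κ) ^ 2 * (1 / 2) ^ B := by ring
    linarith
  have hX : (0 : ℝ) < (Fintype.card F : ℝ) ^ ∑ α, n α := by positivity
  have h6 := mul_le_mul_of_nonneg_right h5 hX.le
  rw [h4, pow_add]
  have h7 : 1 / 2 * ((Fintype.card F : ℝ) ^ (Fintype.card ι * κ))⁻¹ *
      ((Fintype.card F : ℝ) ^ (Fintype.card ι * κ) * (Fintype.card F : ℝ) ^ ∑ α, n α) =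
      1 / 2 * (Fintype.card F : ℝ) ^ ∑ α, n α := by
    field_simp
  rw [h7]
  linarith

end AbelianCovers
end
-- The dual group of `G` and its indexing by `(s, ω)`
open Polynomial
noncomputable section
namespace AbelianCovers

variable {F : Type*} [Field F] [Fintype F] {n : ℕ}

instance isCyclic_mulChar : IsCyclic (MulChar F ℂ) := by
  obtain ⟨e⟩ := MulChar.mulEquiv_units F ℂ
  exact e.isCyclic.2 inferInstance

/-- The tuples `ψ` of characters with `ψ_j ^ r_j = 1`: the dual group of `∏ j, ℤ/r_j`. -/
def chars (F : Type*) [Field F] (r : Fin (n + 1) → ℕ) :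
    Subgroup (Fin (n + 1) → MulChar F ℂ) where
  carrier := {ψ | ∀ j, ψ j ^ r j = 1}
  mul_mem' := by
    intro ψ ψ' h h' j
    rw [Pi.mul_apply, mul_pow, h j, h' j, one_mul]
  one_mem' := by
    intro j
    simp
  inv_mem' := by
    intro ψ h j
    rw [Pi.inv_apply, inv_pow, h j, inv_one]

theorem mem_chars {F : Type*} [Field F] {r : Fin (n + 1) → ℕ} {ψ : Fin (n + 1) → MulChar F ℂ} :
    ψ ∈ chars F r ↔ ∀ j, ψ j ^ r j = 1 := Iff.rfl

instance : Fintype (Fin (n + 1) → MulChar F ℂ) := Fintype.ofFinite _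

/-- The pairing `ψ ↦ ∏ j, ψ_j ^ t_j` with an integer vector `t`. -/
def pairing (F : Type*) [Field F] (t : Fin (n + 1) → ℕ) :
    (Fin (n + 1) → MulChar F ℂ) →* MulChar F ℂ where
  toFun ψ := ∏ j, ψ j ^ t j
  map_one' := by simp
  map_mul' ψ ψ' := by simp [mul_pow, Finset.prod_mul_distrib]

theorem pairing_apply {F : Type*} [Field F] (t : Fin (n + 1) → ℕ) (ψ : Fin (n + 1) → MulChar F ℂ) :
    pairing F t ψ = ∏ j, ψ j ^ t j := rfl

/-- The tuple of characters indexed by `s` and `ω`. -/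
def charTuple (χ : ℕ → MulChar F ℂ) (s ω : Fin (n + 1) → ℕ) (j : Fin (n + 1)) : MulChar F ℂ :=
  χ (ell s) ^ (ell s / s j * ω j)

theorem mem_divVectors {r : Fin (n + 1) → ℕ} (hr : ∀ j, 0 < r j) {s : Fin (n + 1) → ℕ} :
    s ∈ divVectors r ↔ ∀ j, s j ∣ r j := by
  simp [divVectors, (hr _).ne']

theorem dvd_ell (s : Fin (n + 1) → ℕ) (j : Fin (n + 1)) : s j ∣ ell s :=
  Finset.dvd_lcm (Finset.mem_univ j)

theorem dvd_last {r : Fin (n + 1) → ℕ} (hr : ∀ j : Fin n, r j.castSucc ∣ r j.succ)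
    (j : Fin (n + 1)) : r j ∣ r (Fin.last n) := by
  induction j using Fin.reverseInduction with
  | last => exact dvd_rfl
  | cast j ih => exact (hr j).trans ih

theorem ell_dvd {r s : Fin (n + 1) → ℕ} (hr : ∀ j : Fin n, r j.castSucc ∣ r j.succ)
    (hs : ∀ j, s j ∣ r j) : ell s ∣ r (Fin.last n) :=
  Finset.lcm_dvd fun j _ => (hs j).trans (dvd_last hr j)

section

variable {r : Fin (n + 1) → ℕ} {χ : ℕ → MulChar F ℂ}

/-- A character of order `ℓ` has its `ℓ / s_j`-th power of order `s_j`, and an exponent coprime to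
`s_j` does not change this. -/
theorem orderOf_charTuple {F : Type*} [Field F] {χ : ℕ → MulChar F ℂ} (hr_pos : ∀ j, 0 < r j)
    (hr_dvd : ∀ j : Fin n, r j.castSucc ∣ r j.succ)
    (hχ : ∀ m, m ∣ r (Fin.last n) → orderOf (χ m) = m) {s ω : Fin (n + 1) → ℕ}
    (hs : ∀ j, s j ∣ r j) (hω : ω ∈ Omega s) (j : Fin (n + 1)) :
    orderOf (χ (ell s) ^ (ell s / s j)) = s j ∧ orderOf (charTuple χ s ω j) = s j := by
  have hl := hχ _ (ell_dvd hr_dvd hs)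
  have hl0 : 0 < ell s := Nat.pos_of_dvd_of_pos (ell_dvd hr_dvd hs) (hr_pos _)
  have hsj := dvd_ell s j
  have hsj0 : 0 < s j := Nat.pos_of_dvd_of_pos (hs j) (hr_pos j)
  have h1 : orderOf (χ (ell s) ^ (ell s / s j)) = s j := by
    rw [orderOf_pow_of_dvd (Nat.div_pos (Nat.le_of_dvd hl0 hsj) hsj0).ne'
      (by rw [hl]; exact Nat.div_dvd_of_dvd hsj), hl, Nat.div_div_self hsj hl0.ne']
  refine ⟨h1, ?_⟩
  simp only [Omega, Fintype.mem_piFinset, Finset.mem_filter] at hω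
  rw [charTuple, pow_mul, Nat.Coprime.orderOf_pow (by rw [h1]; exact (hω j).2.symm), h1]

/-- The orders of the components recover `s`; then each `ω_j` is determined modulo `s_j`. -/
theorem charTuple_injOn {F : Type*} [Field F] {χ : ℕ → MulChar F ℂ} (hr_pos : ∀ j, 0 < r j)
    (hr_dvd : ∀ j : Fin n, r j.castSucc ∣ r j.succ)
    (hχ : ∀ m, m ∣ r (Fin.last n) → orderOf (χ m) = m) :
    Set.InjOn (fun x : Σ _ : Fin (n + 1) → ℕ, Fin (n + 1) → ℕ => charTuple χ x.1 x.2)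
      ((divVectors r).sigma Omega) := by
  rintro ⟨s, ω⟩ h ⟨s', ω'⟩ h' heq
  simp only [Finset.coe_sigma, Set.mem_sigma_iff, Finset.mem_coe] at h h'
  rw [mem_divVectors hr_pos] at h h'
  simp only at heq
  have hss : s = s' := by
    funext j
    rw [← (orderOf_charTuple hr_pos hr_dvd hχ h.1 h.2 j).2,
      ← (orderOf_charTuple hr_pos hr_dvd hχ h'.1 h'.2 j).2, heq]
  subst hss
  have : ω = ω' := by
    funext j
    have h1 := congrFun heq j
    have h3 := (orderOf_charTuple hr_pos hr_dvd hχ h.1 h.2 j).1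
    simp only [charTuple, pow_mul] at h1
    rw [pow_eq_pow_iff_modEq, h3] at h1
    have h4 := h.2
    have h5 := h'.2
    simp only [Omega, Fintype.mem_piFinset, Finset.mem_filter, Finset.mem_Icc] at h4 h5
    obtain ⟨⟨h6, h7⟩, -⟩ := h4 j
    obtain ⟨⟨h8, h9⟩, -⟩ := h5 j
    -- Since `ω_j` runs from `1` to `s_j`, it is `ω_j - 1` that is a least residue.
    rw [← Nat.sub_add_cancel h6, ← Nat.sub_add_cancel h8] at h1 ⊢
    congr 1
    exact (Nat.ModEq.add_right_cancel' 1 h1).eq_of_lt_of_lt (by omega) (by omega)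
  subst this
  rfl

theorem card_sigma_Omega (r : Fin (n + 1) → ℕ) :
    ((divVectors r).sigma Omega).card = groupOrder r := by
  have h1 (s : Fin (n + 1) → ℕ) : (Omega s).card = ∏ j, Nat.totient (s j) := by
    rw [Omega, Fintype.card_piFinset]
    refine Finset.prod_congr rfl fun j _ => ?_
    rw [← Nat.filter_coprime_Ico_eq_totient (s j) 1]
    congr 1
    ext w
    simp only [Finset.mem_filter, Finset.mem_Icc, Finset.mem_Ico]
    constructor
    · rintro ⟨h, h'⟩
      exact ⟨by omega, h'.symm⟩
    · rintro ⟨h, h'⟩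
      exact ⟨by omega, h'.symm⟩
  rw [Finset.card_sigma, Finset.sum_congr rfl fun s _ => h1 s, divVectors,
    ← Finset.prod_univ_sum, groupOrder]
  exact Finset.prod_congr rfl fun j _ => Nat.sum_totient (r j)

open scoped Classical in
-- Surjectivity comes from counting: there are `|G|` pairs `(s, ω)`, while `η ^ r_j = 1` has at most
-- `r_j` solutions in the cyclic group of characters.
theorem image_charTuple (hr_pos : ∀ j, 0 < r j)
    (hr_dvd : ∀ j : Fin n, r j.castSucc ∣ r j.succ)
    (hχ : ∀ m, m ∣ r (Fin.last n) → orderOf (χ m) = m) :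
    ((divVectors r).sigma Omega).image (fun x => charTuple χ x.1 x.2) =
      Finset.univ.filter (· ∈ chars F r) := by
  refine Finset.eq_of_subset_of_card_le ?_ ?_
  · intro ψ hψ
    obtain ⟨⟨s, ω⟩, h, rfl⟩ := Finset.mem_image.1 hψ
    rw [Finset.mem_sigma, mem_divVectors hr_pos] at h
    rw [Finset.mem_filter]
    refine ⟨Finset.mem_univ _, mem_chars.2 fun j => ?_⟩
    rw [← orderOf_dvd_iff_pow_eq_one, (orderOf_charTuple hr_pos hr_dvd hχ h.1 h.2 j).2]
    exact h.1 j
  · rw [Finset.card_image_of_injOn (charTuple_injOn hr_pos hr_dvd hχ), card_sigma_Omega r]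
    let _ : Fintype (MulChar F ℂ) := Fintype.ofFinite _
    have h1 : Finset.univ.filter (· ∈ chars F r) ⊆
        Fintype.piFinset fun j => Finset.univ.filter fun η : MulChar F ℂ => η ^ r j = 1 := by
      intro ψ hψ
      rw [Finset.mem_filter, mem_chars] at hψ
      simpa using hψ.2
    refine (Finset.card_le_card h1).trans ?_
    rw [Fintype.card_piFinset]
    exact Finset.prod_le_prod' fun j _ => IsCyclic.card_pow_eq_one_le (hr_pos j)

open scoped Classical in
theorem sum_charTuple (hr_pos : ∀ j, 0 < r j)
    (hr_dvd : ∀ j : Fin n, r j.castSucc ∣ r j.succ)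
    (hχ : ∀ m, m ∣ r (Fin.last n) → orderOf (χ m) = m) (Φ : (Fin (n + 1) → MulChar F ℂ) → ℂ) :
    ∑ s ∈ divVectors r, ∑ ω ∈ Omega s, Φ (charTuple χ s ω) =
      ∑ ψ ∈ Finset.univ.filter (· ∈ chars F r), Φ ψ := by
  rw [Finset.sum_sigma', ← image_charTuple hr_pos hr_dvd hχ,
    Finset.sum_image (charTuple_injOn hr_pos hr_dvd hχ)]

theorem card_chars (hr_pos : ∀ j, 0 < r j)
    (hr_dvd : ∀ j : Fin n, r j.castSucc ∣ r j.succ)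
    (hχ : ∀ m, m ∣ r (Fin.last n) → orderOf (χ m) = m) :
    Nat.card (chars F r) = groupOrder r := by
  classical
  rw [← card_sigma_Omega r, ← Finset.card_image_of_injOn (charTuple_injOn hr_pos hr_dvd hχ),
    image_charTuple hr_pos hr_dvd hχ, ← Fintype.card_subtype, Nat.card_eq_fintype_card]

/-- The tuples in `chars F r` whose pairing with `t` is trivial. -/
def annih (F : Type*) [Field F] (r t : Fin (n + 1) → ℕ) :
    Subgroup (Fin (n + 1) → MulChar F ℂ) := chars F r ⊓ (pairing F t).ker

theorem mem_annih {F : Type*} [Field F] {t : Fin (n + 1) → ℕ} {ψ : Fin (n + 1) → MulChar F ℂ} :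
    ψ ∈ annih F r t ↔ ψ ∈ chars F r ∧ pairing F t ψ = 1 := Iff.rfl

/-- The element of `∏ j, ℤ/r_j` given by an integer vector. -/
def toGroup (r t : Fin (n + 1) → ℕ) (j : Fin (n + 1)) : ZMod (r j) := (t j : ZMod (r j))

/-- `annih F r t` is the kernel of the pairing with `t` on the dual group. The image lies in a
cyclic group, so its order equals its exponent, which is the order of `t` in `G`. -/
theorem card_annih_mul (hr_pos : ∀ j, 0 < r j)
    (hr_dvd : ∀ j : Fin n, r j.castSucc ∣ r j.succ)
    (hχ : ∀ m, m ∣ r (Fin.last n) → orderOf (χ m) = m) (t : Fin (n + 1) → ℕ) :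
    Nat.card (annih F r t) * addOrderOf (toGroup r t) = groupOrder r := by
  let f : chars F r →* MulChar F ℂ := (pairing F t).comp (chars F r).subtype
  have h1 : Nat.card f.ker * Nat.card f.range = groupOrder r := by
    rw [← Subgroup.index_ker, Subgroup.card_mul_index, card_chars hr_pos hr_dvd hχ]
  have h2 : Nat.card f.ker = Nat.card (annih F r t) := by
    refine Nat.card_congr ⟨fun x => ⟨x.1.1, x.1.2, x.2⟩, fun y => ⟨⟨y.1, y.2.1⟩, y.2.2⟩,
      fun _ => rfl, fun _ => rfl⟩
  have h3 : Nat.card f.range = addOrderOf (toGroup r t) := by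
    refine Nat.dvd_antisymm ?_ ?_
    · rw [← IsCyclic.exponent_eq_card]
      refine Monoid.exponent_dvd_of_forall_pow_eq_one ?_
      rintro ⟨_, ψ, rfl⟩
      refine Subtype.ext ?_
      simp only [OneMemClass.coe_one]
      change (∏ j, ψ.1 j ^ t j) ^ _ = 1
      rw [← Finset.prod_pow]
      refine Finset.prod_eq_one fun j _ => ?_
      have h4 : (r j) ∣ t j * addOrderOf (toGroup r t) := by
        have := congrFun (addOrderOf_nsmul_eq_zero (toGroup r t)) j
        rw [Pi.smul_apply, toGroup, nsmul_eq_mul, Pi.zero_apply] at this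
        rw [← ZMod.natCast_eq_zero_iff]
        push_cast
        rw [mul_comm]
        exact this
      obtain ⟨m, hm⟩ := h4
      rw [← pow_mul, hm, pow_mul, ψ.2 j, one_pow]
    · rw [addOrderOf_dvd_iff_nsmul_eq_zero]
      funext j
      rw [Pi.smul_apply, toGroup, nsmul_eq_mul, Pi.zero_apply, ← Nat.cast_mul,
        ZMod.natCast_eq_zero_iff, mul_comm]
      have ho := hχ _ (dvd_last hr_dvd j)
      -- A character of exact order `r_j` placed at `j` detects `t_j` modulo `r_j`.
      have hmem : Pi.mulSingle j (χ (r j)) ∈ chars F r := by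
        intro i
        by_cases hi : i = j
        · subst hi
          rw [Pi.mulSingle_eq_same]
          exact orderOf_dvd_iff_pow_eq_one.1 ho.dvd
        · rw [Pi.mulSingle_eq_of_ne hi, one_pow]
      have h4 : f ⟨_, hmem⟩ = χ (r j) ^ t j := by
        change ∏ i, Pi.mulSingle (M := fun _ => MulChar F ℂ) j (χ (r j)) i ^ t i = _
        rw [Finset.prod_eq_single j, Pi.mulSingle_eq_same]
        · intro i _ hi
          rw [Pi.mulSingle_eq_of_ne hi, one_pow]
        · exact fun h => absurd (Finset.mem_univ j) h
      have h5 : (χ (r j) ^ t j) ^ Nat.card f.range = 1 := by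
        have h6 := pow_card_eq_one' (x := (⟨f ⟨_, hmem⟩, ⟨_, rfl⟩⟩ : f.range))
        have h7 := congrArg Subtype.val h6
        simpa only [SubmonoidClass.mk_pow, OneMemClass.coe_one, h4] using h7
      rw [← pow_mul] at h5
      exact ho ▸ orderOf_dvd_iff_pow_eq_one.2 h5
  rw [← h2, ← h3, h1]

end

end AbelianCovers
end
-- The character sum at a single point
open Polynomial
noncomputable section
namespace AbelianCovers

variable {F : Type*} [Field F] {n : ℕ} {r : Fin (n + 1) → ℕ}

open scoped Classical in
/-- The character `η`, extended by `1` to zero if it is trivial. -/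
def extChar (η : MulChar F ℂ) (x : F) : ℂ := if x = 0 then (if η = 1 then 1 else 0) else η x

/-- The integer vector underlying an index. -/
def idxVec (α : Idx r) (j : Fin (n + 1)) : ℕ := (α.1 j : ℕ)

/-- The integer vector of a ramification type. -/
def typeVec : Option (Idx r) → Fin (n + 1) → ℕ
  | none => 0
  | some α => idxVec α

theorem pairing_charTuple (χ : ℕ → MulChar F ℂ) (s ω t : Fin (n + 1) → ℕ) :
    pairing F t (charTuple χ s ω) = χ (ell s) ^ ∑ j, ell s / s j * ω j * t j := by
  rw [pairing_apply, ← Finset.prod_pow_eq_pow_sum]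
  exact Finset.prod_congr rfl fun j _ => (pow_mul _ _ _).symm

theorem map_leadCoeff {χ : ℕ → MulChar F ℂ} {s : Fin (n + 1) → ℕ}
    (hs : orderOf (χ (ell s)) = ell s) (ω : Fin (n + 1) → ℕ) (c : Fin (n + 1) → Fˣ) :
    χ (ell s) (leadCoeff s ω c) = ∏ j, charTuple χ s ω j (c j) := by
  rw [leadCoeff, map_prod]
  refine Finset.prod_congr rfl fun j _ => ?_
  rw [map_pow, ← MulChar.pow_apply_coe, charTuple]
  conv_rhs => rw [← pow_mod_orderOf, hs]

/-- At `x = 0` the reduced exponent is zero exactly when `η ^ k` is trivial, and then `0 ^ 0 = 1`;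
this is why `extChar` extends the trivial character by `1`. -/
theorem map_pow_mod_eq_extChar {η : MulChar F ℂ} {l : ℕ} (hη : orderOf η = l) (k : ℕ) (x : F) :
    η (x ^ (k % l)) = extChar (η ^ k) x := by
  unfold extChar
  split_ifs with hx h1
  · rw [← orderOf_dvd_iff_pow_eq_one, hη] at h1
    rw [Nat.mod_eq_zero_of_dvd h1, pow_zero, map_one]
  · rw [← orderOf_dvd_iff_pow_eq_one, hη] at h1
    rw [hx, zero_pow (fun h => h1 (Nat.dvd_of_mod_eq_zero h)), MulChar.map_zero]
  · obtain ⟨u, rfl⟩ : ∃ u : Fˣ, (u : F) = x := ⟨Units.mk0 x hx, rfl⟩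
    rw [map_pow, ← MulChar.pow_apply_coe]
    conv_rhs => rw [← pow_mod_orderOf, hη]

variable [Fintype F]

open scoped Classical in
/-- The character sum at a finite point, as a function of the constants and the values there. -/
def localSum (c : Fin (n + 1) → Fˣ) (v : Idx r → F) : ℂ :=
  ∑ ψ ∈ Finset.univ.filter (· ∈ chars F r),
    (∏ j, ψ j (c j)) * ∏ α, extChar (pairing F (idxVec α) ψ) (v α)

open scoped Classical in
/-- The character sum at infinity, as a function of the constants and the degrees. -/
def inftySum (r : Fin (n + 1) → ℕ) (c : Fin (n + 1) → Fˣ) (t : Fin (n + 1) → ℕ) : ℂ :=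
  ∑ ψ ∈ Finset.univ.filter (· ∈ chars F r), if pairing F t ψ = 1 then ∏ j, ψ j (c j) else 0

section

variable {χ : ℕ → MulChar F ℂ}

theorem charSum_some (hr_pos : ∀ j, 0 < r j)
    (hr_dvd : ∀ j : Fin n, r j.castSucc ∣ r j.succ)
    (hχ : ∀ m, m ∣ r (Fin.last n) → orderOf (χ m) = m) (p : Datum F r) (x : F) :
    charSum χ p (OnePoint.some x) = localSum p.1 fun α => (p.2 α).eval x := by
  refine Eq.trans ?_ (sum_charTuple hr_pos hr_dvd hχ _)
  refine Finset.sum_congr rfl fun s hs => Finset.sum_congr rfl fun ω _ => ?_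
  rw [mem_divVectors hr_pos] at hs
  have hl := hχ _ (ell_dvd hr_dvd hs)
  change χ (ell s) ((Fpoly s ω p).eval x) = _
  rw [Fpoly, eval_mul, eval_C, eval_prod, map_mul, map_leadCoeff hl, map_prod]
  congr 1
  refine Finset.prod_congr rfl fun α _ => ?_
  rw [eval_pow, map_pow_mod_eq_extChar hl, pairing_charTuple]
  rfl

theorem charSum_none (hr_pos : ∀ j, 0 < r j)
    (hr_dvd : ∀ j : Fin n, r j.castSucc ∣ r j.succ)
    (hχ : ∀ m, m ∣ r (Fin.last n) → orderOf (χ m) = m) (p : Datum F r) :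
    charSum χ p OnePoint.infty = inftySum r p.1 (degF p) := by
  classical
  refine Eq.trans ?_ (sum_charTuple hr_pos hr_dvd hχ _)
  refine Finset.sum_congr rfl fun s hs => Finset.sum_congr rfl fun ω _ => ?_
  rw [mem_divVectors hr_pos] at hs
  have hl := hχ _ (ell_dvd hr_dvd hs)
  change χ (ell s) (if _ then _ else _) = _
  rw [← map_leadCoeff hl]
  have h1 : pairing F (degF p) (charTuple χ s ω) = 1 ↔
      ell s ∣ ∑ j, ell s / s j * ω j * degF p j := by
    rw [pairing_charTuple, ← orderOf_dvd_iff_pow_eq_one, hl]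
  by_cases h2 : ell s ∣ ∑ j, ell s / s j * ω j * degF p j
  · rw [if_pos h2, if_pos (h1.2 h2)]
  · rw [if_neg h2, if_neg (fun h => h2 (h1.1 h))]
    exact MulChar.map_zero _

end

/-- Pairings with opposite vectors are inverse, hence trivial together. This replaces the degrees
`d_j` by the index whose degree is lowered. -/
theorem inftySum_congr (c : Fin (n + 1) → Fˣ) {t t' : Fin (n + 1) → ℕ}
    (h : ∀ j, t j + t' j ≡ 0 [MOD r j]) : inftySum r c t = inftySum r c t' := by
  classical
  rw [inftySum, inftySum]
  refine Finset.sum_congr rfl fun ψ hψ => ?_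
  have hψ' := (Finset.mem_filter.1 hψ).2
  have h1 : pairing F t ψ * pairing F t' ψ = 1 := by
    rw [pairing_apply, pairing_apply, ← Finset.prod_mul_distrib]
    refine Finset.prod_eq_one fun j _ => ?_
    obtain ⟨m, hm⟩ := (Nat.modEq_zero_iff_dvd.1 (h j))
    rw [← pow_add, hm, pow_mul, hψ' j, one_pow]
  have h2 : pairing F t ψ = 1 ↔ pairing F t' ψ = 1 := by
    constructor
    · intro h3
      rwa [h3, one_mul] at h1
    · intro h3
      rwa [h3, mul_one] at h1
  simp only [h2]

/-- Evaluation of multiplicative characters at a unit. -/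
def evalHom (u : Fˣ) : MulChar F ℂ →* ℂ where
  toFun η := η u
  map_one' := MulChar.one_apply_coe u
  map_mul' η η' := MulChar.mul_apply η η' u

/-- A character of the dual group. -/
def dualHom (c : Fin (n + 1) → Fˣ) (u : Idx r → Fˣ) : (Fin (n + 1) → MulChar F ℂ) →* ℂ :=
  (∏ j, (evalHom (c j)).comp (Pi.evalMonoidHom _ j)) *
    ∏ α, (evalHom (u α)).comp (pairing F (idxVec α))

theorem dualHom_apply {F : Type*} [Field F] (c : Fin (n + 1) → Fˣ) (u : Idx r → Fˣ) (ψ : Fin (n + 1) → MulChar F ℂ) :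
    dualHom c u ψ = (∏ j, ψ j (c j)) * ∏ α, pairing F (idxVec α) ψ (u α) := by
  simp [dualHom, evalHom, MonoidHom.finsetProd_apply]

open scoped Classical in
theorem sum_annih_eq (t : Fin (n + 1) → ℕ) (h : (Fin (n + 1) → MulChar F ℂ) →* ℂ) :
    (∑ ψ ∈ Finset.univ.filter (· ∈ chars F r), if pairing F t ψ = 1 then h ψ else 0) = 0 ∨
    (∑ ψ ∈ Finset.univ.filter (· ∈ chars F r), if pairing F t ψ = 1 then h ψ else 0) =
      (Nat.card (annih F r t) : ℂ) := by
  have h1 : (∑ ψ ∈ Finset.univ.filter (· ∈ chars F r), if pairing F t ψ = 1 then h ψ else 0) =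
      ∑ ψ : annih F r t, (h.comp (annih F r t).subtype) ψ := by
    rw [← Finset.sum_filter, Finset.filter_filter]
    exact Finset.sum_subtype _ (fun ψ => by simp [mem_annih]) _
  rw [h1, sum_hom_units]
  split_ifs
  · right
    rw [Nat.card_eq_fintype_card]
  · left
    exact Nat.cast_zero

theorem inftySum_eq_zero_or (c : Fin (n + 1) → Fˣ) (t : Fin (n + 1) → ℕ) :
    inftySum r c t = 0 ∨ inftySum r c t = (Nat.card (annih F r t) : ℂ) := by
  classical
  have := sum_annih_eq (r := r) t (dualHom (r := r) c 1)
  simpa only [dualHom_apply, Pi.one_apply, Units.val_one, map_one, Finset.prod_const_one,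
    mul_one, inftySum] using this

open scoped Classical in
/-- The possible data of one polynomial at a finite point of a given ramification type. -/
def typeSet (F : Type*) [Field F] [Fintype F] {ι : Type*} (τ : Option ι) (α : ι) :
    Finset (F × F) :=
  if τ = some α then {0} ×ˢ Finset.univ.filter (· ≠ 0)
    else Finset.univ.filter (· ≠ 0) ×ˢ Finset.univ

/-- The possible data at a finite point of a given ramification type. -/
def typeData (F : Type*) [Field F] [Fintype F] {ι : Type*} [Fintype ι] [DecidableEq ι]
    (τ : Option ι) : Finset (ι → F × F) :=
  Fintype.piFinset (typeSet F τ)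

theorem mem_typeData {ι : Type*} [Fintype ι] [DecidableEq ι] {τ : Option ι} {b : ι → F × F} :
    b ∈ typeData F τ ↔ ∀ α, (τ = some α → (b α).1 = 0 ∧ (b α).2 ≠ 0) ∧
      (τ ≠ some α → (b α).1 ≠ 0) := by
  classical
  simp only [typeData, typeSet, Fintype.mem_piFinset]
  refine forall_congr' fun α => ?_
  by_cases h : τ = some α
  · rw [if_pos h]
    simp [h, Finset.mem_product, -Finset.singleton_product]
  · simp [h, Finset.mem_product]

/-- A zero of `f_α` kills the `ψ` pairing non-trivially with `α`. On the others its factor is `1`,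
and the summand is the restriction of a homomorphism to the annihilator. -/
theorem localSum_eq_zero_or (c : Fin (n + 1) → Fˣ) {τ : Option (Idx r)} {b : Idx r → F × F}
    (hb : b ∈ typeData F τ) :
    localSum c (fun α => (b α).1) = 0 ∨
      localSum c (fun α => (b α).1) = (Nat.card (annih F r (typeVec τ)) : ℂ) := by
  classical
  rw [mem_typeData] at hb
  -- The value `1` at a zero is harmless: it is only used where the corresponding pairing is
  -- trivial.
  let u : Idx r → Fˣ := fun α => if h : (b α).1 = 0 then 1 else Units.mk0 _ h
  have h1 : localSum c (fun α => (b α).1) = ∑ ψ ∈ Finset.univ.filter (· ∈ chars F r),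
      if pairing F (typeVec τ) ψ = 1 then dualHom c u ψ else 0 := by
    rw [localSum]
    refine Finset.sum_congr rfl fun ψ _ => ?_
    split_ifs with h2
    · rw [dualHom_apply]
      congr 1
      refine Finset.prod_congr rfl fun α _ => ?_
      by_cases h3 : τ = some α
      · have h4 := ((hb α).1 h3).1
        rw [h3] at h2
        have h5 : pairing F (idxVec α) ψ = 1 := h2
        rw [h5, MulChar.one_apply_coe]
        simp [extChar, h4]
      · have h4 := (hb α).2 h3
        simp [extChar, h4, u]
    · cases τ with
      | none =>
        refine absurd ?_ h2
        simp [typeVec, pairing_apply]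
      | some α =>
        rw [Finset.prod_eq_zero (Finset.mem_univ α), mul_zero]
        have h4 := ((hb α).1 rfl).1
        have h5 : pairing F (idxVec α) ψ ≠ 1 := h2
        simp [extChar, h4, h5]
  rw [h1]
  exact sum_annih_eq _ _

theorem exists_pairing_ne_one {F : Type*} [Field F] (hr_pos : ∀ j, 0 < r j)
    {ψ : Fin (n + 1) → MulChar F ℂ} (hψ : ψ ∈ chars F r)
    (h1 : ψ ≠ 1) : ∃ α : Idx r, pairing F (idxVec α) ψ ≠ 1 := by
  obtain ⟨j, hj⟩ := Function.ne_iff.1 h1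
  rw [Pi.one_apply] at hj
  have hrj : 1 < r j := by
    have h2 := hr_pos j
    have h3 : r j ≠ 1 := by
      intro h3
      have h4 := hψ j
      rw [h3, pow_one] at h4
      exact hj h4
    omega
  let α : Idx r := ⟨fun i => if h : i = j then ⟨1, h ▸ hrj⟩ else ⟨0, hr_pos i⟩, j, by simp⟩
  refine ⟨α, ?_⟩
  have h2 : pairing F (idxVec α) ψ = ψ j := by
    rw [pairing_apply, Finset.prod_eq_single j]
    · simp [idxVec, α]
    · intro i _ hi
      simp [idxVec, α, hi]
    · exact fun h => absurd (Finset.mem_univ j) h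
  rwa [h2]

/-- Only the trivial `ψ` survives. Any other pairs non-trivially with some `α`, and the factor at
that `α` sums to zero: by orthogonality over non-zero values, or termwise if the value there is
forced to be zero. -/
theorem sum_localSum (hr_pos : ∀ j, 0 < r j) (c : Fin (n + 1) → Fˣ) (τ : Option (Idx r)) :
    ∑ b ∈ typeData F τ, localSum c (fun α => (b α).1) = ((typeData F τ).card : ℂ) := by
  classical
  have h1 : ∑ b ∈ typeData F τ, localSum c (fun α => (b α).1) =
      ∑ ψ ∈ Finset.univ.filter (· ∈ chars F r), (∏ j, ψ j (c j)) *
        ∏ α, ∑ x ∈ typeSet F τ α, extChar (pairing F (idxVec α) ψ) x.1 := by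
    simp only [localSum]
    rw [Finset.sum_comm]
    refine Finset.sum_congr rfl fun ψ _ => ?_
    rw [← Finset.mul_sum, Finset.prod_univ_sum, typeData]
  rw [h1, Finset.sum_eq_single 1]
  · have h2 (α : Idx r) (x : F) : extChar (pairing F (idxVec α) 1) x = 1 := by
      rw [map_one, extChar]
      by_cases h : x = 0
      · simp [h]
      · rw [if_neg h, MulChar.one_apply (isUnit_iff_ne_zero.2 h)]
    simp only [h2, Pi.one_apply, MulChar.one_apply_coe, Finset.prod_const_one, one_mul,
      Finset.sum_const, nsmul_eq_mul, mul_one]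
    rw [typeData, Fintype.card_piFinset]
    push_cast
    rfl
  · intro ψ hψ h1
    obtain ⟨α, hα⟩ := exists_pairing_ne_one hr_pos (Finset.mem_filter.1 hψ).2 h1
    suffices h : ∃ α, ∑ x ∈ typeSet F τ α, extChar (pairing F (idxVec α) ψ) x.1 = 0 by
      obtain ⟨α, h⟩ := h
      rw [Finset.prod_eq_zero (Finset.mem_univ α) h, mul_zero]
    have h3 (α : Idx r) (hα : pairing F (idxVec α) ψ ≠ 1) :
        ∑ x ∈ typeSet F τ α, extChar (pairing F (idxVec α) ψ) x.1 = 0 := by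
      by_cases h4 : τ = some α
      · refine Finset.sum_eq_zero fun x hx => ?_
        simp only [typeSet, if_pos h4, Finset.mem_product, Finset.mem_singleton] at hx
        simp [extChar, hx.1, hα]
      · simp only [typeSet, if_neg h4]
        rw [Finset.sum_product_right]
        refine Finset.sum_eq_zero fun y _ => ?_
        rw [Finset.sum_filter]
        refine Eq.trans ?_ (MulChar.sum_eq_zero_of_ne_one hα)
        refine Finset.sum_congr rfl fun x _ => ?_
        by_cases hx : x = 0
        · simp [hx, MulChar.map_zero]
        · simp [hx, extChar]
    exact ⟨α, h3 α hα⟩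
  · intro h
    exact absurd (Finset.mem_filter.2 ⟨Finset.mem_univ _, (chars F r).one_mem⟩) h

theorem sum_inftySum [DecidableEq F] (t : Fin (n + 1) → ℕ) :
    ∑ c : Fin (n + 1) → Fˣ, inftySum r c t = (Fintype.card (Fin (n + 1) → Fˣ) : ℂ) := by
  classical
  have h1 : ∑ c : Fin (n + 1) → Fˣ, inftySum r c t =
      ∑ ψ ∈ Finset.univ.filter (· ∈ chars F r),
        if pairing F t ψ = 1 then ∏ j, ∑ u : Fˣ, ψ j u else 0 := by
    simp only [inftySum]
    rw [Finset.sum_comm]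
    refine Finset.sum_congr rfl fun ψ _ => ?_
    split_ifs
    · rw [Finset.prod_univ_sum, Fintype.piFinset_univ]
    · exact Finset.sum_const_zero
  rw [h1, Finset.sum_eq_single 1]
  · simp [MulChar.one_apply_coe]
  · intro ψ _ hψ
    obtain ⟨j, hj⟩ := Function.ne_iff.1 hψ
    rw [Pi.one_apply] at hj
    have h2 : ∑ u : Fˣ, ψ j u = 0 := by
      refine sum_hom_units_eq_zero ((ψ j : F →* ℂ).comp (Units.coeHom F)) fun h => hj ?_
      exact MulChar.eq_one_iff.2 fun u => DFunLike.congr_fun h u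
    rw [Finset.prod_eq_zero (Finset.mem_univ j) h2, ite_self]
  · intro h
    exact absurd (Finset.mem_filter.2 ⟨Finset.mem_univ _, (chars F r).one_mem⟩) h

/-- The proportion of cases in which a sum that is `N` or `0`, with mean `1`, has the value `e`. -/
def frac (N e : ℕ) : ℝ := if e = N then (N : ℝ)⁻¹ else if e = 0 then 1 - (N : ℝ)⁻¹ else 0

open scoped Classical in
-- Two possible values `0`, `N` and mean `1` leave only one distribution.
theorem card_filter_eq_frac {β : Type*} (s : Finset β) (S : β → ℂ) {N : ℕ} (hN : 0 < N)
    (hS : ∀ b ∈ s, S b = 0 ∨ S b = N) (hsum : ∑ b ∈ s, S b = s.card) (e : ℕ) :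
    ((s.filter fun b => S b = e).card : ℝ) = s.card * frac N e := by
  have hN' : (N : ℝ) ≠ 0 := by exact_mod_cast hN.ne'
  have hNC : (N : ℂ) ≠ 0 := by exact_mod_cast hN.ne'
  have h1 : ((s.filter fun b => S b = N).card : ℝ) * N = s.card := by
    have h2 : ∑ b ∈ s, S b = ((s.filter fun b => S b = N).card : ℂ) * N := by
      rw [← nsmul_eq_mul, ← Finset.sum_const, Finset.sum_filter]
      refine Finset.sum_congr rfl fun b hb => ?_
      rcases hS b hb with h | h
      · simp [h, hNC.symm]
      · simp [h]
    rw [h2] at hsum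
    exact_mod_cast hsum
  have h3 : (s.filter fun b => S b = N).card + (s.filter fun b => S b = (0 : ℕ)).card = s.card := by
    rw [← Finset.card_filter_add_card_filter_not (s := s) (fun b => S b = N)]
    congr 2
    refine Finset.filter_congr fun b hb => ?_
    rcases hS b hb with h | h
    · simp [h, hNC.symm]
    · simp [h, hNC]
  unfold frac
  split_ifs with h4 h5
  · subst h4
    rw [← h1]
    field_simp
  · subst h5
    have h3' : ((s.filter fun b => S b = N).card : ℝ) +
      (s.filter fun b => S b = (0 : ℕ)).card = s.card := by exact_mod_cast h3
    have h6 : ((s.filter fun b => S b = N).card : ℝ) = s.card * (N : ℝ)⁻¹ := by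
      rw [← h1]
      field_simp
    rw [mul_sub, mul_one, ← h6]
    exact eq_sub_of_add_eq' h3'
  · rw [mul_zero, Nat.cast_eq_zero, Finset.card_eq_zero, Finset.filter_eq_empty_iff]
    intro b hb h
    rcases hS b hb with h' | h'
    · rw [h'] at h
      exact h5 (by exact_mod_cast h.symm)
    · rw [h'] at h
      exact h4 (by exact_mod_cast h.symm)

end AbelianCovers
end
-- Weights of the ramification types and the main term
open Polynomial
noncomputable section
namespace AbelianCovers

variable {F : Type*} [Field F] [Fintype F] {n : ℕ} {r : Fin (n + 1) → ℕ}

theorem prod_onePoint {F : Type*} [Fintype F] (f : OnePoint F → ℝ) :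
    ∏ x, f x = f OnePoint.infty * ∏ x : F, f (OnePoint.some x) :=
  Fintype.prod_option (α := F) f

theorem toGroup_typeVec_bijective (hr_pos : ∀ j, 0 < r j) :
    Function.Bijective fun τ : Option (Idx r) => toGroup r (typeVec τ) := by
  have hlt (τ : Option (Idx r)) (j : Fin (n + 1)) : typeVec τ j < r j := by
    cases τ with
    | none => exact hr_pos j
    | some α => exact (α.1 j).2
  constructor
  · intro τ τ' h
    have h1 (j : Fin (n + 1)) : typeVec τ j = typeVec τ' j := by
      have := congrFun h j
      simp only [toGroup] at this
      rw [ZMod.natCast_eq_natCast_iff] at this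
      exact this.eq_of_lt_of_lt (hlt τ j) (hlt τ' j)
    cases τ with
    | none =>
      cases τ' with
      | none => rfl
      | some α =>
        obtain ⟨j, hj⟩ := α.2
        exact absurd (h1 j).symm hj
    | some α =>
      cases τ' with
      | none =>
        obtain ⟨j, hj⟩ := α.2
        exact absurd (h1 j) hj
      | some β =>
        congr 1
        exact Subtype.ext (funext fun j => Fin.ext (h1 j))
  · intro g
    have (j : Fin (n + 1)) : NeZero (r j) := ⟨(hr_pos j).ne'⟩
    by_cases hg : ∃ j, (g j).val ≠ 0
    · refine ⟨some ⟨fun j => ⟨(g j).val, ZMod.val_lt _⟩, hg⟩, funext fun j => ?_⟩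
      exact ZMod.natCast_zmod_val (g j)
    · push Not at hg
      refine ⟨none, funext fun j => ?_⟩
      have := (ZMod.val_eq_zero (g j)).1 (hg j)
      simp [toGroup, typeVec, this]

/-- The order of a ramification type. -/
def typeOrder (τ : Option (Idx r)) : ℕ := addOrderOf (toGroup r (typeVec τ))

theorem card_typeOrder_eq (hr_pos : ∀ j, 0 < r j) (s : ℕ) :
    (Finset.univ.filter fun τ : Option (Idx r) => typeOrder τ = s).card = phiG r s := by
  rw [phiG, ← Fintype.card_subtype, ← Nat.card_eq_fintype_card]
  exact Nat.card_congr ((Equiv.ofBijective _ (toGroup_typeVec_bijective hr_pos)).subtypeEquiv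
    fun τ => Iff.rfl)

theorem card_option_idx (hr_pos : ∀ j, 0 < r j) : Fintype.card (Option (Idx r)) = groupOrder r := by
  have (j : Fin (n + 1)) : NeZero (r j) := ⟨(hr_pos j).ne'⟩
  rw [Fintype.card_congr (Equiv.ofBijective _ (toGroup_typeVec_bijective hr_pos)),
    Fintype.card_pi, groupOrder]
  exact Finset.prod_congr rfl fun j _ => ZMod.card (r j)

theorem groupOrder_pos (hr_pos : ∀ j, 0 < r j) : 0 < groupOrder r :=
  Finset.prod_pos fun j _ => hr_pos j

theorem last_dvd_groupOrder (r : Fin (n + 1) → ℕ) : r (Fin.last n) ∣ groupOrder r :=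
  Finset.dvd_prod_of_mem r (Finset.mem_univ _)

theorem typeOrder_dvd (hr_dvd : ∀ j : Fin n, r j.castSucc ∣ r j.succ) (τ : Option (Idx r)) :
    typeOrder τ ∣ r (Fin.last n) := by
  rw [typeOrder, addOrderOf_dvd_iff_nsmul_eq_zero]
  funext j
  rw [Pi.smul_apply, nsmul_eq_mul, (ZMod.natCast_eq_zero_iff _ _).2 (dvd_last hr_dvd j), zero_mul,
    Pi.zero_apply]

theorem typeOrder_none : typeOrder (none : Option (Idx r)) = 1 := by
  rw [typeOrder, AddMonoid.addOrderOf_eq_one_iff]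
  funext j
  simp [toGroup, typeVec]

theorem typeOrder_some_ne_one (hr_pos : ∀ j, 0 < r j) (α : Idx r) : typeOrder (some α) ≠ 1 := by
  rw [← typeOrder_none (r := r), typeOrder, typeOrder]
  intro h
  have h0 : toGroup r (typeVec (none : Option (Idx r))) = 0 := by
    funext j
    simp [toGroup, typeVec]
  rw [h0, addOrderOf_zero, AddMonoid.addOrderOf_eq_one_iff, ← h0] at h
  exact absurd ((toGroup_typeVec_bijective hr_pos).1 h) (by simp)

/-- The weighted proportion of the value `e`. -/
def valueWeight (F : Type*) [Field F] [Fintype F] (r : Fin (n + 1) → ℕ) (e : ℕ) : ℝ :=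
  ∑ τ : Option (Idx r), weight F τ * frac (Nat.card (annih F r (typeVec τ))) e

/-- The total weight. -/
def totalWeight (F : Type*) [Field F] [Fintype F] (r : Fin (n + 1) → ℕ) : ℝ :=
  ∑ τ : Option (Idx r), weight F τ

theorem weight_pos {ι : Type*} (τ : Option ι) : 0 < weight F τ := by
  have := two_le_card (F := F)
  cases τ with
  | none => exact one_pos
  | some β =>
    rw [weight]
    positivity

theorem totalWeight_pos : 0 < totalWeight F r :=
  Finset.sum_pos (fun τ _ => weight_pos τ) ⟨none, Finset.mem_univ _⟩

theorem totalWeight_eq (hr_pos : ∀ j, 0 < r j) :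
    totalWeight F r = ((Fintype.card F : ℝ) + groupOrder r - 1) / Fintype.card F := by
  have := two_le_card (F := F)
  rw [totalWeight, Fintype.sum_option, ← card_option_idx hr_pos, Fintype.card_option]
  simp only [weight, Finset.sum_const, Finset.card_univ, nsmul_eq_mul]
  push_cast
  field_simp
  ring

section

variable {χ : ℕ → MulChar F ℂ}

theorem card_annih_mul_typeOrder (hr_pos : ∀ j, 0 < r j)
    (hr_dvd : ∀ j : Fin n, r j.castSucc ∣ r j.succ)
    (hχ : ∀ m, m ∣ r (Fin.last n) → orderOf (χ m) = m) (τ : Option (Idx r)) :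
    Nat.card (annih F r (typeVec τ)) * typeOrder τ = groupOrder r :=
  card_annih_mul hr_pos hr_dvd hχ _

/-- As `N · ord τ = |G|`, the value `|G| / s` arises only from types of order `s`, each with
frequency `1/N = s / |G|`. -/
theorem valueWeight_div (hr_pos : ∀ j, 0 < r j)
    (hr_dvd : ∀ j : Fin n, r j.castSucc ∣ r j.succ)
    (hχ : ∀ m, m ∣ r (Fin.last n) → orderOf (χ m) = m) {s : ℕ} (hs : s ∣ r (Fin.last n)) :
    valueWeight F r (groupOrder r / s) =
      ∑ τ : Option (Idx r), if typeOrder τ = s then weight F τ * (s / groupOrder r : ℝ) else 0 := by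
  rw [valueWeight]
  refine Finset.sum_congr rfl fun τ _ => ?_
  have h1 := card_annih_mul_typeOrder hr_pos hr_dvd hχ τ
  have hg := groupOrder_pos hr_pos
  set N := Nat.card (annih F r (typeVec τ)) with hN
  set o := typeOrder τ with ho
  have hsg : s ∣ groupOrder r := hs.trans (last_dvd_groupOrder r)
  have hs0 : 0 < s := Nat.pos_of_dvd_of_pos hsg hg
  have hN0 : 0 < N := Nat.pos_of_mul_pos_right (h1 ▸ hg)
  have he0 : groupOrder r / s ≠ 0 := (Nat.div_pos (Nat.le_of_dvd hg hsg) hs0).ne'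
  by_cases hos : o = s
  · have h2 : groupOrder r / s = N := by
      rw [← h1, hos, Nat.mul_div_cancel _ hs0]
    rw [if_pos hos, frac, if_pos h2, ← h1, hos]
    have : (s : ℝ) ≠ 0 := by exact_mod_cast hs0.ne'
    push_cast
    field_simp
  · have h2 : groupOrder r / s ≠ N := by
      intro h2
      refine hos (Nat.eq_of_mul_eq_mul_left hN0 ?_)
      rw [h1, ← h2, Nat.div_mul_cancel hsg]
    rw [if_neg hos, frac, if_neg h2, if_neg he0, mul_zero]

theorem valueWeight_groupOrder (hr_pos : ∀ j, 0 < r j)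
    (hr_dvd : ∀ j : Fin n, r j.castSucc ∣ r j.succ)
    (hχ : ∀ m, m ∣ r (Fin.last n) → orderOf (χ m) = m) :
    valueWeight F r (groupOrder r) / totalWeight F r =
      (Fintype.card F : ℝ) / (groupOrder r * (Fintype.card F + groupOrder r - 1)) := by
  have h1 := valueWeight_div hr_pos hr_dvd hχ (one_dvd _)
  rw [Nat.div_one, Fintype.sum_option, if_pos typeOrder_none, Finset.sum_eq_zero
    (fun α _ => if_neg (typeOrder_some_ne_one hr_pos α))] at h1
  rw [h1, totalWeight_eq hr_pos, weight]
  have hq := two_le_card (F := F)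
  have hg : (1 : ℝ) ≤ groupOrder r := by exact_mod_cast groupOrder_pos hr_pos
  have : (Fintype.card F : ℝ) + groupOrder r - 1 ≠ 0 := by linarith
  field_simp
  simp

/-- For `s ≠ 1` only the `φ_G(s)` ramified types of order `s` contribute, all with weight `1/q`. -/
theorem valueWeight_div_ne_one (hr_pos : ∀ j, 0 < r j)
    (hr_dvd : ∀ j : Fin n, r j.castSucc ∣ r j.succ)
    (hχ : ∀ m, m ∣ r (Fin.last n) → orderOf (χ m) = m) {s : ℕ} (hs : s ∣ r (Fin.last n))
    (hs1 : s ≠ 1) :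
    valueWeight F r (groupOrder r / s) / totalWeight F r =
      (s : ℝ) * phiG r s / (groupOrder r * (Fintype.card F + groupOrder r - 1)) := by
  rw [valueWeight_div hr_pos hr_dvd hχ hs, ← Finset.sum_filter]
  have h1 : ∀ τ ∈ Finset.univ.filter (fun τ : Option (Idx r) => typeOrder τ = s),
      weight F τ * (s / groupOrder r : ℝ) = (Fintype.card F : ℝ)⁻¹ * (s / groupOrder r) := by
    intro τ hτ
    cases τ with
    | none =>
      rw [Finset.mem_filter, typeOrder_none] at hτ
      exact absurd hτ.2.symm hs1
    | some β => rfl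
  rw [Finset.sum_congr rfl h1, Finset.sum_const, card_typeOrder_eq hr_pos, nsmul_eq_mul,
    totalWeight_eq hr_pos]
  have hq := two_le_card (F := F)
  have hg : (1 : ℝ) ≤ groupOrder r := by exact_mod_cast groupOrder_pos hr_pos
  have : (Fintype.card F : ℝ) + groupOrder r - 1 ≠ 0 := by linarith
  field_simp

theorem sum_typeOrder (hr_pos : ∀ j, 0 < r j)
    (hr_dvd : ∀ j : Fin n, r j.castSucc ∣ r j.succ) :
    ∑ τ : Option (Idx r), (typeOrder τ : ℝ) =
      ∑ s ∈ (r (Fin.last n)).divisors, (s : ℝ) * phiG r s := by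
  rw [← Finset.sum_fiberwise_of_maps_to (g := typeOrder) (t := (r (Fin.last n)).divisors)
    (fun τ _ => Nat.mem_divisors.2 ⟨typeOrder_dvd hr_dvd τ, (hr_pos _).ne'⟩)]
  refine Finset.sum_congr rfl fun s _ => ?_
  rw [Finset.sum_congr rfl fun τ hτ => by rw [(Finset.mem_filter.1 hτ).2], Finset.sum_const,
    card_typeOrder_eq hr_pos, nsmul_eq_mul, mul_comm]

theorem valueWeight_zero (hr_pos : ∀ j, 0 < r j)
    (hr_dvd : ∀ j : Fin n, r j.castSucc ∣ r j.succ)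
    (hχ : ∀ m, m ∣ r (Fin.last n) → orderOf (χ m) = m) :
    valueWeight F r 0 = ∑ τ : Option (Idx r), weight F τ * (1 - typeOrder τ / groupOrder r) := by
  rw [valueWeight]
  refine Finset.sum_congr rfl fun τ _ => ?_
  have h1 := card_annih_mul_typeOrder hr_pos hr_dvd hχ τ
  have hg := groupOrder_pos hr_pos
  set N := Nat.card (annih F r (typeVec τ)) with hN
  set o := typeOrder τ with ho
  have hN0 : 0 < N := Nat.pos_of_mul_pos_right (h1 ▸ hg)
  have ho0 : 0 < o := Nat.pos_of_mul_pos_left (h1 ▸ hg)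
  rw [frac, if_neg hN0.ne, if_pos rfl, ← h1]
  have : (o : ℝ) ≠ 0 := by exact_mod_cast ho0.ne'
  have : (N : ℝ) ≠ 0 := by exact_mod_cast hN0.ne'
  push_cast
  field_simp

theorem valueWeight_zero_div (hr_pos : ∀ j, 0 < r j)
    (hr_dvd : ∀ j : Fin n, r j.castSucc ∣ r j.succ)
    (hχ : ∀ m, m ∣ r (Fin.last n) → orderOf (χ m) = m) :
    valueWeight F r 0 / totalWeight F r =
      (((groupOrder r : ℝ) - 1) * (Fintype.card F + groupOrder r) -
        ∑ s ∈ (r (Fin.last n)).divisors, (s : ℝ) * phiG r s + 1) /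
        (groupOrder r * (Fintype.card F + groupOrder r - 1)) := by
  rw [valueWeight_zero hr_pos hr_dvd hχ, ← sum_typeOrder hr_pos hr_dvd, totalWeight_eq hr_pos,
    Fintype.sum_option, Fintype.sum_option, typeOrder_none]
  have hq := two_le_card (F := F)
  have hg : (1 : ℝ) ≤ groupOrder r := by exact_mod_cast groupOrder_pos hr_pos
  have h1 : (Fintype.card F : ℝ) + groupOrder r - 1 ≠ 0 := by linarith
  have h2 : (groupOrder r : ℝ) = Fintype.card (Idx r) + 1 := by
    rw [← card_option_idx hr_pos, Fintype.card_option]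
    push_cast
    rfl
  simp only [weight]
  rw [← Finset.mul_sum, Finset.sum_sub_distrib, ← Finset.sum_div, Finset.sum_const,
    Finset.card_univ, nsmul_eq_mul, mul_one]
  have h3 : (Fintype.card (Idx r) : ℝ) = groupOrder r - 1 := by linarith
  rw [h3]
  field_simp
  push_cast
  ring

/-- The points are grouped by their value `e x`; distinct divisors `s` give distinct non-zero values
`|G| / s`, so no group is counted twice. -/
theorem mainTerm_eq (hr_pos : ∀ j, 0 < r j)
    (hr_dvd : ∀ j : Fin n, r j.castSucc ∣ r j.succ)
    (hχ : ∀ m, m ∣ r (Fin.last n) → orderOf (χ m) = m) (e : OnePoint F → ℕ)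
    (he : ∀ x, e x = 0 ∨ ∃ s, s ∣ r (Fin.last n) ∧ e x = groupOrder r / s) :
    mainTerm r e = ∏ x, valueWeight F r (e x) / totalWeight F r := by
  classical
  have hg := groupOrder_pos hr_pos
  set D := (r (Fin.last n)).divisors with hD
  have hDg {s : ℕ} (hs : s ∈ D) : s ∣ groupOrder r :=
    (Nat.dvd_of_mem_divisors hs).trans (last_dvd_groupOrder r)
  have h1 : ∏ x, valueWeight F r (e x) / totalWeight F r =
      ∏ v ∈ insert 0 (D.image fun s => groupOrder r / s),
        (valueWeight F r v / totalWeight F r) ^ mult e v := by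
    rw [← Finset.prod_fiberwise_of_maps_to (g := e)
      (t := insert 0 (D.image fun s => groupOrder r / s))]
    · refine Finset.prod_congr rfl fun v _ => ?_
      rw [Finset.prod_congr rfl fun x hx => by rw [(Finset.mem_filter.1 hx).2],
        Finset.prod_const, mult, Nat.card_eq_fintype_card, Fintype.card_subtype]
    · intro x _
      rcases he x with h | ⟨s, hs, h⟩
      · rw [h]
        exact Finset.mem_insert_self _ _
      · rw [h]
        exact Finset.mem_insert_of_mem (Finset.mem_image.2
          ⟨s, Nat.mem_divisors.2 ⟨hs, (hr_pos _).ne'⟩, rfl⟩)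
  have h0 : 0 ∉ D.image fun s => groupOrder r / s := by
    intro h
    obtain ⟨s, hs, h⟩ := Finset.mem_image.1 h
    have h2 := Nat.pos_of_dvd_of_pos (hDg hs) hg
    exact (Nat.div_pos (Nat.le_of_dvd hg (hDg hs)) h2).ne' h
  have hinj : Set.InjOn (fun s => groupOrder r / s) D := by
    intro s hs s' hs' h
    have h2 : groupOrder r / s * s = groupOrder r / s * s' := by
      simp only at h
      rw [Nat.div_mul_cancel (hDg hs), h, Nat.div_mul_cancel (hDg hs')]
    refine Nat.eq_of_mul_eq_mul_left (Nat.div_pos (Nat.le_of_dvd hg (hDg hs))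
      (Nat.pos_of_dvd_of_pos (hDg hs) hg)) h2
  have h1D : 1 ∈ D := Nat.mem_divisors.2 ⟨one_dvd _, (hr_pos _).ne'⟩
  rw [h1, Finset.prod_insert h0, Finset.prod_image hinj, ← Finset.mul_prod_erase D _ h1D,
    Nat.div_one, valueWeight_zero_div hr_pos hr_dvd hχ, valueWeight_groupOrder hr_pos hr_dvd hχ,
    ← mul_assoc, mainTerm]
  congr 1
  refine Finset.prod_congr rfl fun s hs => ?_
  rw [Finset.mem_erase] at hs
  rw [valueWeight_div_ne_one hr_pos hr_dvd hχ (Nat.dvd_of_mem_divisors hs.2) hs.1]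

end

end AbelianCovers
end
-- From the family to local data at the points of the projective line
open Polynomial
noncomputable section
namespace AbelianCovers

/-- Up to a unit, an irreducible polynomial has degree at least two or is `X - y`, and a double root
is visible in the value and the derivative. -/
theorem squarefree_iff_away {F : Type*} [Field F] {f : F[X]} (hf : f ≠ 0) :
    Squarefree f ↔ (∀ P : F[X], P.Monic → Irreducible P → 2 ≤ P.natDegree → ¬ P ^ 2 ∣ f) ∧
      ∀ x, ¬ (f.eval x = 0 ∧ f.derivative.eval x = 0) := by
  classical
  rw [squarefree_iff_irreducible_sq_not_dvd_of_ne_zero hf]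
  constructor
  · intro h
    refine ⟨fun P _ hP _ hd => h P hP (sq P ▸ hd), fun x hx => ?_⟩
    refine h (X - C x) (irreducible_X_sub_C x) ?_
    rw [← sq, ← le_rootMultiplicity_iff hf]
    exact (one_lt_rootMultiplicity_iff_isRoot hf).2 hx
  · rintro ⟨h1, h2⟩ P hP hd
    have hn : Irreducible (normalize P) := (normalize_associated P).symm.irreducible hP
    have hm : (normalize P).Monic := monic_normalize hP.ne_zero
    have hd' : normalize P ^ 2 ∣ f := by
      rw [sq]
      exact (mul_dvd_mul (normalize_associated P).dvd (normalize_associated P).dvd).trans hd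
    rcases Nat.lt_or_ge (normalize P).natDegree 2 with h3 | h3
    · have h4 : (normalize P).natDegree = 1 := by
        have := hn.natDegree_pos
        omega
      obtain ⟨y, hy⟩ : ∃ y, normalize P = X - C y :=
        ⟨-(normalize P).coeff 0, by rw [C_neg, sub_neg_eq_add]; exact hm.eq_X_add_C h4⟩
      rw [hy, ← le_rootMultiplicity_iff hf] at hd'
      exact h2 y ((one_lt_rootMultiplicity_iff_isRoot hf).1 hd')
    · exact h1 _ hm hn h3 hd'

theorem isCoprime_iff_away {F : Type*} [Field F] {f g : F[X]} (hf : f ≠ 0) :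
    IsCoprime f g ↔
      (∀ P : F[X], P.Monic → Irreducible P → 2 ≤ P.natDegree → ¬ (P ∣ f ∧ P ∣ g)) ∧
      ∀ x, ¬ (f.eval x = 0 ∧ g.eval x = 0) := by
  classical
  constructor
  · intro h
    refine ⟨fun P _ hP _ hd => hP.not_isUnit (h.isUnit_of_dvd' hd.1 hd.2), fun x hx => ?_⟩
    exact (irreducible_X_sub_C x).not_isUnit
      (h.isUnit_of_dvd' (dvd_iff_isRoot.2 hx.1) (dvd_iff_isRoot.2 hx.2))
  · rintro ⟨h1, h2⟩
    refine isCoprime_of_irreducible_dvd (fun h => hf h.1) fun P hP hdf hdg => ?_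
    have hn : Irreducible (normalize P) := (normalize_associated P).symm.irreducible hP
    have hm : (normalize P).Monic := monic_normalize hP.ne_zero
    rw [← normalize_dvd_iff] at hdf hdg
    rcases Nat.lt_or_ge (normalize P).natDegree 2 with h3 | h3
    · have h4 : (normalize P).natDegree = 1 := by
        have := hn.natDegree_pos
        omega
      obtain ⟨y, hy⟩ : ∃ y, normalize P = X - C y :=
        ⟨-(normalize P).coeff 0, by rw [C_neg, sub_neg_eq_add]; exact hm.eq_X_add_C h4⟩
      rw [hy, dvd_iff_isRoot] at hdf hdg
      exact h2 y ⟨hdf, hdg⟩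
    · exact h1 _ hm hn h3 ⟨hdf, hdg⟩

variable {F : Type*} [Field F] [Fintype F]

/-- The data at each finite point are of some ramification type. -/
def Admissible {ι : Type*} [Fintype ι] [DecidableEq ι] (a : ι → F → F × F) : Prop :=
  ∀ x, ∃ σ, (fun α => a α x) ∈ typeData F σ

/-- Admissibility is the part of the conditions at linear primes: at each point at most one entry
vanishes, and its zero is simple. -/
theorem goodTuple_and_admissible_iff {ι : Type*} [Fintype ι] [DecidableEq ι] {f : ι → F[X]}
    (hf : ∀ α, f α ≠ 0) :
    (GoodTuple f ∧ Admissible fun α => herm F (f α)) ↔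
      (∀ α, Squarefree (f α)) ∧ ∀ α β, α ≠ β → IsCoprime (f α) (f β) := by
  constructor
  · rintro ⟨h1, h2⟩
    refine ⟨fun α => (squarefree_iff_away (hf α)).2 ⟨fun P hm hP hd => (h1 P hm hP hd).1 α,
      fun x hx => ?_⟩, fun α β hαβ => (isCoprime_iff_away (hf α)).2 ⟨fun P hm hP hd =>
        (h1 P hm hP hd).2 α β hαβ, fun x hx => ?_⟩⟩
    · obtain ⟨σ, hσ⟩ := h2 x
      rw [mem_typeData] at hσ
      by_cases h : σ = some α
      · exact ((hσ α).1 h).2 hx.2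
      · exact (hσ α).2 h hx.1
    · obtain ⟨σ, hσ⟩ := h2 x
      rw [mem_typeData] at hσ
      have h3 : σ = some α := by
        by_contra h
        exact (hσ α).2 h hx.1
      have h4 : σ = some β := by
        by_contra h
        exact (hσ β).2 h hx.2
      exact hαβ (Option.some_injective _ (h3.symm.trans h4))
  · rintro ⟨h1, h2⟩
    refine ⟨fun P hm hP hd => ⟨fun α => ((squarefree_iff_away (hf α)).1 (h1 α)).1 P hm hP hd,
      fun α β hαβ => ((isCoprime_iff_away (hf α)).1 (h2 α β hαβ)).1 P hm hP hd⟩, fun x => ?_⟩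
    by_cases h : ∃ α, (f α).eval x = 0
    · obtain ⟨α, hα⟩ := h
      refine ⟨some α, mem_typeData.2 fun β => ⟨fun hβ => ?_, fun hβ hβ' => ?_⟩⟩
      · rw [Option.some_inj] at hβ
        subst hβ
        exact ⟨hα, fun h' => ((squarefree_iff_away (hf α)).1 (h1 α)).2 x ⟨hα, h'⟩⟩
      · have hαβ : α ≠ β := fun h => hβ (congrArg some h)
        exact ((isCoprime_iff_away (hf α)).1 (h2 α β hαβ)).2 x ⟨hα, hβ'⟩
    · push Not at h
      exact ⟨none, mem_typeData.2 fun β => ⟨fun hβ => by simp at hβ, fun _ => h β⟩⟩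

variable {n : ℕ} {r : Fin (n + 1) → ℕ}

theorem mem_Fhat_iff {d : Idx r → ℕ} {p : Datum F r} :
    p ∈ Fhat F r d ↔ ∃ τ : Option (Idx r), (∀ β, τ = some β → 1 ≤ d β) ∧
      p.2 ∈ tuples F (lowerDeg d τ) ∧ GoodTuple p.2 ∧ Admissible fun α => herm F (p.2 α) := by
  constructor
  · rintro ⟨h1, h2, h3⟩
    have h4 := (goodTuple_and_admissible_iff fun α => (h1 α).1.ne_zero).2
      ⟨fun α => (h1 α).2, h2⟩
    rcases h3 with h3 | ⟨β, h5, h6⟩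
    · exact ⟨none, fun β h => by simp at h, mem_tuples.2 fun α => ⟨(h1 α).1, h3 α⟩, h4⟩
    · refine ⟨some β, fun γ h => ?_, mem_tuples.2 fun α => ⟨(h1 α).1, ?_⟩, h4⟩
      · rw [Option.some_inj] at h
        subst h
        omega
      · by_cases hα : α = β
        · subst hα
          simp only [lowerDeg, Function.update_self]
          omega
        · simp only [lowerDeg, Function.update_of_ne hα]
          exact h6 α hα
  · rintro ⟨τ, hτ, h1, h2⟩
    rw [mem_tuples] at h1
    obtain ⟨h3, h4⟩ := (goodTuple_and_admissible_iff fun α => (h1 α).1.ne_zero).1 h2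
    refine ⟨fun α => ⟨(h1 α).1, h3 α⟩, h4, ?_⟩
    cases τ with
    | none => exact Or.inl fun α => (h1 α).2
    | some β =>
      refine Or.inr ⟨β, ?_, fun α hα => ?_⟩
      · rw [(h1 β).2]
        have := hτ β rfl
        simp only [lowerDeg, Function.update_self]
        omega
      · rw [(h1 α).2]
        simp only [lowerDeg, Function.update_of_ne hα]

/-- Adding the type restores the missing degree. With the congruences on `d`, the degrees `d_j` are
therefore opposite to the type modulo `r_j`. -/
theorem degF_add_typeVec {d : Idx r → ℕ} {p : Datum F r} {τ : Option (Idx r)}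
    (hτ : ∀ β, τ = some β → 1 ≤ d β) (hp : p.2 ∈ tuples F (lowerDeg d τ)) (j : Fin (n + 1)) :
    degF p j + typeVec τ j = ∑ α : Idx r, (α.1 j : ℕ) * d α := by
  rw [mem_tuples] at hp
  rw [degF, Finset.sum_congr rfl fun α _ => by rw [(hp α).2]]
  cases τ with
  | none => simp [lowerDeg, typeVec]
  | some β =>
    rw [← Finset.add_sum_erase _ _ (Finset.mem_univ β), ← Finset.add_sum_erase _ _ (Finset.mem_univ β)]
    have h1 : ∑ α ∈ Finset.univ.erase β, (α.1 j : ℕ) * lowerDeg d (some β) α =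
        ∑ α ∈ Finset.univ.erase β, (α.1 j : ℕ) * d α := by
      refine Finset.sum_congr rfl fun α hα => ?_
      rw [lowerDeg, Function.update_of_ne (Finset.ne_of_mem_erase hα)]
    obtain ⟨k, hk⟩ := Nat.exists_eq_add_of_le' (hτ β rfl)
    rw [h1]
    simp only [lowerDeg, Function.update_self, typeVec, idxVec, hk]
    rw [Nat.add_sub_cancel]
    ring

/-- The conditions on the character sums, in terms of the data. -/
def Matches (e : OnePoint F → ℕ) (τ : Option (Idx r)) (c : Fin (n + 1) → Fˣ)
    (a : Idx r → F → F × F) : Prop :=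
  inftySum r c (typeVec τ) = (e OnePoint.infty : ℂ) ∧
    ∀ x : F, localSum c (fun α => (a α x).1) = (e (OnePoint.some x) : ℂ)

theorem forall_charSum_iff {χ : ℕ → MulChar F ℂ} (hr_pos : ∀ j, 0 < r j)
    (hr_dvd : ∀ j : Fin n, r j.castSucc ∣ r j.succ)
    (hχ : ∀ m, m ∣ r (Fin.last n) → orderOf (χ m) = m) {d : Idx r → ℕ}
    (hd : ∀ j, ∑ α : Idx r, (α.1 j : ℕ) * d α ≡ 0 [MOD r j]) {p : Datum F r} {τ : Option (Idx r)}
    (hτ : ∀ β, τ = some β → 1 ≤ d β) (hp : p.2 ∈ tuples F (lowerDeg d τ)) (e : OnePoint F → ℕ) :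
    (∀ x, charSum χ p x = (e x : ℂ)) ↔ Matches e τ p.1 fun α => herm F (p.2 α) := by
  have h1 : charSum χ p OnePoint.infty = inftySum r p.1 (typeVec τ) := by
    rw [charSum_none hr_pos hr_dvd hχ]
    refine inftySum_congr _ fun j => ?_
    rw [degF_add_typeVec hτ hp j]
    exact hd j
  rw [Matches, ← h1]
  constructor
  · intro h
    refine ⟨h OnePoint.infty, fun x => ?_⟩
    rw [← h (OnePoint.some x), charSum_some hr_pos hr_dvd hχ]
    rfl
  · rintro ⟨h2, h3⟩ x
    cases x with
    | infty => exact h2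
    | coe x =>
      refine Eq.trans ?_ (h3 x)
      exact charSum_some hr_pos hr_dvd hχ p x

theorem lowerDeg_injective {ι : Type*} [Fintype ι] [DecidableEq ι] {d : ι → ℕ}
    (hd : ∀ α, 1 ≤ d α) : Function.Injective (lowerDeg d) := by
  intro τ τ' h
  have h1 (β : ι) : lowerDeg d none ≠ lowerDeg d (some β) := by
    intro h
    have := congrFun h β
    have := hd β
    simp only [lowerDeg, Function.update_self] at *
    omega
  cases τ with
  | none =>
    cases τ' with
    | none => rfl
    | some β => exact absurd h (h1 β)
  | some β =>
    cases τ' with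
    | none => exact absurd h.symm (h1 β)
    | some γ =>
      by_contra hne
      have hβγ : β ≠ γ := fun h => hne (congrArg some h)
      have h2 := congrFun h β
      have := hd β
      simp only [lowerDeg, Function.update_self, Function.update_of_ne hβγ] at h2
      omega

open scoped Classical in
-- The set is partitioned by the type at infinity, the constants and the data. The parts are
-- disjoint because for `d ≥ 1` the degrees determine the type.
theorem ncard_eq_sum_tupleCount {d : Idx r → ℕ} (hd : ∀ α, 1 ≤ d α)
    (W : Option (Idx r) → (Fin (n + 1) → Fˣ) × (Idx r → F → F × F) → Prop)
    [∀ τ, DecidablePred (W τ)] (S : Set (Datum F r))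
    (hS : ∀ p : Datum F r, p ∈ S ↔ ∃ τ, p.2 ∈ tuples F (lowerDeg d τ) ∧ GoodTuple p.2 ∧
      W τ (p.1, fun α => herm F (p.2 α))) :
    S.ncard = ∑ τ, ∑ ca ∈ Finset.univ.filter (W τ), tupleCount (lowerDeg d τ) ca.2 := by
  let A : Finset (Σ _ : Option (Idx r), Σ _ : (Fin (n + 1) → Fˣ) × (Idx r → F → F × F),
      Idx r → F[X]) :=
    Finset.univ.sigma fun τ => (Finset.univ.filter (W τ)).sigma fun ca =>
      (tuples F (lowerDeg d τ)).filter fun f => GoodTuple f ∧ ∀ α, herm F (f α) = ca.2 α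
  have hA : A.card = ∑ τ, ∑ ca ∈ Finset.univ.filter (W τ), tupleCount (lowerDeg d τ) ca.2 := by
    rw [Finset.card_sigma]
    refine Finset.sum_congr rfl fun τ _ => ?_
    rw [Finset.card_sigma]
    rfl
  have hmem (x) : x ∈ A ↔ W x.1 x.2.1 ∧ x.2.2 ∈ tuples F (lowerDeg d x.1) ∧ GoodTuple x.2.2 ∧
      ∀ α, herm F (x.2.2 α) = x.2.1.2 α := by
    simp [A, Finset.mem_sigma]
  have hinj : Set.InjOn (fun x : Σ _ : Option (Idx r),
      Σ _ : (Fin (n + 1) → Fˣ) × (Idx r → F → F × F), Idx r → F[X] =>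
        ((x.2.1.1, x.2.2) : Datum F r)) A := by
    rintro ⟨τ, ⟨c, a⟩, f⟩ h ⟨τ', ⟨c', a'⟩, f'⟩ h' heq
    rw [Finset.mem_coe, hmem] at h h'
    simp only [Prod.mk.injEq] at heq h h'
    obtain ⟨rfl, rfl⟩ := heq
    have h1 : τ = τ' := by
      refine lowerDeg_injective hd (funext fun α => ?_)
      rw [← (mem_tuples.1 h.2.1 α).2, (mem_tuples.1 h'.2.1 α).2]
    have h2 : a = a' := funext fun α => by rw [← h.2.2.2 α, h'.2.2.2 α]
    subst h1 h2
    rfl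
  have hSA : S = ↑(A.image fun x => ((x.2.1.1, x.2.2) : Datum F r)) := by
    ext p
    rw [hS, Finset.mem_coe, Finset.mem_image]
    constructor
    · rintro ⟨τ, h1, h2, h3⟩
      exact ⟨⟨τ, (p.1, fun α => herm F (p.2 α)), p.2⟩, (hmem _).2 ⟨h3, h1, h2, fun _ => rfl⟩, rfl⟩
    · rintro ⟨⟨τ, ⟨c, a⟩, f⟩, h, rfl⟩
      rw [hmem] at h
      simp only at h
      refine ⟨τ, h.2.1, h.2.2.1, ?_⟩
      have : (fun α => herm F (f α)) = a := funext h.2.2.2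
      simp only [this]
      exact h.1
  rw [hSA, Set.ncard_coe_finset, Finset.card_image_of_injOn hinj, hA]

end AbelianCovers
end
-- Counting local data and comparing with the true counts
open Polynomial
noncomputable section
namespace AbelianCovers

variable {F : Type*} [Field F] [Fintype F]

/-- The number of possible data at an unramified point. -/
def unramifiedCount (F ι : Type*) [Fintype F] [Fintype ι] : ℝ :=
  (((Fintype.card F : ℝ) - 1) * Fintype.card F) ^ Fintype.card ι

theorem unramifiedCount_pos (ι : Type*) [Fintype ι] : 0 < unramifiedCount F ι := by
  have hq := two_le_card (F := F)
  have : (0 : ℝ) < (Fintype.card F : ℝ) - 1 := by linarith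
  unfold unramifiedCount
  positivity

/-- A simple zero leaves `q - 1` choices for the pair of value and derivative, instead of `(q - 1)
q`. The ratio `1/q` is the weight of a lowered degree at infinity. -/
theorem card_typeData {ι : Type*} [Fintype ι] [DecidableEq ι] (τ : Option ι) :
    ((typeData F τ).card : ℝ) = unramifiedCount F ι * weight F τ := by
  classical
  have hq := two_le_card (F := F)
  have h0 : (((Finset.univ : Finset F).filter (· ≠ 0)).card : ℝ) = (Fintype.card F : ℝ) - 1 := by
    rw [Finset.filter_ne', Finset.card_erase_of_mem (Finset.mem_univ _), Finset.card_univ,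
      Nat.cast_sub Fintype.card_pos, Nat.cast_one]
  have h1 (α : ι) : ((typeSet F τ α).card : ℝ) = ((Fintype.card F : ℝ) - 1) * Fintype.card F *
      (if τ = some α then (Fintype.card F : ℝ)⁻¹ else 1) := by
    rw [typeSet]
    split_ifs
    · rw [Finset.card_product, Finset.card_singleton, one_mul, h0]
      field_simp
    · rw [Finset.card_product, Nat.cast_mul, h0, Finset.card_univ, mul_one]
  rw [typeData, Fintype.card_piFinset]
  push_cast
  rw [Finset.prod_congr rfl fun α _ => h1 α, Finset.prod_mul_distrib, Finset.prod_const,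
    Finset.card_univ, unramifiedCount]
  congr 1
  cases τ with
  | none => simp [weight]
  | some β => simp [weight]

theorem typeData_disjoint {ι : Type*} [Fintype ι] [DecidableEq ι] {τ τ' : Option ι} (h : τ ≠ τ') :
    Disjoint (typeData F τ) (typeData F τ') := by
  rw [Finset.disjoint_left]
  intro b hb hb'
  rw [mem_typeData] at hb hb'
  have key (τ τ' : Option ι) (h : τ ≠ τ')
      (hb : ∀ α, (τ = some α → (b α).1 = 0 ∧ (b α).2 ≠ 0) ∧ (τ ≠ some α → (b α).1 ≠ 0))
      (hb' : ∀ α, (τ' = some α → (b α).1 = 0 ∧ (b α).2 ≠ 0) ∧ (τ' ≠ some α → (b α).1 ≠ 0))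
      (β : ι) (hβ : τ = some β) : False :=
    (hb' β).2 (fun h' => h (hβ.trans h'.symm)) ((hb β).1 hβ).1
  cases τ with
  | some β => exact key _ _ h hb hb' β rfl
  | none =>
    cases τ' with
    | none => exact h rfl
    | some β => exact key _ _ h.symm hb' hb β rfl

variable {n : ℕ} {r : Fin (n + 1) → ℕ}

theorem card_annih_pos (t : Fin (n + 1) → ℕ) : 0 < Nat.card (annih F r t) := Nat.card_pos

open scoped Classical in
theorem card_local (hr_pos : ∀ j, 0 < r j) (c : Fin (n + 1) → Fˣ) (e : ℕ) :
    ((Finset.univ.filter fun b : Idx r → F × F => (∃ σ, b ∈ typeData F σ) ∧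
      localSum c (fun α => (b α).1) = e).card : ℝ) =
      unramifiedCount F (Idx r) * valueWeight F r e := by
  have h1 : (Finset.univ.filter fun b : Idx r → F × F => (∃ σ, b ∈ typeData F σ) ∧
      localSum c (fun α => (b α).1) = e) = Finset.univ.biUnion fun σ =>
        (typeData F σ).filter fun b => localSum c (fun α => (b α).1) = e := by
    ext b
    simp
  rw [h1, Finset.card_biUnion]
  · push_cast
    rw [valueWeight, Finset.mul_sum]
    refine Finset.sum_congr rfl fun σ _ => ?_
    rw [card_filter_eq_frac _ _ (card_annih_pos (typeVec σ))
      (fun b hb => localSum_eq_zero_or c hb) (sum_localSum hr_pos c σ), card_typeData, mul_assoc]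
  · intro σ _ σ' _ h
    exact Finset.disjoint_filter_filter (typeData_disjoint h)

open scoped Classical in
theorem card_local_all :
    ((Finset.univ.filter fun b : Idx r → F × F => ∃ σ, b ∈ typeData F σ).card : ℝ) =
      unramifiedCount F (Idx r) * totalWeight F r := by
  have h1 : (Finset.univ.filter fun b : Idx r → F × F => ∃ σ, b ∈ typeData F σ) =
      Finset.univ.biUnion fun σ => typeData F σ := by
    ext b
    simp
  rw [h1, Finset.card_biUnion fun σ _ σ' _ h => typeData_disjoint h]
  push_cast
  rw [totalWeight, Finset.mul_sum]
  exact Finset.sum_congr rfl fun σ _ => card_typeData σ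

open scoped Classical in
theorem card_infty (e : ℕ) (t : Fin (n + 1) → ℕ) :
    ((Finset.univ.filter fun c : Fin (n + 1) → Fˣ => inftySum r c t = e).card : ℝ) =
      Fintype.card (Fin (n + 1) → Fˣ) * frac (Nat.card (annih F r t)) e := by
  rw [card_filter_eq_frac _ _ (card_annih_pos t) (fun c _ => inftySum_eq_zero_or c t)
    (by rw [sum_inftySum, Finset.card_univ]), Finset.card_univ]

theorem card_filter_forall {ι κ β : Type*} [Fintype κ] [Fintype (ι → β)] [Fintype (ι → κ → β)]
    (P : (ι → κ → β) → Prop) (p : κ → (ι → β) → Prop) [DecidablePred P]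
    [∀ x, DecidablePred (p x)] (h : ∀ a, P a ↔ ∀ x, p x fun α => a α x) :
    (Finset.univ.filter P).card = ∏ x, (Finset.univ.filter (p x)).card := by
  classical
  rw [← Fintype.card_piFinset]
  refine Finset.card_bij (fun a _ x α => a α x) ?_ ?_ ?_
  · intro a ha
    simpa [h] using ha
  · intro a _ a' _ h
    funext α x
    exact congrFun (congrFun h x) α
  · intro b hb
    refine ⟨fun α x => b x α, ?_, rfl⟩
    simpa [h] using hb

theorem card_filter_prod {β γ : Type*} [Fintype β] [Fintype γ] [Fintype (β × γ)] (p : β × γ → Prop)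
    [DecidablePred p] [∀ c, DecidablePred fun a => p (c, a)] :
    (Finset.univ.filter p).card = ∑ c, (Finset.univ.filter fun a => p (c, a)).card := by
  rw [← Finset.card_sigma]
  refine Finset.card_bij (fun z _ => ⟨z.1, z.2⟩) ?_ ?_ ?_
  · intro z hz
    simpa using hz
  · rintro ⟨z, z'⟩ _ ⟨w, w'⟩ _ h
    simpa using h
  · rintro ⟨z, z'⟩ hz
    exact ⟨(z, z'), by simpa using hz, rfl⟩

open scoped Classical in
-- For fixed constants the finite points are independent, with counts not depending on the
-- constants; the condition at infinity involves only the constants and so splits off.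
theorem card_admissible_matches (hr_pos : ∀ j, 0 < r j) (e : OnePoint F → ℕ)
    (τ : Option (Idx r)) :
    ((Finset.univ.filter fun ca : (Fin (n + 1) → Fˣ) × (Idx r → F → F × F) =>
      Admissible ca.2 ∧ Matches e τ ca.1 ca.2).card : ℝ) =
      Fintype.card (Fin (n + 1) → Fˣ) * frac (Nat.card (annih F r (typeVec τ))) (e OnePoint.infty) *
        ∏ x : F, (unramifiedCount F (Idx r) * valueWeight F r (e (OnePoint.some x))) := by
  have h1 (c : Fin (n + 1) → Fˣ) : ((Finset.univ.filter fun a : Idx r → F → F × F =>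
      Admissible a ∧ Matches e τ c a).card : ℝ) =
      (if inftySum r c (typeVec τ) = (e OnePoint.infty : ℂ) then 1 else 0) *
        ∏ x : F, (unramifiedCount F (Idx r) * valueWeight F r (e (OnePoint.some x))) := by
    split_ifs with h
    · rw [one_mul]
      rw [card_filter_forall _ (fun (x : F) (b : Idx r → F × F) => (∃ σ, b ∈ typeData F σ) ∧
        localSum c (fun α => (b α).1) = (e (OnePoint.some x) : ℂ)) fun a => by
          simp only [Admissible, Matches, h, true_and]
          exact forall_and.symm]
      push_cast
      exact Finset.prod_congr rfl fun x _ => card_local hr_pos c (e (OnePoint.some x))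
    · rw [zero_mul, Nat.cast_eq_zero, Finset.card_eq_zero, Finset.filter_eq_empty_iff]
      exact fun a _ h' => h h'.2.1
  rw [card_filter_prod fun ca : (Fin (n + 1) → Fˣ) × (Idx r → F → F × F) =>
    Admissible ca.2 ∧ Matches e τ ca.1 ca.2]
  push_cast
  rw [Finset.sum_congr rfl fun c _ => h1 c, ← Finset.sum_mul, ← card_infty, Finset.sum_boole]

open scoped Classical in
theorem card_admissible :
    ((Finset.univ.filter fun ca : (Fin (n + 1) → Fˣ) × (Idx r → F → F × F) =>
      Admissible ca.2).card : ℝ) = Fintype.card (Fin (n + 1) → Fˣ) *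
        ∏ _x : F, (unramifiedCount F (Idx r) * totalWeight F r) := by
  rw [card_filter_prod fun ca : (Fin (n + 1) → Fˣ) × (Idx r → F → F × F) => Admissible ca.2]
  push_cast
  rw [Finset.sum_const, nsmul_eq_mul, Finset.card_univ]
  congr 1
  rw [card_filter_forall Admissible (fun (_ : F) (b : Idx r → F × F) => ∃ σ, b ∈ typeData F σ)
    fun a => Iff.rfl]
  push_cast
  exact Finset.prod_congr rfl fun x _ => card_local_all

/-- The normalizing constant in the weighted counts. -/
def normConst (F : Type*) [Field F] [Fintype F] (r : Fin (n + 1) → ℕ) : ℝ :=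
  Nat.card (Fin (n + 1) → Fˣ) * unramifiedCount F (Idx r) ^ Fintype.card F *
    totalWeight F r ^ (Fintype.card F + 1)

theorem normConst_pos : 0 < normConst F r := by
  have h1 := unramifiedCount_pos (F := F) (Idx r)
  have h2 := totalWeight_pos (F := F) (r := r)
  have h3 : 0 < Nat.card (Fin (n + 1) → Fˣ) := Nat.card_pos
  unfold normConst
  positivity

open scoped Classical in
theorem sum_weight_card_admissible :
    ∑ τ : Option (Idx r), weight F τ *
      ((Finset.univ.filter fun ca : (Fin (n + 1) → Fˣ) × (Idx r → F → F × F) =>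
        Admissible ca.2).card : ℝ) = normConst F r := by
  rw [card_admissible, ← Finset.sum_mul, ← totalWeight, normConst, Finset.prod_const,
    Finset.card_univ, Nat.card_eq_fintype_card]
  ring

open scoped Classical in
-- Summing over the type at infinity supplies the missing factor for that point, and the product
-- extends over all `q + 1` points.
theorem sum_weight_card_matches (hr_pos : ∀ j, 0 < r j) (e : OnePoint F → ℕ) :
    ∑ τ : Option (Idx r), weight F τ *
      ((Finset.univ.filter fun ca : (Fin (n + 1) → Fˣ) × (Idx r → F → F × F) =>
        Admissible ca.2 ∧ Matches e τ ca.1 ca.2).card : ℝ) =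
      normConst F r * ∏ x, valueWeight F r (e x) / totalWeight F r := by
  have h2 := totalWeight_pos (F := F) (r := r)
  rw [Finset.sum_congr rfl fun τ _ => by rw [card_admissible_matches hr_pos], prod_onePoint,
    Finset.prod_div_distrib, Finset.prod_const, Finset.card_univ]
  have h3 : ∑ τ : Option (Idx r), weight F τ * (Fintype.card (Fin (n + 1) → Fˣ) *
      frac (Nat.card (annih F r (typeVec τ))) (e OnePoint.infty) *
        ∏ x : F, (unramifiedCount F (Idx r) * valueWeight F r (e (OnePoint.some x)))) =
      valueWeight F r (e OnePoint.infty) * (Fintype.card (Fin (n + 1) → Fˣ) *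
        ∏ x : F, (unramifiedCount F (Idx r) * valueWeight F r (e (OnePoint.some x)))) := by
    rw [valueWeight, Finset.sum_mul]
    exact Finset.sum_congr rfl fun τ _ => by ring
  rw [h3, Finset.prod_mul_distrib, Finset.prod_const, Finset.card_univ, normConst,
    Nat.card_eq_fintype_card, pow_succ]
  field_simp

/-- The constant in the estimate of the counts by weighted counts. -/
def errConst (F : Type*) [Field F] [Fintype F] (r : Fin (n + 1) → ℕ) : ℝ :=
  Nat.card (Option (Idx r)) * Nat.card ((Fin (n + 1) → Fˣ) × (Idx r → F → F × F)) *
    cmpConst F (Idx r)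

open scoped Classical in
-- Each `tupleCount` in the partition is replaced by its weight times the count for the data `0`.
-- These data serve only as a common reference and cancel in the quotient.
theorem abs_ncard_sub_le {d : Idx r → ℕ} {m : ℕ} (hm : ∀ α, m ≤ d α) (hm1 : 1 ≤ m)
    (W : Option (Idx r) → (Fin (n + 1) → Fˣ) × (Idx r → F → F × F) → Prop)
    [∀ τ, DecidablePred (W τ)] (S : Set (Datum F r))
    (hS : ∀ p : Datum F r, p ∈ S ↔ ∃ τ, p.2 ∈ tuples F (lowerDeg d τ) ∧ GoodTuple p.2 ∧
      W τ (p.1, fun α => herm F (p.2 α))) :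
    |(S.ncard : ℝ) - tupleCount d (0 : Idx r → F → F × F) *
      ∑ τ, weight F τ * ((Finset.univ.filter (W τ)).card : ℝ)| ≤
      errConst F r * ((Fintype.card F : ℝ) ^ (∑ β, d β) * (sqrtq F)⁻¹ ^ m) := by
  have hs := sqrtq_pos (F := F)
  rw [ncard_eq_sum_tupleCount (fun α => hm1.trans (hm α)) W S hS]
  push_cast
  have h1 : (tupleCount d (0 : Idx r → F → F × F) : ℝ) *
      ∑ τ, weight F τ * ((Finset.univ.filter (W τ)).card : ℝ) =
      ∑ τ, ∑ _ca ∈ Finset.univ.filter (W τ), weight F τ *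
        tupleCount d (0 : Idx r → F → F × F) := by
    rw [Finset.mul_sum]
    refine Finset.sum_congr rfl fun τ _ => ?_
    rw [Finset.sum_const, nsmul_eq_mul]
    ring
  rw [h1, ← Finset.sum_sub_distrib]
  simp only [← Finset.sum_sub_distrib]
  have hC : 0 ≤ cmpConst F (Idx r) := by
    unfold cmpConst
    positivity
  set E := cmpConst F (Idx r) * ((Fintype.card F : ℝ) ^ (∑ β, d β) * (sqrtq F)⁻¹ ^ m) with hE
  have hE0 : 0 ≤ E := by positivity
  refine (Finset.abs_sum_le_sum_abs _ _).trans ?_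
  have h2 (τ : Option (Idx r)) : |∑ ca ∈ Finset.univ.filter (W τ),
      ((tupleCount (lowerDeg d τ) ca.2 : ℝ) - weight F τ *
        tupleCount d (0 : Idx r → F → F × F))| ≤
      Nat.card ((Fin (n + 1) → Fˣ) × (Idx r → F → F × F)) * E := by
    refine (Finset.abs_sum_le_sum_abs _ _).trans ?_
    refine (Finset.sum_le_sum fun ca _ => abs_tupleCount_lowerDeg_sub_le hm hm1 τ ca.2 0).trans ?_
    rw [Finset.sum_const, nsmul_eq_mul]
    refine mul_le_mul_of_nonneg_right ?_ hE0
    rw [Nat.card_eq_fintype_card]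
    exact_mod_cast Finset.card_le_univ _
  refine (Finset.sum_le_sum fun τ _ => h2 τ).trans (le_of_eq ?_)
  rw [Finset.sum_const, nsmul_eq_mul, Finset.card_univ, errConst, hE, Nat.card_eq_fintype_card,
    Nat.card_eq_fintype_card]
  ring

end AbelianCovers
end
-- Relative error and conclusion
open Polynomial
noncomputable section
namespace AbelianCovers

variable {F : Type*} [Field F] [Fintype F]

theorem exists_mul_sqrtq_inv_pow_le (F : Type*) [Field F] [Fintype F] (J : ℝ) {ε : ℝ}
    (hε : 0 < ε) : ∃ B : ℕ, ∀ m, B ≤ m → J * (sqrtq F)⁻¹ ^ m ≤ ε := by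
  have h1 : Filter.Tendsto (fun m : ℕ => J * (sqrtq F)⁻¹ ^ m) Filter.atTop (nhds (J * 0)) :=
    (tendsto_pow_atTop_nhds_zero_of_lt_one (inv_nonneg.2 sqrtq_pos.le)
      (inv_lt_one_of_one_lt₀ one_lt_sqrtq)).const_mul J
  rw [mul_zero] at h1
  exact Filter.eventually_atTop.1 ((h1.eventually_lt_const hε).mono fun _ h => h.le)

/-- The good tuples are distributed over finitely many data with nearly equal counts, so each count,
in particular that for `0`, inherits a positive share of their density. -/
theorem exists_tupleCount_ge (F : Type*) [Field F] [Fintype F] (ι : Type*) [Fintype ι]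
    [DecidableEq ι] :
    ∃ c : ℝ, 0 < c ∧ ∃ B : ℕ, ∀ (d : ι → ℕ) (m : ℕ), (∀ α, m ≤ d α) → B ≤ m →
      c * (Fintype.card F : ℝ) ^ (∑ α, d α) ≤ tupleCount d (0 : ι → F → F × F) := by
  classical
  obtain ⟨c, hc, B, hB⟩ := exists_card_goodTuple_ge F ι
  have hN : (0 : ℝ) < Fintype.card (ι → F → F × F) := by exact_mod_cast Fintype.card_pos
  obtain ⟨B', hB'⟩ := exists_mul_sqrtq_inv_pow_le F
    (Fintype.card (ι → F → F × F) * cmpConst F ι) (half_pos hc)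
  refine ⟨c / 2 / Fintype.card (ι → F → F × F), by positivity, B + B' + 1, fun d m hm hBm => ?_⟩
  have h1 := hB d fun α => by have := hm α; omega
  have h2 := hB' m (by omega)
  have h3 : (((tuples F d).filter GoodTuple).card : ℝ) =
      ∑ a : ι → F → F × F, (tupleCount d a : ℝ) := by
    rw [Finset.card_eq_sum_card_fiberwise (f := fun (f : ι → F[X]) α => herm F (f α))
      (t := Finset.univ) fun _ _ => Finset.mem_coe.2 (Finset.mem_univ _)]
    push_cast
    refine Finset.sum_congr rfl fun a _ => ?_
    rw [tupleCount, Finset.filter_filter]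
    simp only [funext_iff]
  have h4 (a : ι → F → F × F) : (tupleCount d a : ℝ) ≤ tupleCount d (0 : ι → F → F × F) +
      cmpConst F ι * ((Fintype.card F : ℝ) ^ (∑ β, d β) * (sqrtq F)⁻¹ ^ m) := by
    have h5 := abs_tupleCount_lowerDeg_sub_le hm (by omega) none a 0
    rw [lowerDeg, weight, one_mul] at h5
    linarith [(abs_le.1 h5).2]
  have h5 := Finset.sum_le_sum fun a (_ : a ∈ Finset.univ) => h4 a
  rw [Finset.sum_const, nsmul_eq_mul, Finset.card_univ, ← h3] at h5
  have h6 := mul_le_mul_of_nonneg_right h2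
    (by positivity : (0 : ℝ) ≤ (Fintype.card F : ℝ) ^ (∑ β, d β))
  rw [div_mul_eq_mul_div, div_le_iff₀ hN]
  nlinarith

theorem abs_div_sub_le {A D X N M Q T E K c : ℝ} (hQ : 0 < Q) (hT : 0 ≤ T) (hE : 0 ≤ E)
    (hc : 0 < c) (hM : |M| ≤ K) (hA : |A - X * (N * M)| ≤ E * (Q * T))
    (hD : |D - X * N| ≤ E * (Q * T)) (hcD : c * Q ≤ D) :
    |A / D - M| ≤ E * (1 + K) / c * T := by
  have hD0 : 0 < D := (mul_pos hc hQ).trans_le hcD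
  have h1 : |A - M * D| ≤ E * (Q * T) * (1 + K) := by
    have h2 : A - M * D = (A - X * (N * M)) - M * (D - X * N) := by ring
    rw [h2]
    refine (abs_sub _ _).trans ?_
    rw [abs_mul]
    have h3 := mul_le_mul hM hD (abs_nonneg _) ((abs_nonneg _).trans hM)
    linarith
  have hK : 0 ≤ K := (abs_nonneg _).trans hM
  rw [show A / D - M = (A - M * D) / D by field_simp, abs_div, abs_of_pos hD0, div_le_iff₀ hD0]
  refine h1.trans ?_
  calc E * (Q * T) * (1 + K) = E * (1 + K) / c * T * (c * Q) := by field_simp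
    _ ≤ E * (1 + K) / c * T * D := mul_le_mul_of_nonneg_left hcD (by positivity)

variable {n : ℕ} {r : Fin (n + 1) → ℕ}

theorem frac_nonneg {N : ℕ} (hN : 0 < N) (e : ℕ) : 0 ≤ frac N e := by
  have h1 : (N : ℝ)⁻¹ ≤ 1 := inv_le_one_of_one_le₀ (by exact_mod_cast hN)
  unfold frac
  split_ifs
  · positivity
  · linarith
  · exact le_rfl

/-- A multiplicative error allows no deviation from a zero main term. If the term vanishes, one
factor does; being proportional to a count, or at infinity a sum of non-negative frequencies, it
leaves no data at that point with the required value. -/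
theorem not_forall_charSum_of_mainTerm_eq_zero {χ : ℕ → MulChar F ℂ} (hr_pos : ∀ j, 0 < r j)
    (hr_dvd : ∀ j : Fin n, r j.castSucc ∣ r j.succ)
    (hχ : ∀ m, m ∣ r (Fin.last n) → orderOf (χ m) = m) {d : Idx r → ℕ}
    (hd : ∀ j, ∑ α : Idx r, (α.1 j : ℕ) * d α ≡ 0 [MOD r j]) {e : OnePoint F → ℕ}
    (he : ∀ x, e x = 0 ∨ ∃ s, s ∣ r (Fin.last n) ∧ e x = groupOrder r / s)
    (h0 : mainTerm r e = 0) {p : Datum F r} (hp : p ∈ Fhat F r d) :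
    ¬∀ x, charSum χ p x = (e x : ℂ) := by
  classical
  intro hpe
  rw [mainTerm_eq hr_pos hr_dvd hχ e he, Finset.prod_eq_zero_iff] at h0
  obtain ⟨x, -, hx⟩ := h0
  rw [div_eq_zero_iff, or_iff_left totalWeight_pos.ne'] at hx
  obtain ⟨τ, hτ, hp1, -, hp2⟩ := mem_Fhat_iff.1 hp
  rw [forall_charSum_iff hr_pos hr_dvd hχ hd hτ hp1] at hpe
  cases x using OnePoint.rec with
  | infty =>
    have h1 : weight F τ * frac (Nat.card (annih F r (typeVec τ))) (e OnePoint.infty) = 0 :=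
      (Finset.sum_eq_zero_iff_of_nonneg fun σ _ => mul_nonneg (weight_pos σ).le
        (frac_nonneg (card_annih_pos _) _)).1 hx τ (Finset.mem_univ _)
    have h2 := card_infty (F := F) (r := r) (e OnePoint.infty) (typeVec τ)
    rw [(mul_eq_zero.1 h1).resolve_left (weight_pos τ).ne', mul_zero, Nat.cast_eq_zero,
      Finset.card_eq_zero, Finset.filter_eq_empty_iff] at h2
    exact h2 (Finset.mem_univ p.1) hpe.1
  | coe y =>
    have h2 := card_local hr_pos p.1 (e (OnePoint.some y))
    rw [show valueWeight F r (e (OnePoint.some y)) = 0 from hx, mul_zero, Nat.cast_eq_zero,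
      Finset.card_eq_zero, Finset.filter_eq_empty_iff] at h2
    exact h2 (Finset.mem_univ fun α => herm F (p.2 α) y) ⟨hp2 y, hpe.2 y⟩

/-- Finiteness yields bounds for the main term and for its inverse that are uniform in `e`. -/
theorem finite_allowed_values (F : Type*) [Fintype F] (r : Fin (n + 1) → ℕ) :
    {e : OnePoint F → ℕ |
      ∀ x, e x = 0 ∨ ∃ s, s ∣ r (Fin.last n) ∧ e x = groupOrder r / s}.Finite := by
  have : Finite (OnePoint F) := inferInstanceAs (Finite (Option F))
  refine (Set.Finite.pi' fun _ : OnePoint F => Set.finite_Iic (groupOrder r)).subset ?_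
  intro e he x
  rcases he x with h | ⟨s, -, h⟩
  · rw [h]
    exact Nat.zero_le _
  · rw [h]
    exact Nat.div_le_self _ _

theorem rpow_neg_div_two (F : Type*) [Field F] [Fintype F] (m : ℕ) :
    (Fintype.card F : ℝ) ^ (-(m : ℝ) / 2) = (sqrtq F)⁻¹ ^ m := by
  have h : (0 : ℝ) ≤ Fintype.card F := by positivity
  rw [sqrtq, Real.sqrt_eq_rpow, ← Real.rpow_neg h, ← Real.rpow_natCast, ← Real.rpow_mul h]
  congr 1
  ring

theorem exists_abs_ratio_sub_mainTerm_le (F : Type*) [Field F] [Fintype F] (r : Fin (n + 1) → ℕ)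
    (hr_pos : ∀ j, 0 < r j) (hr_dvd : ∀ j : Fin n, r j.castSucc ∣ r j.succ) :
    ∃ C : ℝ, ∃ B : ℕ, ∀ χ : ℕ → MulChar F ℂ,
      (∀ m, m ∣ r (Fin.last n) → orderOf (χ m) = m) → ∀ d : Idx r → ℕ,
      (∀ j, ∑ α : Idx r, (α.1 j : ℕ) * d α ≡ 0 [MOD r j]) → ∀ e : OnePoint F → ℕ,
      (∀ x, e x = 0 ∨ ∃ s, s ∣ r (Fin.last n) ∧ e x = groupOrder r / s) →
      ∀ m : ℕ, (∀ α, m ≤ d α) → B ≤ m →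
      |({p ∈ Fhat F r d | ∀ x : OnePoint F, charSum χ p x = (e x : ℂ)}.ncard : ℝ) /
        ((Fhat F r d).ncard : ℝ) - mainTerm r e| ≤ C * (sqrtq F)⁻¹ ^ m := by
  classical
  obtain ⟨c, hc, B₁, hB₁⟩ := exists_tupleCount_ge F (Idx r)
  have hN := normConst_pos (F := F) (r := r)
  have hs := sqrtq_pos (F := F)
  have hq := two_le_card (F := F)
  obtain ⟨B₂, hB₂⟩ := exists_mul_sqrtq_inv_pow_le F (errConst F r)
    (half_pos (mul_pos hc hN))
  obtain ⟨K, hK⟩ := ((finite_allowed_values F r).image fun e => |mainTerm r e|).bddAbove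
  refine ⟨errConst F r * (1 + K) / (c * normConst F r / 2), B₁ + B₂ + 1,
    fun χ hχ d hd e he m hm hBm => ?_⟩
  have hd1 (α : Idx r) : 1 ≤ d α := by have := hm α; omega
  have hD := abs_ncard_sub_le hm (by omega) (fun _ ca => Admissible ca.2) (Fhat F r d)
    fun p => by
      rw [mem_Fhat_iff]
      exact exists_congr fun τ => and_iff_right fun β _ => hd1 β
  have hA := abs_ncard_sub_le hm (by omega) (fun τ ca => Admissible ca.2 ∧ Matches e τ ca.1 ca.2)
    {p ∈ Fhat F r d | ∀ x : OnePoint F, charSum χ p x = (e x : ℂ)} fun p => by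
      rw [Set.mem_ofPred_eq, mem_Fhat_iff, ← exists_and_right]
      refine exists_congr fun τ => ?_
      constructor
      · rintro ⟨⟨h1, h2, h3, h4⟩, h5⟩
        exact ⟨h2, h3, h4, (forall_charSum_iff hr_pos hr_dvd hχ hd h1 h2 e).1 h5⟩
      · rintro ⟨h2, h3, h4, h5⟩
        have h1 : ∀ β, τ = some β → 1 ≤ d β := fun β _ => hd1 β
        exact ⟨⟨h1, h2, h3, h4⟩, (forall_charSum_iff hr_pos hr_dvd hχ hd h1 h2 e).2 h5⟩
  rw [sum_weight_card_admissible] at hD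
  rw [sum_weight_card_matches hr_pos, ← mainTerm_eq hr_pos hr_dvd hχ e he] at hA
  have hQ : (0 : ℝ) < (Fintype.card F : ℝ) ^ (∑ β, d β) := by positivity
  have hE : 0 ≤ errConst F r := by
    unfold errConst cmpConst
    positivity
  refine abs_div_sub_le hQ (by positivity) hE (by positivity)
    (hK (Set.mem_image_of_mem _ he)) hA hD ?_
  -- The denominator is at least `c * normConst * Q` minus its error, and `B₂` was chosen so that
  -- the error is at most half of this.
  have h1 := mul_le_mul_of_nonneg_right (hB₁ d m hm (by omega)) hN.le
  have h2 := mul_le_mul_of_nonneg_right (hB₂ m (by omega)) hQ.le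
  have h3 := (abs_le.1 hD).1
  nlinarith

end AbelianCovers
end


theorem mainTheorem2 {F : Type*} [Field F] [Fintype F] (n : ℕ) (r : Fin (n + 1) → ℕ)
    (hr_pos : ∀ j, 0 < r j)
    (hr_dvd : ∀ j : Fin n, r j.castSucc ∣ r j.succ)
    (hq : Fintype.card F ≡ 1 [MOD r (Fin.last n)]) :
    ∃ K : ℝ, ∀ χ : ℕ → MulChar F ℂ, (∀ m, m ∣ r (Fin.last n) → orderOf (χ m) = m) →
      ∀ d : Idx r → ℕ, (∀ j, ∑ α : Idx r, (α.1 j : ℕ) * d α ≡ 0 [MOD r j]) →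
      ∀ e : OnePoint F → ℕ,
        (∀ x, e x = 0 ∨ ∃ s, s ∣ r (Fin.last n) ∧ e x = groupOrder r / s) →
        ∃ δ : ℝ,
          |δ| ≤ K * (Fintype.card F : ℝ) ^ (-((⨅ α, d α : ℕ) : ℝ) / 2) ∧
          ({p ∈ Fhat F r d | ∀ x : OnePoint F, charSum χ p x = (e x : ℂ)}.ncard : ℝ) /
              ((Fhat F r d).ncard : ℝ) =
            mainTerm r e * (1 + δ) := by
  obtain ⟨C, B, hCB⟩ := exists_abs_ratio_sub_mainTerm_le F r hr_pos hr_dvd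
  obtain ⟨K, hK⟩ := ((finite_allowed_values F r).image fun e => |mainTerm r e|⁻¹).bddAbove
  have hs := sqrtq_pos (F := F)
  -- The first summand serves large `m`. The second serves `m < B + 1`, where the ratio is at most
  -- `1` and `δ` at most `|K| + 1` in absolute value.
  refine ⟨|C| * |K| + (|K| + 1) * sqrtq F ^ (B + 1), fun χ hχ d hd e he => ?_⟩
  set R : ℝ := ({p ∈ Fhat F r d | ∀ x : OnePoint F, charSum χ p x = (e x : ℂ)}.ncard : ℝ) /
    ((Fhat F r d).ncard : ℝ) with hR
  set m := ⨅ α, d α with hm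
  rw [rpow_neg_div_two, add_mul]
  have hT : 0 < (sqrtq F)⁻¹ ^ m := by positivity
  have hb₁ : 0 ≤ |C| * |K| * (sqrtq F)⁻¹ ^ m := by positivity
  have hb₂ : 0 ≤ (|K| + 1) * sqrtq F ^ (B + 1) * (sqrtq F)⁻¹ ^ m := by positivity
  by_cases h0 : mainTerm r e = 0
  · refine ⟨0, by rw [abs_zero]; positivity, ?_⟩
    have h1 : {p ∈ Fhat F r d | ∀ x : OnePoint F, charSum χ p x = (e x : ℂ)} = ∅ :=
      Set.eq_empty_of_forall_notMem fun p hp =>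
        not_forall_charSum_of_mainTerm_eq_zero hr_pos hr_dvd hχ hd he h0 hp.1 hp.2
    rw [hR, h1, h0, Set.ncard_empty, Nat.cast_zero, zero_div, zero_mul]
  refine ⟨R / mainTerm r e - 1, ?_, by field_simp; ring⟩
  have hKe : |mainTerm r e|⁻¹ ≤ |K| := (hK (Set.mem_image_of_mem _ he)).trans (le_abs_self K)
  -- For trivial `G` the infimum over the empty index set is `0`, so that case falls under the
  -- second alternative.
  rcases le_or_gt (B + 1) m with hBm | hBm
  · have hmd (α : Idx r) : m ≤ d α := ciInf_le (OrderBot.bddBelow _) α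
    have h1 := hCB χ hχ d hd e he m hmd (by omega)
    rw [← hR] at h1
    refine le_add_of_le_of_nonneg ?_ hb₂
    rw [show R / mainTerm r e - 1 = (R - mainTerm r e) * (mainTerm r e)⁻¹ by field_simp, abs_mul,
      abs_inv]
    calc |R - mainTerm r e| * |mainTerm r e|⁻¹ ≤ (|C| * (sqrtq F)⁻¹ ^ m) * |K| :=
          mul_le_mul (h1.trans (mul_le_mul_of_nonneg_right (le_abs_self C) hT.le)) hKe
            (by positivity) (by positivity)
      _ = |C| * |K| * (sqrtq F)⁻¹ ^ m := by ring
  · refine le_add_of_nonneg_of_le hb₁ ?_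
    have hR0 : 0 ≤ R := by positivity
    have hR1 : R ≤ 1 := by
      rcases (Fhat F r d).finite_or_infinite with hf | hf
      · exact div_le_one_of_le₀ (by exact_mod_cast Set.ncard_le_ncard (Set.sep_subset _ _) hf)
          (by positivity)
      -- For an infinite set `ncard` is `0`, and the ratio takes the default value `0`.
      · rw [hR, hf.ncard, Nat.cast_zero, div_zero]
        exact zero_le_one
    have h1 : |R / mainTerm r e| ≤ |K| := by
      rw [abs_div, abs_of_nonneg hR0, div_eq_mul_inv]
      exact (mul_le_of_le_one_left (by positivity) hR1).trans hKe
    have h2 : 1 ≤ sqrtq F ^ (B + 1) * (sqrtq F)⁻¹ ^ m := by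
      rw [inv_pow, ← div_eq_mul_inv, one_le_div (by positivity)]
      exact pow_le_pow_right₀ one_lt_sqrtq.le hBm.le
    calc |R / mainTerm r e - 1| ≤ |R / mainTerm r e| + |1| := abs_sub _ _
      _ ≤ |K| + 1 := by rw [abs_one]; gcongr
      _ ≤ (|K| + 1) * (sqrtq F ^ (B + 1) * (sqrtq F)⁻¹ ^ m) :=
          le_mul_of_one_le_right (by positivity) h2
      _ = _ := by ring
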